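/- Let $d\in\mathbb N$ and let $G,\alpha:\mathbb R^d\to\mathbb R$ satisfy (A1) $G\in W^{1,\infty}_{\mathrm{loc}}(\mathbb R^d)$, $G$ is bounded from below, and $\int_{\mathbb R^d}e^{-G(x)}\,\mathrm dx<\infty$; (A2) $\alpha\in W^{1,\infty}(\mathbb R^d)$. Write $(x,v)\in\mathbb R^{2d}$, $\mu(\mathrm dx\,\mathrm dv)=Z_\mu^{-1}e^{-\frac12\|v\|^2-G(x)}\,\mathrm dx\,\mathrm dv$ with $Z_\mu$ the normalizing constant, $Y=L^2_\mu(\mathbb R^{2d})$ and $V_v=\{y\in Y:\nabla_v y\in Y^d\}$ with $\|y\|_{V_v}^2=\|y\|_Y^2+\|\nabla_v y\|_{Y^d}^2$. Let $A$ be the closure in $Y$ of the operator $$\mathcal L^*\varphi=-v^\top\nabla_x\varphi+\nabla_xG^\top\nabla_v\varphi-v^\top\nabla_v\varphi+\Delta_v\varphi,\qquad \varphi\in C_0^\infty(\mathbb R^{2d}),$$ let $A^\dagger$ be its Hilbert space adjoint in $Y$, and let $Y_{-1}=\mathcal D(A^\dagger)'$, where $\mathcal D(A^\dagger)$ carries the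 graph norm. Then $Y\subset Y_{-1}$, and $A$ extends to $(A^\dagger)'\in\mathcal B(Y,Y_{-1})$. The operator $N\varphi=(\nabla_x\alpha)^\top\nabla_v\varphi-\varphi\,(\nabla_x\alpha)^\top v$, $\varphi\in C_0^\infty(\mathbb R^{2d})$, extends continuously to $N\in\mathcal B(Y,Y_{-1})$. For every $y_0\in Y$ and every $w\in L^2_{\mathrm{loc}}(0,\infty;Y)$ (that is, $w\in L^2(0,T;Y)$ for all $T>0$), the problem $\dot y=Ay+Nw$, $y(0)=y_0$, has a unique solution in $Y_{-1}$, that is, a unique $y\in L^1_{\mathrm{loc}}(0,\infty;Y)\cap C([0,\infty);Y_{-1})$ with $$y(t)-y_0=\int_0^t\big(Ay(s)+Nw(s)\big)\,\mathrm ds\quad\text{in }Y_{-1}\text{ for all }t\ge0;$$ $A$ generates a $C_0$-semigroup $e^{At}$ on $Y$, which extends to $Y_{-1}$, and $y(t)\in Y$ is given by $y(t)=e^{At}y_0+\int_0^te^{A(t-s)}Nw(s)\,\mathrm ds$. This solution satisfies $\nabla_vy\in L^2_{\mathrm{loc}}(0,\infty;Y^d)$ and has a weak derivative $\dot y\in L^2_{\mathrm{loc}}(0,\infty;Y_{-1})$.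 Moreover there are a constant $C_1$ and, for every $T>0$, constants $C_2(T),C_3(T)$, none of them depending on $y_0$ or $w$, such that for all $T>0$ $$\max\big(\|y\|_{L^\infty(0,T;Y)},\|\nabla_vy\|_{L^2(0,T;Y^d)}\big)\le C_1\big(\|y_0\|_Y+\|w\|_{L^2(0,T;Y)}\big),$$ $$\|y\|_{L^2(0,T;V_v)}\le C_2(T)\big(\|y_0\|_Y+\|w\|_{L^2(0,T;Y)}\big),$$ $$\|\dot y\|_{L^2(0,T;Y_{-1})}\le C_3(T)\big(\|y_0\|_Y+\|w\|_{L^2(0,T;Y)}\big).$$ -/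

import Mathlib

open MeasureTheory Set Filter Topology
open scoped NNReal ENNReal ContDiff InnerProductSpace Gradient Laplacian LinearPMap

noncomputable section

namespace KFP

/-! ### Test functions and weak derivatives -/

/-- The space `ℝ^d` with its Euclidean norm. -/
abbrev E (d : ℕ) : Type := EuclideanSpace ℝ (Fin d)

/-- The phase space `ℝ^{2d}` of pairs `(x, v)`; its `volume` is Lebesgue measure. -/
abbrev Phase (d : ℕ) : Type := E d × E d

/-- Smooth functions with compact support. -/
def IsTest {X : Type*} [NormedAddCommGroup X] [NormedSpace ℝ X] (φ : X → ℝ) : Prop :=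
  ContDiff ℝ ∞ φ ∧ HasCompactSupport φ

/-- `g` is the weak derivative of `f` in the direction `e` (both locally integrable). -/
structure HasWeakDeriv {X : Type*} [NormedAddCommGroup X] [NormedSpace ℝ X] [MeasureSpace X]
    (f g : X → ℝ) (e : X) : Prop where
  locInt : LocallyIntegrable f volume
  locInt' : LocallyIntegrable g volume
  eq : ∀ φ : X → ℝ, IsTest φ → ∫ p, f p * fderiv ℝ φ p e = - ∫ p, g p * φ p

variable {d : ℕ}

/-- `g` is the weak gradient of `f : ℝ^d → ℝ`. -/
def IsWeakGrad (f : E d → ℝ) (g : E d → E d) : Prop :=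
  ∀ i : Fin d, HasWeakDeriv f (fun x => g x i) (EuclideanSpace.single i 1)

open Classical in
/-- The weak gradient of `f : ℝ^d → ℝ` (unique almost everywhere when it exists). -/
def weakGrad (f : E d → ℝ) : E d → E d :=
  if h : ∃ g, IsWeakGrad f g then h.choose else 0

/-- `g` is the weak gradient with respect to `v` of `f : ℝ^{2d} → ℝ`. -/
def IsWeakGradV (f : Phase d → ℝ) (g : Phase d → E d) : Prop :=
  ∀ i : Fin d, HasWeakDeriv f (fun p => g p i) (0, EuclideanSpace.single i 1)

/-- `f ∈ W^{1,∞}_loc(ℝ^d)`. -/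
def MemW1InftyLoc (f : E d → ℝ) : Prop :=
  (∀ K : Set (E d), IsCompact K → MemLp f ∞ (volume.restrict K)) ∧
    ∃ g, IsWeakGrad f g ∧ ∀ K : Set (E d), IsCompact K → MemLp g ∞ (volume.restrict K)

/-- `f ∈ W^{1,∞}(ℝ^d)`. -/
def MemW1Infty (f : E d → ℝ) : Prop :=
  MemLp f ∞ volume ∧ ∃ g, IsWeakGrad f g ∧ MemLp g ∞ volume

/-- The assumption on the confinement potential `G`. -/
structure AssumptionA1 (G : E d → ℝ) : Prop where
  memW : MemW1InftyLoc G
  bddBelow : ∃ c : ℝ, ∀ᵐ x, c ≤ G x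
  integrable : Integrable (fun x => Real.exp (-G x)) volume

/-- The assumption on the control potential `α`. -/
def AssumptionA2 (α : E d → ℝ) : Prop := MemW1Infty α

/-! ### The invariant measure and the spaces `Y`, `Y^d` -/

/-- The Hamiltonian `H(x, v) = ‖v‖² / 2 + G(x)`. -/
def hamiltonian (G : E d → ℝ) (p : Phase d) : ℝ := ‖p.2‖ ^ 2 / 2 + G p.1

/-- The normalization constant `Z_μ`. -/
def partitionFn (G : E d → ℝ) : ℝ := ∫ p : Phase d, Real.exp (-hamiltonian G p)

/-- The measure `μ(dx dv) = Z_μ⁻¹ exp(-H(x, v)) dx dv`. -/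
def gibbs (G : E d → ℝ) : Measure (Phase d) :=
  volume.withDensity fun p => ENNReal.ofReal ((partitionFn G)⁻¹ * Real.exp (-hamiltonian G p))

/-- `Y = L²_μ(ℝ^{2d})`. -/
abbrev Y (G : E d → ℝ) : Type := Lp ℝ 2 (gibbs G)

/-- `Y^d`, realized as `L²_μ(ℝ^{2d}; ℝ^d)` with `‖g‖² = ∑ᵢ ‖gᵢ‖²_Y`. -/
abbrev Yd (G : E d → ℝ) : Type := Lp (E d) 2 (gibbs G)

/-! ### The operator `A` -/

/-- `∇_x φ`. -/
def gradX (φ : Phase d → ℝ) (p : Phase d) : E d := ∇ (fun x => φ (x, p.2)) p.1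

/-- `∇_v φ`. -/
def gradV (φ : Phase d → ℝ) (p : Phase d) : E d := ∇ (fun v => φ (p.1, v)) p.2

/-- `Δ_v φ`. -/
def lapV (φ : Phase d → ℝ) (p : Phase d) : ℝ := Δ (fun v => φ (p.1, v)) p.2

/-- `𝓛* φ = -v·∇_x φ + ∇_x G·∇_v φ - v·∇_v φ + Δ_v φ`. -/
def Lstar (G : E d → ℝ) (φ : Phase d → ℝ) (p : Phase d) : ℝ :=
  -⟪p.2, gradX φ p⟫_ℝ + ⟪weakGrad G p.1, gradV φ p⟫_ℝ - ⟪p.2, gradV φ p⟫_ℝ + lapV φ p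

lemma IsTest.zero {X : Type*} [NormedAddCommGroup X] [NormedSpace ℝ X] :
    IsTest (0 : X → ℝ) := ⟨contDiff_const, HasCompactSupport.zero⟩

lemma IsTest.add {X : Type*} [NormedAddCommGroup X] [NormedSpace ℝ X] {φ ψ : X → ℝ}
    (h : IsTest φ) (h' : IsTest ψ) : IsTest (φ + ψ) := ⟨h.1.add h'.1, h.2.add h'.2⟩

lemma IsTest.smul {X : Type*} [NormedAddCommGroup X] [NormedSpace ℝ X] {φ : X → ℝ}
    (c : ℝ) (h : IsTest φ) : IsTest (c • φ) := ⟨h.1.const_smul c, h.2.smul_left (f := fun _ => c)⟩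

lemma gradient_add' {f g : E d → ℝ} {x : E d} (hf : DifferentiableAt ℝ f x)
    (hg : DifferentiableAt ℝ g x) : ∇ (f + g) x = ∇ f x + ∇ g x := by
  simp only [gradient, fderiv_add hf hg, map_add]

lemma gradient_smul' {f : E d → ℝ} {x : E d} (c : ℝ) (hf : DifferentiableAt ℝ f x) :
    ∇ (c • f) x = c • ∇ f x := by
  simp only [gradient, fderiv_const_smul hf c, map_smulₛₗ]; simp

lemma IsTest.sliceX {φ : Phase d → ℝ} (h : IsTest φ) (v : E d) :
    ContDiff ℝ ∞ fun x => φ (x, v) := h.1.comp (contDiff_id.prodMk contDiff_const)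

lemma IsTest.sliceV {φ : Phase d → ℝ} (h : IsTest φ) (x : E d) :
    ContDiff ℝ ∞ fun v => φ (x, v) := h.1.comp (contDiff_const.prodMk contDiff_id)

lemma Lstar_add (G : E d → ℝ) {φ ψ : Phase d → ℝ} (h : IsTest φ) (h' : IsTest ψ) :
    Lstar G (φ + ψ) = Lstar G φ + Lstar G ψ := by
  funext p
  have e1 := gradient_add' ((h.sliceX p.2).differentiable (by simp) p.1)
    ((h'.sliceX p.2).differentiable (by simp) p.1)
  have e2 := gradient_add' ((h.sliceV p.1).differentiable (by simp) p.2)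
    ((h'.sliceV p.1).differentiable (by simp) p.2)
  have e3 := ((contDiff_infty.1 (h.sliceV p.1) 2).contDiffAt (x := p.2)).laplacian_add
    ((contDiff_infty.1 (h'.sliceV p.1) 2).contDiffAt (x := p.2))
  change -⟪p.2, ∇ ((fun x => φ (x, p.2)) + fun x => ψ (x, p.2)) p.1⟫_ℝ
    + ⟪weakGrad G p.1, ∇ ((fun v => φ (p.1, v)) + fun v => ψ (p.1, v)) p.2⟫_ℝ
    - ⟪p.2, ∇ ((fun v => φ (p.1, v)) + fun v => ψ (p.1, v)) p.2⟫_ℝ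
    + Δ ((fun v => φ (p.1, v)) + fun v => ψ (p.1, v)) p.2 = _
  rw [e1, e2, e3]
  simp only [inner_add_right, Pi.add_apply, Lstar, gradX, gradV, lapV]
  ring

lemma Lstar_smul (G : E d → ℝ) (c : ℝ) {φ : Phase d → ℝ} (h : IsTest φ) :
    Lstar G (c • φ) = c • Lstar G φ := by
  funext p
  have e1 := gradient_smul' c ((h.sliceX p.2).differentiable (by simp) p.1)
  have e2 := gradient_smul' c ((h.sliceV p.1).differentiable (by simp) p.2)
  have e3 := InnerProductSpace.laplacian_smul c
    ((contDiff_infty.1 (h.sliceV p.1) 2).contDiffAt (x := p.2))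
  change -⟪p.2, ∇ (c • (fun x => φ (x, p.2))) p.1⟫_ℝ
    + ⟪weakGrad G p.1, ∇ (c • fun v => φ (p.1, v)) p.2⟫_ℝ
    - ⟪p.2, ∇ (c • fun v => φ (p.1, v)) p.2⟫_ℝ
    + Δ (c • fun v => φ (p.1, v)) p.2 = _
  rw [e1, e2, e3]
  simp only [inner_smul_right, Pi.smul_apply, smul_eq_mul, Lstar, gradX, gradV, lapV]
  ring

/-- The graph of `𝓛*` with domain `C₀^∞(ℝ^{2d})`, as a subspace of `Y × Y`. -/
def graphLstar (G : E d → ℝ) : Submodule ℝ (Y G × Y G) where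
  carrier := {q | ∃ φ : Phase d → ℝ, IsTest φ ∧ q.1 =ᵐ[gibbs G] φ ∧ q.2 =ᵐ[gibbs G] Lstar G φ}
  zero_mem' := by
    refine ⟨0, IsTest.zero, Lp.coeFn_zero _ _ _, ?_⟩
    have h0 : Lstar G (0 : Phase d → ℝ) = 0 := by
      simpa using Lstar_smul G 0 (IsTest.zero (X := Phase d))
    rw [h0]; exact Lp.coeFn_zero _ _ _
  add_mem' := by
    rintro ⟨a, a'⟩ ⟨b, b'⟩ ⟨φ, hφ, h1, h2⟩ ⟨ψ, hψ, h3, h4⟩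
    refine ⟨φ + ψ, hφ.add hψ, (Lp.coeFn_add a b).trans (h1.add h3), ?_⟩
    rw [Lstar_add G hφ hψ]
    exact (Lp.coeFn_add a' b').trans (h2.add h4)
  smul_mem' := by
    rintro c ⟨a, a'⟩ ⟨φ, hφ, h1, h2⟩
    refine ⟨c • φ, hφ.smul c, (Lp.coeFn_smul c a).trans (h1.const_smul c), ?_⟩
    rw [Lstar_smul G c hφ]
    exact (Lp.coeFn_smul c a').trans (h2.const_smul c)

/-- `A`, the closure in `Y` of `𝓛*` with domain `C₀^∞(ℝ^{2d})`. -/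
def opA (G : E d → ℝ) : Y G →ₗ.[ℝ] Y G := (graphLstar G).toLinearPMap.closure

/-! ### The space `Y_{-1} = 𝓓(A†)'` -/

/-- `𝓓(A†)` with the graph norm `(‖z‖² + ‖A† z‖²)^{1/2}`: its elements are the pairs `(z, A† z)`. -/
def DAdj (G : E d → ℝ) : Submodule ℝ (WithLp 2 (Y G × Y G)) :=
  (opA G)†.graph.comap (WithLp.linearEquiv 2 ℝ (Y G × Y G)).toLinearMap

/-- `Y_{-1}`, the dual of `𝓓(A†)`, with the dual norm. -/
abbrev Yneg (G : E d → ℝ) : Type := StrongDual ℝ (DAdj G)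

/-- The inclusion `z` of `𝓓(A†)` into `Y`. -/
def dIncl (G : E d → ℝ) : DAdj G →L[ℝ] Y G :=
  ContinuousLinearMap.fst ℝ (Y G) (Y G) ∘L
    (WithLp.prodContinuousLinearEquiv 2 ℝ (Y G) (Y G)).toContinuousLinearMap ∘L (DAdj G).subtypeL

/-- `A†` as a bounded operator from `𝓓(A†)` to `Y`. -/
def dAdj (G : E d → ℝ) : DAdj G →L[ℝ] Y G :=
  ContinuousLinearMap.snd ℝ (Y G) (Y G) ∘L
    (WithLp.prodContinuousLinearEquiv 2 ℝ (Y G) (Y G)).toContinuousLinearMap ∘L (DAdj G).subtypeL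

/-- The dual `T' : H → D'` of `T : D → H`, `⟨T' y, z⟩ = ⟨y, T z⟩_H`. -/
def dualMap {D H : Type*} [NormedAddCommGroup D] [NormedSpace ℝ D] [NormedAddCommGroup H]
    [InnerProductSpace ℝ H] (T : D →L[ℝ] H) : H →L[ℝ] StrongDual ℝ D :=
  LinearMap.mkContinuous₂
    (LinearMap.mk₂ ℝ (fun (y : H) (z : D) => ⟪y, T z⟫_ℝ)
      (fun _ _ _ => inner_add_left _ _ _)
      (fun _ _ _ => by simp [inner_smul_left])
      (fun _ _ _ => by simp [inner_add_right])
      (fun _ _ _ => by simp [inner_smul_right]))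
    ‖T‖ (fun y z => by
      have h1 : ‖⟪y, T z⟫_ℝ‖ ≤ ‖y‖ * ‖T z‖ := norm_inner_le_norm _ _
      have h2 : ‖y‖ * ‖T z‖ ≤ ‖y‖ * (‖T‖ * ‖z‖) :=
        mul_le_mul_of_nonneg_left (T.le_opNorm z) (norm_nonneg _)
      calc _ ≤ ‖y‖ * (‖T‖ * ‖z‖) := h1.trans h2
        _ = ‖T‖ * ‖y‖ * ‖z‖ := by ring)

@[simp] lemma dualMap_apply {D H : Type*} [NormedAddCommGroup D] [NormedSpace ℝ D]
    [NormedAddCommGroup H] [InnerProductSpace ℝ H] (T : D →L[ℝ] H) (y : H) (z : D) :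
    dualMap T y z = ⟪y, T z⟫_ℝ := rfl

/-- The embedding `Y ⊂ Y_{-1}`. -/
def emb (G : E d → ℝ) : Y G →L[ℝ] Yneg G := dualMap (dIncl G)

/-- The extension `(A†)'` of `A` to a bounded operator from `Y` to `Y_{-1}`. -/
def extA (G : E d → ℝ) : Y G →L[ℝ] Yneg G := dualMap (dAdj G)

/-! ### The control operator `N` -/

/-- `N φ = ∇_x α·∇_v φ - φ ∇_x α·v` for test functions `φ`. -/
def ctrl (α : E d → ℝ) (φ : Phase d → ℝ) (p : Phase d) : ℝ :=
  ⟪weakGrad α p.1, gradV φ p⟫_ℝ - φ p * ⟪weakGrad α p.1, p.2⟫_ℝ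

/-- `B ∈ 𝓑(Y, Y_{-1})` extends `N : C₀^∞(ℝ^{2d}) → Y ⊂ Y_{-1}`. -/
def IsCtrlExt (G α : E d → ℝ) (B : Y G →L[ℝ] Yneg G) : Prop :=
  ∀ φ : Phase d → ℝ, IsTest φ → ∃ f n : Y G,
    f =ᵐ[gibbs G] φ ∧ n =ᵐ[gibbs G] ctrl α φ ∧ B f = emb G n

open Classical in
/-- `N` as an element of `𝓑(Y, Y_{-1})`: the continuous extension of `N` from `C₀^∞(ℝ^{2d})`, which
is unique as `C₀^∞(ℝ^{2d})` is dense in `Y`. -/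
def opN (G α : E d → ℝ) : Y G →L[ℝ] Yneg G :=
  if h : ∃ B, IsCtrlExt G α B then h.choose else 0

/-! ### Solutions -/

/-- `f ∈ L²_loc(0,∞;X)`, that is, `f ∈ L²(0,T;X)` for every `T > 0`. -/
def MemL2Loc {X : Type*} [NormedAddCommGroup X] (f : ℝ → X) : Prop :=
  ∀ T > 0, MemLp f 2 (volume.restrict (Ioo 0 T))

/-- `u` is a solution in `Y_{-1}` of `y' = A y + N w`, `y(0) = y₀`: a function
`u ∈ L¹_loc(0,∞;Y) ∩ C([0,∞);Y_{-1})` that satisfies the integrated equation in `Y_{-1}`. Here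
`y` represents `u` as an element of `L¹_loc(0,∞;Y)`. -/
def IsSolution (G α : E d → ℝ) (y₀ : Y G) (w : ℝ → Y G) (u : ℝ → Yneg G) : Prop :=
  ContinuousOn u (Ici 0) ∧ ∃ y : ℝ → Y G,
    (∀ T > 0, IntegrableOn y (Ioo 0 T)) ∧
    (∀ᵐ t ∂volume.restrict (Ioi 0), u t = emb G (y t)) ∧
    ∀ t ≥ 0, u t - emb G y₀ = ∫ s in (0 : ℝ)..t, (extA G (y s) + opN G α (w s))

/-- `S` is a strongly continuous semigroup on `H` (only times `t ≥ 0` matter) with generator `A`. -/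
structure IsSemigroupOf {H : Type*} [NormedAddCommGroup H] [NormedSpace ℝ H]
    (A : H →ₗ.[ℝ] H) (S : ℝ → H →L[ℝ] H) : Prop where
  zero : S 0 = ContinuousLinearMap.id ℝ H
  add : ∀ s ≥ 0, ∀ t ≥ 0, S (s + t) = S s ∘L S t
  cont : ∀ y, ContinuousOn (fun t => S t y) (Ici 0)
  gen : ∀ y z, (y, z) ∈ A.graph ↔
    Tendsto (fun h : ℝ => h⁻¹ • (S h y - y)) (𝓝[>] 0) (𝓝 z)

/-- `y(t) = e^{At} y₀ + ∫₀ᵗ e^{A(t-s)} N w(s) ds` in `Y_{-1}` for `t ≥ 0`, where `S t = e^{At}` on `Y`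
and `B t` is the extension of `e^{At}` to `Y_{-1}` (unique as `Y` is dense in `Y_{-1}`). -/
def IsMildSolution (G α : E d → ℝ) (y₀ : Y G) (w : ℝ → Y G) (y : ℝ → Y G) : Prop :=
  ∃ (S : ℝ → Y G →L[ℝ] Y G) (B : ℝ → Yneg G →L[ℝ] Yneg G),
    IsSemigroupOf (opA G) S ∧ (∀ t ≥ 0, ∀ f, B t (emb G f) = emb G (S t f)) ∧
    ∀ t ≥ 0, emb G (y t) = emb G (S t y₀) + ∫ s in (0 : ℝ)..t, B (t - s) (opN G α (w s))

/-- `g` is the weak derivative on `(0,∞)` of `u : (0,∞) → X`. -/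
def IsWeakTimeDeriv {X : Type*} [NormedAddCommGroup X] [NormedSpace ℝ X] (u g : ℝ → X) : Prop :=
  ∀ ψ : ℝ → ℝ, IsTest ψ → tsupport ψ ⊆ Ioi 0 →
    ∫ t in Ioi (0 : ℝ), deriv ψ t • u t = - ∫ t in Ioi (0 : ℝ), ψ t • g t

end KFP

end

open MeasureTheory Set Filter Topology
open scoped NNReal ENNReal ContDiff InnerProductSpace Gradient Laplacian LinearPMap

noncomputable section

namespace KFP

set_option linter.unusedSectionVars false

/-! ### Generation of contraction semigroups by maximal dissipative operators -/

section Exponential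

variable {𝔸 : Type*} [NormedRing 𝔸] [NormedAlgebra ℝ 𝔸]

/-! In `L²_μ` the operator `𝓛*` is the sum of a transport part, antisymmetric by Liouville's
theorem, and an Ornstein-Uhlenbeck part, symmetric and nonpositive, so that `⟪𝓛*φ, φ⟫ = -‖∇_v φ‖²`
(`integral_Lstar_self`). The control is a divergence in `v`: `⟪Nφ, ψ⟫ = -⟪φ, ∇α·∇_v ψ⟫`
(`integral_ctrl_mul`), hence `|⟪Nφ, ψ⟫| ≤ ‖∇α‖_∞ ‖φ‖ ‖∇_v ψ‖`. Formally `d/dt ‖y‖² = -2‖∇_v y‖² +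
2⟪Nw, y⟫ ≤ -‖∇_v y‖² + C²‖w‖²`: the dissipation pays for the unboundedness of `N`, and the first
estimate, with a constant independent of `T`, is the integral of this inequality.

To make this rigorous, forcings `ψ(t) n` with smooth `ψ` are solved classically by means of the
semigroup. Such forcings are dense, differences of classical solutions satisfy the same energy
inequality, and so states and velocity gradients are Cauchy (`exists_isLimitSolution`). The equation
itself passes to the limit only in `Y_{-1}`, where `A` and `N` act as bounded maps. Uniqueness is
the dissipativity of `A` applied to the twice integrated difference of two solutions
(`eq_zero_of_integral_eq`). This part is carried out for an abstract dissipative operator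
(`exists_solution_of_isDissipationGraph`).

The main work is that `A` generates a semigroup. By the Hille-Yosida theorem this requires `l - 𝓛*`
to have dense range on test functions for large `l`, although `∇G` is merely locally bounded. If `f`
is orthogonal to the range, then `h = f exp(-H/2)` lies in `L²(dx dv)` and solves the adjoint of a
conjugated equation in the sense of distributions. Mollifiers that are much narrower in `v` than in
`x` almost commute with `v·∇_x`; they yield a localized energy inequality for `h`
(`integral_energy_nonpos`), and cutoffs adapted to the size of `∇G` then force `h = 0`
(`integral_ball_sq_le`).

Finally, the reflection `v ↦ -v` conjugates `A` to `A†` (`reflY_mem_graph_of_mem_adjoint`). Thus the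
range condition and the control bound hold for `A†` as well. The former identifies the domain of `A`
inside that of its extension, the latter bounds `N` from `Y` to `Y_{-1}` (`exists_norm_emb_le`). -/

lemma norm_normedSpace_exp_le [NormOneClass 𝔸] (x : 𝔸) :
    ‖NormedSpace.exp x‖ ≤ Real.exp ‖x‖ := by
  have hs : Summable fun n : ℕ => ‖x‖ ^ n / n.factorial := Real.summable_pow_div_factorial _
  rw [congrFun (NormedSpace.exp_eq_tsum ℝ (𝔸 := 𝔸)) x, Real.exp_eq_exp_ℝ,
    NormedSpace.exp_eq_tsum_div]
  refine tsum_of_norm_bounded hs.hasSum fun n => ?_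
  rw [norm_smul, norm_inv, Real.norm_natCast, inv_mul_eq_div]
  gcongr
  exact norm_pow_le x n

variable [CompleteSpace 𝔸]

/-- The scalar part of the exponent contributes exactly `exp (-c)`, which compensates the crude
bound `exp c` for the rest. With `x = l R(l)` this makes the Yosida approximations generate
contractions. -/
lemma norm_exp_smul_sub_algebraMap_le [NormOneClass 𝔸] {x : 𝔸} (hx : ‖x‖ ≤ 1) {c : ℝ}
    (hc : 0 ≤ c) : ‖NormedSpace.exp (c • x + algebraMap ℝ 𝔸 (-c))‖ ≤ 1 := by
  let : NormedAlgebra ℚ 𝔸 := NormedAlgebra.restrictScalars ℚ ℝ 𝔸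
  rw [NormedSpace.exp_add_of_commute (Algebra.commutes _ _).symm,
    ← NormedSpace.algebraMap_exp_comm, ← Real.exp_eq_exp_ℝ]
  calc _ ≤ ‖NormedSpace.exp (c • x)‖ * ‖algebraMap ℝ 𝔸 (Real.exp (-c))‖ := norm_mul_le _ _
    _ ≤ Real.exp c * Real.exp (-c) := by
        gcongr
        · refine (norm_normedSpace_exp_le _).trans (Real.exp_le_exp.2 ?_)
          rw [norm_smul, Real.norm_of_nonneg hc]
          nlinarith [norm_nonneg x]
        · rw [norm_algebraMap', Real.norm_of_nonneg (Real.exp_nonneg _)]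
    _ = 1 := by rw [← Real.exp_add]; simp

/-- This path runs from `exp (t P)` to `exp (t Q)`; its derivative carries the factor `Q - P`, which
allows the two endpoints to be compared. -/
lemma hasDerivAt_exp_mul_exp {P Q : 𝔸} (hPQ : Commute P Q) (t s : ℝ) :
    HasDerivAt (fun s : ℝ => NormedSpace.exp ((t - s) • P) * NormedSpace.exp (s • Q))
      (NormedSpace.exp ((t - s) • P) * NormedSpace.exp (s • Q) * (Q - P)) s := by
  let : NormedAlgebra ℚ 𝔸 := NormedAlgebra.restrictScalars ℚ ℝ 𝔸
  have h1 : HasDerivAt (fun s : ℝ => NormedSpace.exp ((t - s) • P))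
      ((-1 : ℝ) • (NormedSpace.exp ((t - s) • P) * P)) s :=
    (hasDerivAt_exp_smul_const (𝕂 := ℝ) P (t - s)).scomp s ((hasDerivAt_id s).const_sub t)
  have h2 := h1.mul (hasDerivAt_exp_smul_const (𝕂 := ℝ) Q s)
  refine h2.congr_deriv ?_
  have h3 : Commute P (NormedSpace.exp (s • Q)) := (hPQ.smul_right s).exp_right
  rw [mul_sub, mul_assoc _ _ Q, mul_assoc _ _ P, ← h3.eq]
  simp [mul_assoc]
  abel

lemma continuous_exp_smul (P : 𝔸) : Continuous fun s : ℝ => NormedSpace.exp (s • P) := by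
  let : NormedAlgebra ℚ 𝔸 := NormedAlgebra.restrictScalars ℚ ℝ 𝔸
  exact NormedSpace.exp_continuous.comp (continuous_id.smul continuous_const)

lemma exp_add_smul (P : 𝔸) (s t : ℝ) :
    NormedSpace.exp ((s + t) • P) = NormedSpace.exp (s • P) * NormedSpace.exp (t • P) := by
  let : NormedAlgebra ℚ 𝔸 := NormedAlgebra.restrictScalars ℚ ℝ 𝔸
  rw [add_smul, NormedSpace.exp_add_of_commute]
  exact ((Commute.refl P).smul_left s).smul_right t

end Exponential

section Generation

variable {H : Type*} [NormedAddCommGroup H] [InnerProductSpace ℝ H]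

/-- A densely defined operator `A` is maximal dissipative: `⟪A y, y⟫ ≤ 0`, and `l - A` is onto for
all `l ≥ l₀`. -/
structure IsMDissipative (A : H →ₗ.[ℝ] H) (l₀ : ℝ) : Prop where
  pos : 0 < l₀
  diss : ∀ y z, (y, z) ∈ A.graph → ⟪z, y⟫_ℝ ≤ 0
  range : ∀ l ≥ l₀, ∀ h, ∃ y z, (y, z) ∈ A.graph ∧ l • y - z = h
  dense : Dense (A.domain : Set H)

/-- Pairing `l • y - z` with `y` discards the dissipative term. The bound yields injectivity of `l -
A`, the resolvent estimate and the closedness of the range. -/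
lemma mul_norm_le_of_inner_nonpos {y z : H} (h : ⟪z, y⟫_ℝ ≤ 0) (l : ℝ) :
    l * ‖y‖ ≤ ‖l • y - z‖ := by
  rcases eq_or_ne y 0 with rfl | hy
  · simp
  have hy' : 0 < ‖y‖ := norm_pos_iff.2 hy
  have h1 : ⟪l • y - z, y⟫_ℝ ≤ ‖l • y - z‖ * ‖y‖ := real_inner_le_norm _ _
  rw [inner_sub_left, real_inner_smul_left, real_inner_self_eq_norm_sq] at h1
  nlinarith

lemma IsMDissipative.eq_of_sub_eq {A : H →ₗ.[ℝ] H} {l₀ : ℝ} (hA : IsMDissipative A l₀) {l : ℝ}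
    (hl : l₀ ≤ l) {y z y' z' : H} (h : (y, z) ∈ A.graph) (h' : (y', z') ∈ A.graph)
    (e : l • y - z = l • y' - z') : y = y' := by
  have h2 : (y - y', z - z') ∈ A.graph := A.graph.sub_mem h h'
  have h3 := mul_norm_le_of_inner_nonpos (hA.diss _ _ h2) l
  have h4 : l • (y - y') - (z - z') = 0 := by
    rw [smul_sub, sub_sub_sub_comm, e, sub_self]
  rw [h4, norm_zero] at h3
  have := hA.pos
  have h5 : ‖y - y'‖ ≤ 0 := by
    by_contra hc
    push Not at hc
    have : 0 < l * ‖y - y'‖ := mul_pos (by linarith) hc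
    linarith
  exact sub_eq_zero.1 (norm_le_zero_iff.1 h5)

/-- The resolvent of a maximal dissipative operator. -/
lemma IsMDissipative.exists_resolvent {A : H →ₗ.[ℝ] H} {l₀ : ℝ} (hA : IsMDissipative A l₀) {l : ℝ}
    (hl : l₀ ≤ l) :
    ∃ R : H →L[ℝ] H, (∀ h, (R h, l • R h - h) ∈ A.graph) ∧ (∀ h, l * ‖R h‖ ≤ ‖h‖) ∧
      ∀ y z, (y, z) ∈ A.graph → R (l • y - z) = y := by
  have hl0 : 0 < l := hA.pos.trans_le hl
  choose R Z hR hZ using hA.range l hl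
  have key : ∀ y z, (y, z) ∈ A.graph → R (l • y - z) = y := fun y z h =>
    hA.eq_of_sub_eq hl (hR _) h (hZ _)
  have hbd : ∀ h, l * ‖R h‖ ≤ ‖h‖ := fun h => by
    have := mul_norm_le_of_inner_nonpos (hA.diss _ _ (hR h)) l
    rwa [hZ] at this
  let R₀ : H →ₗ[ℝ] H :=
    { toFun := R
      map_add' := fun a b => by
        have h1 := key _ _ (A.graph.add_mem (hR a) (hR b))
        rw [← h1]
        congr 1
        rw [smul_add, add_sub_add_comm, hZ, hZ]
      map_smul' := fun c a => by
        have h1 := key _ _ (A.graph.smul_mem c (hR a))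
        change R (c • a) = c • R a
        rw [← h1]
        congr 1
        rw [smul_comm, ← smul_sub, hZ] }
  refine ⟨R₀.mkContinuous l⁻¹ fun h => ?_, fun h => ?_, hbd, key⟩
  · rw [inv_mul_eq_div, le_div_iff₀ hl0, mul_comm]
    exact hbd h
  · change (R h, l • R h - h) ∈ A.graph
    convert hR h
    nth_rewrite 2 [← hZ h]
    abel

variable [CompleteSpace H]

lemma norm_exp_smul_le_one {R : H →L[ℝ] H} {l : ℝ} (hl : 0 < l) (hR : ∀ h, l * ‖R h‖ ≤ ‖h‖)
    {t : ℝ} (ht : 0 ≤ t) :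
    ‖NormedSpace.exp (t • ((l ^ 2) • R - l • (1 : H →L[ℝ] H)))‖ ≤ 1 := by
  have h1 : ‖l • R‖ ≤ 1 := ContinuousLinearMap.opNorm_le_bound _ zero_le_one fun h => by
    simpa [norm_smul, abs_of_pos hl] using hR h
  have h2 : t • ((l ^ 2) • R - l • (1 : H →L[ℝ] H)) =
      (t * l) • (l • R) + algebraMap ℝ (H →L[ℝ] H) (-(t * l)) := by
    rw [Algebra.algebraMap_eq_smul_one]
    module
  -- The identity operator has norm one only if `H` is nontrivial.
  rcases subsingleton_or_nontrivial H with hs | hs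
  · have : NormedSpace.exp (t • ((l ^ 2) • R - l • (1 : H →L[ℝ] H))) = 0 :=
      ContinuousLinearMap.ext fun x => Subsingleton.elim _ _
    rw [this, norm_zero]
    exact zero_le_one
  rw [h2]
  exact norm_exp_smul_sub_algebraMap_le h1 (by positivity)

/-- Mean value inequality along the interpolating path: the exponentials are contractions and
commute with `Q - P`, which therefore acts directly on `x`. Only convergence on the single vector
`x` is needed later. -/
lemma norm_exp_sub_exp_apply_le {P Q : H →L[ℝ] H} (hPQ : Commute P Q)
    (hP : ∀ t ≥ 0, ‖NormedSpace.exp ((t : ℝ) • P)‖ ≤ 1)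
    (hQ : ∀ t ≥ 0, ‖NormedSpace.exp ((t : ℝ) • Q)‖ ≤ 1) {t : ℝ} (ht : 0 ≤ t) (x : H) :
    ‖NormedSpace.exp (t • Q) x - NormedSpace.exp (t • P) x‖ ≤ ‖Q x - P x‖ * t := by
  have hd' : ∀ s ∈ Icc 0 t, HasDerivWithinAt (fun s : ℝ => (NormedSpace.exp ((t - s) • P) *
      NormedSpace.exp (s • Q)) x)
      ((NormedSpace.exp ((t - s) • P) * NormedSpace.exp (s • Q) * (Q - P)) x) (Icc 0 t) s :=
    fun s _ => ((ContinuousLinearMap.apply ℝ H x).hasFDerivAt.comp_hasDerivAt s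
      (hasDerivAt_exp_mul_exp hPQ t s)).hasDerivWithinAt
  have hb : ∀ s ∈ Ico 0 t, ‖(NormedSpace.exp ((t - s) • P) * NormedSpace.exp (s • Q) *
      (Q - P)) x‖ ≤ ‖Q x - P x‖ := fun s hs => by
    have h1 : ‖NormedSpace.exp ((t - s) • P) * NormedSpace.exp (s • Q)‖ ≤ 1 :=
      (norm_mul_le _ _).trans
        (mul_le_one₀ (hP _ (by linarith [hs.2])) (norm_nonneg _) (hQ _ hs.1))
    calc _ ≤ ‖NormedSpace.exp ((t - s) • P) * NormedSpace.exp (s • Q)‖ * ‖(Q - P) x‖ :=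
          ContinuousLinearMap.le_opNorm _ _
      _ ≤ 1 * ‖(Q - P) x‖ := by gcongr
      _ = _ := by simp
  have := norm_image_sub_le_of_norm_deriv_le_segment' hd' hb t (right_mem_Icc.2 ht)
  simpa using this

end Generation

section Generation

variable {H : Type*} [NormedAddCommGroup H] [InnerProductSpace ℝ H]

/-- The properties of the contraction semigroup generated by `A`; it is extended by `S t = 1` to
negative times. -/
structure IsContractionSemigroupOf (A : H →ₗ.[ℝ] H) (S : ℝ → H →L[ℝ] H) : Prop
    extends IsSemigroupOf A S where
  neg : ∀ t ≤ 0, S t = ContinuousLinearMap.id ℝ H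
  norm_le : ∀ t x, ‖S t x‖ ≤ ‖x‖
  continuous : ∀ x, Continuous fun t => S t x
  integral_eq : ∀ y z, (y, z) ∈ A.graph → ∀ t ≥ 0, S t y = y + ∫ s in (0 : ℝ)..t, S s z

/-- The semigroup commutes with its generator. -/
lemma IsSemigroupOf.apply_mem_graph {A : H →ₗ.[ℝ] H} {S : ℝ → H →L[ℝ] H} (hS : IsSemigroupOf A S)
    {y z : H} (h : (y, z) ∈ A.graph) {t : ℝ} (ht : 0 ≤ t) : (S t y, S t z) ∈ A.graph := by
  rw [hS.gen]
  have h1 := ((S t).continuous.tendsto z).comp ((hS.gen y z).1 h)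
  refine h1.congr' ?_
  filter_upwards [self_mem_nhdsWithin] with r hr
  have hr' : 0 ≤ r := le_of_lt hr
  have h2 : S r (S t y) = S t (S r y) := by
    have e1 := congrArg (· y) (hS.add r hr' t ht)
    have e2 := congrArg (· y) (hS.add t ht r hr')
    simp only [ContinuousLinearMap.comp_apply] at e1 e2
    rw [← e1, ← e2, add_comm]
  simp [h2]

/-- A family of contractions that converges on a dense set converges everywhere. -/
lemma exists_tendsto_of_dense {F : ℕ → H →L[ℝ] H} (hF : ∀ n x, ‖F n x‖ ≤ ‖x‖) {D : Set H}
    (hD : Dense D) (h : ∀ x ∈ D, CauchySeq fun n => F n x) (x : H) :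
    CauchySeq fun n => F n x := by
  refine Metric.cauchySeq_iff'.2 fun ε hε => ?_
  obtain ⟨y, hy, hxy⟩ := Metric.dense_iff.1 hD x (ε / 3) (by positivity)
  obtain ⟨N, hN⟩ := Metric.cauchySeq_iff'.1 (h _ hxy) (ε / 3) (by positivity)
  refine ⟨N, fun n hn => ?_⟩
  have h1 : ∀ m, ‖F m x - F m y‖ < ε / 3 := fun m => by
    rw [← map_sub]
    refine (hF m _).trans_lt ?_
    rwa [← dist_eq_norm, dist_comm]
  have h2 := hN n hn
  rw [dist_eq_norm] at h2 ⊢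
  have h3 : F n x - F N x = (F n x - F n y) + (F n y - F N y) - (F N x - F N y) := by abel
  rw [h3]
  calc _ ≤ ‖F n x - F n y‖ + ‖F n y - F N y‖ + ‖F N x - F N y‖ :=
        (norm_sub_le _ _).trans (by gcongr; exact norm_add_le _ _)
    _ < ε := by linarith [h1 n, h1 N]

lemma tendsto_apply_of_tendsto {F : ℕ → H →L[ℝ] H} (hF : ∀ n x, ‖F n x‖ ≤ ‖x‖) {u : ℕ → H}
    {x y : H} (h : Tendsto (fun n => F n x) atTop (𝓝 y)) (hu : Tendsto u atTop (𝓝 x)) :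
    Tendsto (fun n => F n (u n)) atTop (𝓝 y) := by
  have h1 : Tendsto (fun n => F n (u n - x)) atTop (𝓝 0) := by
    refine squeeze_zero_norm (fun n => hF n _) ?_
    simpa using (hu.sub_const x).norm
  simpa using h1.add h

variable [CompleteSpace H]

/-- **Hille–Yosida theorem** for maximal dissipative operators on a Hilbert space. -/
theorem IsMDissipative.exists_semigroup {A : H →ₗ.[ℝ] H} {l₀ : ℝ} (hA : IsMDissipative A l₀) :
    ∃ S : ℝ → H →L[ℝ] H, IsContractionSemigroupOf A S := by
  have hl : ∀ n : ℕ, l₀ ≤ l₀ + n := fun n => by simp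
  have hl0 : ∀ n : ℕ, 0 < l₀ + n := fun n => hA.pos.trans_le (hl n)
  choose R hRg hRn hRi using fun n : ℕ => hA.exists_resolvent (hl n)
  -- The Yosida approximation `l A R(l) = l² R(l) - l` at `l = l₀ + n`.
  set P : ℕ → H →L[ℝ] H := fun n => ((l₀ + n) ^ 2) • R n - (l₀ + n) • (1 : H →L[ℝ] H) with hP
  -- the resolvents commute
  have hRR : ∀ n m h, R n h - R m h = ((l₀ + m) - (l₀ + n)) • R n (R m h) := fun n m h => by
    have h1 := hRi n _ _ (hRg m h)
    have h2 : (l₀ + n) • R m h - ((l₀ + m) • R m h - h) =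
      ((l₀ + n) - (l₀ + m)) • R m h + h := by module
    rw [h2, map_add, map_smul] at h1
    calc R n h - R m h = R n h - (((l₀ + n) - (l₀ + m)) • R n (R m h) + R n h) := by rw [h1]
      _ = _ := by module
  have hcomm : ∀ n m, Commute (R n) (R m) := fun n m => by
    rcases eq_or_ne n m with rfl | hnm
    · exact Commute.refl _
    refine ContinuousLinearMap.ext fun h => ?_
    have h1 := hRR n m h
    have h2 := hRR m n h
    have h3 : ((l₀ + m) - (l₀ + n)) • R n (R m h) = ((l₀ + m) - (l₀ + n)) • R m (R n h) := by
      rw [← h1, ← neg_sub (R m h), h2]; module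
    have h4 : ((l₀ + m) - (l₀ + n)) ≠ 0 := by
      simpa [sub_eq_zero] using hnm.symm
    exact smul_right_injective H h4 h3
  have hPP : ∀ n m, Commute (P n) (P m) := fun n m => by
    refine Commute.sub_left (Commute.sub_right ?_ ?_) ?_
    · exact ((hcomm n m).smul_left _).smul_right _
    · exact ((Commute.one_right _).smul_left _).smul_right _
    · exact (Commute.one_left _).smul_left _
  have hPexp : ∀ n, ∀ t ≥ 0, ‖NormedSpace.exp ((t : ℝ) • P n)‖ ≤ 1 := fun n t ht =>
    norm_exp_smul_le_one (hl0 n) (hRn n) ht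
  -- the Yosida approximations converge on the domain
  have hJ : ∀ z, Tendsto (fun n : ℕ => (l₀ + n) • R n z) atTop (𝓝 z) := by
    have hJn : ∀ (n : ℕ) x, ‖((l₀ + n) • R n) x‖ ≤ ‖x‖ := fun n x => by
      simpa [norm_smul, abs_of_pos (hl0 n)] using hRn n x
    have hJD : ∀ y z, (y, z) ∈ A.graph → Tendsto (fun n : ℕ => (l₀ + n) • R n y) atTop (𝓝 y) := by
      intro y z hyz
      have h1 : ∀ n : ℕ, (l₀ + n) • R n y - y = R n z := fun n => by
        have := hRi n _ _ hyz
        rw [map_sub, map_smul] at this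
        nth_rewrite 2 [← this]
        abel
      have h2 : Tendsto (fun n : ℕ => R n z) atTop (𝓝 0) := by
        refine squeeze_zero_norm (a := fun n : ℕ => ‖z‖ / (l₀ + n)) (fun n => ?_) ?_
        · rw [le_div_iff₀ (hl0 n), mul_comm]
          exact hRn n z
        · exact tendsto_const_nhds.div_atTop
            (tendsto_atTop_add_const_left _ _ tendsto_natCast_atTop_atTop)
      have h3 := h2.add_const y
      simp only [← h1, sub_add_cancel, zero_add] at h3
      exact h3
    intro z
    refine Metric.tendsto_atTop.2 fun ε hε => ?_
    obtain ⟨y, hy, hyD⟩ := Metric.dense_iff.1 hA.dense z (ε / 3) (by positivity)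
    obtain ⟨y', hyy'⟩ := LinearPMap.mem_domain_iff.1 hyD
    obtain ⟨N, hN⟩ := Metric.tendsto_atTop.1 (hJD _ _ hyy') (ε / 3) (by positivity)
    refine ⟨N, fun n hn => ?_⟩
    have h1 := hN n hn
    have h2 := hJn n (z - y)
    rw [Metric.mem_ball, dist_comm, dist_eq_norm] at hy
    rw [dist_eq_norm] at h1 ⊢
    have h3 : (l₀ + n) • R n z - z =
        ((l₀ + n) • R n) (z - y) + ((l₀ + n) • R n y - y) - (z - y) := by
      simp only [FunLike.coe_smul, Pi.smul_apply, map_sub]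
      abel
    rw [h3]
    calc _ ≤ ‖((l₀ + n) • R n) (z - y)‖ + ‖(l₀ + n) • R n y - y‖ + ‖z - y‖ :=
          (norm_sub_le _ _).trans (by gcongr; exact norm_add_le _ _)
      _ < ε := by linarith
  have hPx : ∀ y z, (y, z) ∈ A.graph → ∀ n, P n y = (l₀ + n) • R n z := fun y z hyz n => by
    have := hRi n _ _ hyz
    rw [map_sub, map_smul, sub_eq_iff_eq_add'] at this
    have h2 : P n y = (l₀ + n) • ((l₀ + n) • R n y - y) := by
      simp only [hP, sub_apply, FunLike.coe_smul, Pi.smul_apply,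
        one_apply_eq_self]
      module
    rw [h2, this]; module
  have hPt : ∀ y z, (y, z) ∈ A.graph → Tendsto (fun n => P n y) atTop (𝓝 z) := fun y z hyz => by
    simp only [hPx y z hyz]; exact hJ z
  -- the approximating semigroups
  set T : ℕ → ℝ → H →L[ℝ] H := fun n t => NormedSpace.exp ((max t 0) • P n) with hT
  have hTn : ∀ n t x, ‖T n t x‖ ≤ ‖x‖ := fun n t x => by
    refine ((T n t).le_opNorm x).trans ?_
    have := hPexp n (max t 0) (le_max_right _ _)
    nlinarith [norm_nonneg x]
  have hTc : ∀ n x, Continuous fun t => T n t x := fun n x =>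
    ((ContinuousLinearMap.apply ℝ H x).continuous.comp ((continuous_exp_smul (P n)).comp
      (continuous_id.max continuous_const)))
  have hTint : ∀ n x, ∀ t ≥ 0, T n t x - x = ∫ s in (0 : ℝ)..t, T n s (P n x) := fun n x t ht => by
    have hd : ∀ s : ℝ, HasDerivAt (fun s : ℝ => NormedSpace.exp (s • P n) x)
        (NormedSpace.exp (s • P n) (P n x)) s := fun s =>
      (ContinuousLinearMap.apply ℝ H x).hasFDerivAt.comp_hasDerivAt s
        (hasDerivAt_exp_smul_const (𝕂 := ℝ) (P n) s)
    have h1 := intervalIntegral.integral_eq_sub_of_hasDerivAt (a := 0) (b := t)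
      (fun s _ => hd s) (((ContinuousLinearMap.apply ℝ H (P n x)).continuous.comp
        (continuous_exp_smul (P n))).intervalIntegrable 0 t)
    have h2 : ∫ s in (0 : ℝ)..t, T n s (P n x) =
        ∫ s in (0 : ℝ)..t, NormedSpace.exp (s • P n) (P n x) := by
      refine intervalIntegral.integral_congr fun s hs => ?_
      rw [uIcc_of_le ht] at hs
      simp only [hT, max_eq_left hs.1]
    rw [h2, h1]
    simp [hT, max_eq_left ht]
  have hTcau : ∀ t x, CauchySeq fun n => T n t x := fun t => by
    refine exists_tendsto_of_dense (fun n x => hTn n t x) hA.dense fun y hy => ?_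
    obtain ⟨z, hyz⟩ := LinearPMap.mem_domain_iff.1 hy
    refine Metric.cauchySeq_iff'.2 fun ε hε => ?_
    have ht := le_max_right t 0
    obtain ⟨N, hN⟩ := Metric.cauchySeq_iff'.1 (hPt y z hyz).cauchySeq (ε / (max t 0 + 1))
      (by positivity)
    refine ⟨N, fun n hn => ?_⟩
    have h1 := norm_exp_sub_exp_apply_le (hPP N n) (hPexp N) (hPexp n) ht y
    have h2 := hN n hn
    rw [dist_eq_norm] at h2 ⊢
    refine h1.trans_lt ?_
    rw [lt_div_iff₀ (by positivity)] at h2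
    nlinarith [norm_nonneg (P n y - P N y)]
  choose s hs using fun t x => cauchySeq_tendsto_of_complete (hTcau t x)
  have hsn : ∀ t x, ‖s t x‖ ≤ ‖x‖ := fun t x =>
    le_of_tendsto (hs t x).norm (Eventually.of_forall fun n => hTn n t x)
  let S : ℝ → H →L[ℝ] H := fun t => LinearMap.mkContinuous
    { toFun := s t
      map_add' := fun x y => tendsto_nhds_unique (hs t (x + y))
        (by simpa using (hs t x).add (hs t y))
      map_smul' := fun c x => tendsto_nhds_unique (hs t (c • x))
        (by simpa using (hs t x).const_smul c) } 1 fun x => by simpa using hsn t x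
  have hS : ∀ t x, Tendsto (fun n => T n t x) atTop (𝓝 (S t x)) := hs
  have hSn : ∀ t x, ‖S t x‖ ≤ ‖x‖ := hsn
  have hSlip : ∀ y z, (y, z) ∈ A.graph → ∀ t ≥ 0, S t y - y = ∫ s in (0 : ℝ)..t, S s z := by
    intro y z hyz t ht
    refine tendsto_nhds_unique ((hS t y).sub_const y) ?_
    simp only [hTint _ y t ht]
    have hbd : ∃ C, ∀ n, ‖P n y‖ ≤ C :=
      (hPt y z hyz).norm.bddAbove_range.imp fun C hC n => hC ⟨n, rfl⟩
    obtain ⟨C, hC⟩ := hbd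
    refine intervalIntegral.tendsto_integral_filter_of_dominated_convergence (fun _ => C)
      (Eventually.of_forall fun n => (hTc n _).aestronglyMeasurable)
      (Eventually.of_forall fun n => ae_of_all _ fun s _ => (hTn n s _).trans (hC n))
      intervalIntegrable_const (ae_of_all _ fun s _ => ?_)
    exact tendsto_apply_of_tendsto (fun n x => hTn n s x) (hS s z) (hPt y z hyz)
  have hSmax : ∀ t, S t = S (max t 0) := fun t => by
    refine ContinuousLinearMap.ext fun x => tendsto_nhds_unique (hS t x) ?_
    have := hS (max t 0) x
    simpa [hT] using this
  have hSzero : S 0 = ContinuousLinearMap.id ℝ H := by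
    refine ContinuousLinearMap.ext fun x => tendsto_nhds_unique (hS 0 x) ?_
    simp [hT]
  have hSadd : ∀ s ≥ 0, ∀ t ≥ 0, S (s + t) = S s ∘L S t := fun s hs t ht => by
    refine ContinuousLinearMap.ext fun x => tendsto_nhds_unique (hS (s + t) x) ?_
    have h1 := tendsto_apply_of_tendsto (fun n x => hTn n s x) (hS s (S t x)) (hS t x)
    refine h1.congr fun n => ?_
    simp only [hT, max_eq_left hs, max_eq_left ht, max_eq_left (add_nonneg hs ht)]
    exact (congrArg (· x) (exp_add_smul (P n) s t)).symm
  -- strong continuity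
  have hTlip : ∀ n x, LipschitzWith ‖P n x‖₊ fun t => T n t x := fun n x => by
    have h0 : ∀ t ≥ 0, ∀ r ≥ t, ‖T n r x - T n t x‖ ≤ ‖P n x‖ * |r - t| := fun t ht r hr => by
      have h1 : T n r x - T n t x = ∫ s in t..r, T n s (P n x) := by
        rw [← sub_sub_sub_cancel_right _ _ x, hTint n x t ht, hTint n x r (ht.le.trans hr),
          intervalIntegral.integral_interval_sub_left ((hTc n _).intervalIntegrable _ _)
            ((hTc n _).intervalIntegrable _ _)]
      rw [h1]
      exact intervalIntegral.norm_integral_le_of_norm_le_const fun s _ => hTn n s _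
    have h1 : ∀ t r, t ≤ r → ‖T n r x - T n t x‖ ≤ ‖P n x‖ * |r - t| := fun t r h => by
      have := h0 (max t 0) (le_max_right _ _) (max r 0) (max_le_max h le_rfl)
      simp only [hT, max_assoc, max_self] at this ⊢
      exact this.trans
        (mul_le_mul_of_nonneg_left (abs_max_sub_max_le_abs r t 0) (norm_nonneg _))
    refine LipschitzWith.of_dist_le_mul fun t r => ?_
    rw [dist_eq_norm, Real.dist_eq, coe_nnnorm]
    rcases le_total t r with h | h
    · rw [norm_sub_rev, abs_sub_comm]; exact h1 t r h
    · exact h1 r t h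
  have hSc : ∀ x, Continuous fun t => S t x := fun x => by
    refine Metric.continuous_iff.2 fun t ε hε => ?_
    obtain ⟨y, hy, hyD⟩ := Metric.dense_iff.1 hA.dense x (ε / 3) (by positivity)
    obtain ⟨z, hyz⟩ := LinearPMap.mem_domain_iff.1 hyD
    have hlip : ∀ r t, ‖S r y - S t y‖ ≤ ‖z‖ * |r - t| := fun r t =>
      le_of_tendsto_of_tendsto ((hS r y).sub (hS t y)).norm
        ((hPt y z hyz).norm.mul_const _) (Eventually.of_forall fun n => by
          simpa [dist_eq_norm] using (hTlip n y).dist_le_mul r t)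
    refine ⟨ε / 3 / (‖z‖ + 1), by positivity, fun r hr => ?_⟩
    rw [Real.dist_eq, lt_div_iff₀ (by positivity)] at hr
    have h1 := hSn r (x - y)
    have h2 := hSn t (x - y)
    have h3 := hlip r t
    rw [Metric.mem_ball, dist_comm, dist_eq_norm] at hy
    rw [dist_eq_norm]
    have h4 : S r x - S t x = S r (x - y) + (S r y - S t y) - S t (x - y) := by
      simp only [map_sub]; abel
    rw [h4]
    calc _ ≤ ‖S r (x - y)‖ + ‖S r y - S t y‖ + ‖S t (x - y)‖ :=
          (norm_sub_le _ _).trans (by gcongr; exact norm_add_le _ _)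
      _ < ε := by nlinarith [abs_nonneg (r - t)]
  have hfwd : ∀ y z, (y, z) ∈ A.graph →
      Tendsto (fun h : ℝ => h⁻¹ • (S h y - y)) (𝓝[>] 0) (𝓝 z) := fun y z hyz => by
    have h1 := intervalIntegral.integral_hasDerivAt_right
      ((hSc z).intervalIntegrable 0 0) ((hSc z).stronglyMeasurableAtFilter _ _) (hSc z).continuousAt
    rw [hSzero] at h1
    have h2 := (hasDerivAt_iff_tendsto_slope.1 h1).mono_left
      (nhdsWithin_mono 0 (fun h hh => (ne_of_gt hh : h ≠ 0)) : 𝓝[>] (0 : ℝ) ≤ 𝓝[≠] 0)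
    refine h2.congr' ?_
    filter_upwards [self_mem_nhdsWithin] with h hh
    rw [slope, hSlip y z hyz h (le_of_lt hh)]
    simp
  refine ⟨S, ⟨hSzero, hSadd, fun y => (hSc y).continuousOn, fun y z => ⟨hfwd y z, fun h => ?_⟩⟩,
    fun t ht => by rw [hSmax, max_eq_right ht, hSzero], hSn, hSc, fun y z hyz t ht => by rw [← hSlip y z hyz t ht]; abel⟩
  -- the generator is dissipative, hence not larger than `A`
  obtain ⟨a, b, hab, he⟩ := hA.range l₀ le_rfl (l₀ • y - z)
  have h1 : Tendsto (fun h : ℝ => h⁻¹ • (S h (y - a) - (y - a))) (𝓝[>] 0) (𝓝 (z - b)) := by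
    refine (h.sub (hfwd a b hab)).congr fun r => ?_
    rw [← smul_sub, map_sub]; congr 1; abel
  -- Contractivity makes every difference quotient dissipative, hence also the limit. As `l₀` minus
  -- the generator sends `y - a` to zero, `y = a` follows.
  have h2 : ⟪z - b, y - a⟫_ℝ ≤ 0 := by
    refine le_of_tendsto (h1.inner tendsto_const_nhds) ?_
    filter_upwards [self_mem_nhdsWithin] with r hr
    rw [real_inner_smul_left, inner_sub_left, real_inner_self_eq_norm_sq]
    refine mul_nonpos_of_nonneg_of_nonpos (inv_nonneg.2 (le_of_lt hr)) ?_
    have h3 := real_inner_le_norm (S r (y - a)) (y - a)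
    nlinarith [hSn r (y - a), norm_nonneg (y - a)]
  have h3 := mul_norm_le_of_inner_nonpos h2 l₀
  have h4 : l₀ • (y - a) - (z - b) = 0 := by
    rw [smul_sub, sub_sub_sub_comm, he, sub_self]
  rw [h4, norm_zero] at h3
  have h5 : y = a := by
    have : ‖y - a‖ ≤ 0 := by
      by_contra hc
      push Not at hc
      linarith [mul_pos hA.pos hc]
    exact sub_eq_zero.1 (norm_le_zero_iff.1 this)
  have h6 : z = b := by
    rw [h5, sub_self, smul_zero, zero_sub, neg_eq_zero, sub_eq_zero] at h4
    exact h4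
  rwa [h5, h6]

end Generation

/-! ### Classical solutions of the forced problem -/

section Classical

variable {H K : Type*} [NormedAddCommGroup H] [InnerProductSpace ℝ H]
  [NormedAddCommGroup K] [InnerProductSpace ℝ K]

/-- `Γ` assigns to the elements `(y, z)` of the graph of `A` elements `g` of `K` with
`‖g‖² = -⟪z, y⟫`. -/
structure IsDissipationGraph (A : H →ₗ.[ℝ] H) (Γ : Submodule ℝ (H × H × K)) : Prop where
  norm_sq : ∀ y z g, (y, z, g) ∈ Γ → ‖g‖ ^ 2 = -⟪z, y⟫_ℝ
  exists_mem : ∀ y z, (y, z) ∈ A.graph → ∃ g, (y, z, g) ∈ Γ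
  mem_graph : ∀ y z g, (y, z, g) ∈ Γ → (y, z) ∈ A.graph

/-- The pairs `(f, n) ∈ 𝒩` satisfy `|⟪n, y⟫| ≤ C ‖f‖ ‖g‖` for `(y, z, g) ∈ Γ`. -/
def IsDominated (Γ : Submodule ℝ (H × H × K)) (𝒩 : Submodule ℝ (H × H)) (C : ℝ) : Prop :=
  ∀ f n, (f, n) ∈ 𝒩 → ∀ y z g, (y, z, g) ∈ Γ → |⟪n, y⟫_ℝ| ≤ C * ‖f‖ * ‖g‖

/-- `y` is a classical solution of `y' = A y + k`, with `z = A y`, with `g` assigned to `(y, z)` by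
`Γ`, and with `(w, k) ∈ 𝒩`. -/
structure IsClassical (S : ℝ → H →L[ℝ] H) (Γ : Submodule ℝ (H × H × K)) (𝒩 : Submodule ℝ (H × H))
    (w k y z : ℝ → H) (g : ℝ → K) : Prop where
  contW : Continuous w
  contK : Continuous k
  contY : Continuous y
  contZ : Continuous z
  contG : Continuous g
  mem : ∀ t, (y t, z t, g t) ∈ Γ
  memN : ∀ t, (w t, k t) ∈ 𝒩
  eq : ∀ t ≥ 0, y t = y 0 + ∫ s in (0 : ℝ)..t, (z s + k s)
  mild : ∀ t ≥ 0, y t = S t (y 0) + ∫ s in (0 : ℝ)..t, S (t - s) (k s)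

variable {A : H →ₗ.[ℝ] H} {S : ℝ → H →L[ℝ] H} {Γ : Submodule ℝ (H × H × K)}
  {𝒩 : Submodule ℝ (H × H)} {C : ℝ} {w k y z w' k' y' z' : ℝ → H} {g g' : ℝ → K}

lemma continuous_semigroup_apply (hS : IsContractionSemigroupOf A S) {r : ℝ → ℝ} (hr : Continuous r)
    {u : ℝ → H} (hu : Continuous u) : Continuous fun t => S (r t) (u t) := by
  refine continuous_iff_continuousAt.2 fun t₀ => ?_
  have h1 : Tendsto (fun t => S (r t) (u t - u t₀)) (𝓝 t₀) (𝓝 0) := by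
    refine squeeze_zero_norm (fun t => hS.norm_le _ _) ?_
    simpa using ((hu.tendsto t₀).sub_const (u t₀)).norm
  have h2 := h1.add (((hS.continuous (u t₀)).comp hr).tendsto t₀)
  simpa [ContinuousAt] using h2

lemma IsClassical.add (hS : IsContractionSemigroupOf A S) (h : IsClassical S Γ 𝒩 w k y z g)
    (h' : IsClassical S Γ 𝒩 w' k' y' z' g') :
    IsClassical S Γ 𝒩 (w + w') (k + k') (y + y') (z + z') (g + g') where
  contW := h.contW.add h'.contW
  contK := h.contK.add h'.contK
  contY := h.contY.add h'.contY
  contZ := h.contZ.add h'.contZ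
  contG := h.contG.add h'.contG
  mem t := Γ.add_mem (h.mem t) (h'.mem t)
  memN t := 𝒩.add_mem (h.memN t) (h'.memN t)
  eq t ht := by
    have h1 : ∀ s, (z + z') s + (k + k') s = (z s + k s) + (z' s + k' s) := fun s => by
      simp only [Pi.add_apply]; abel
    simp only [h1]
    have i1 : IntervalIntegrable (fun s => z s + k s) volume 0 t :=
      (h.contZ.add h.contK).intervalIntegrable _ _
    have i2 : IntervalIntegrable (fun s => z' s + k' s) volume 0 t :=
      (h'.contZ.add h'.contK).intervalIntegrable _ _
    rw [intervalIntegral.integral_add i1 i2]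
    simp only [Pi.add_apply]
    rw [h.eq t ht, h'.eq t ht]
    abel
  mild t ht := by
    have c1 : Continuous fun s => S (t - s) (k s) :=
      continuous_semigroup_apply hS (continuous_const.sub continuous_id) h.contK
    have c2 : Continuous fun s => S (t - s) (k' s) :=
      continuous_semigroup_apply hS (continuous_const.sub continuous_id) h'.contK
    simp only [Pi.add_apply, map_add]
    rw [intervalIntegral.integral_add (c1.intervalIntegrable _ _) (c2.intervalIntegrable _ _)]
    rw [h.mild t ht, h'.mild t ht]
    abel

lemma IsClassical.neg (h : IsClassical S Γ 𝒩 w k y z g) :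
    IsClassical S Γ 𝒩 (-w) (-k) (-y) (-z) (-g) where
  contW := h.contW.neg
  contK := h.contK.neg
  contY := h.contY.neg
  contZ := h.contZ.neg
  contG := h.contG.neg
  mem t := Γ.neg_mem (h.mem t)
  memN t := 𝒩.neg_mem (h.memN t)
  eq t ht := by
    have h1 : ∀ s, (-z) s + (-k) s = -(z s + k s) := fun s => by
      simp only [Pi.neg_apply]; abel
    simp only [h1, intervalIntegral.integral_neg]
    simp only [Pi.neg_apply]
    rw [h.eq t ht, neg_add]
  mild t ht := by
    simp only [Pi.neg_apply, map_neg, intervalIntegral.integral_neg]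
    rw [h.mild t ht]
    abel

lemma IsClassical.sub (hS : IsContractionSemigroupOf A S) (h : IsClassical S Γ 𝒩 w k y z g)
    (h₂ : IsClassical S Γ 𝒩 w' k' y' z' g') :
    IsClassical S Γ 𝒩 (w - w') (k - k') (y - y') (z - z') (g - g') := by
  simpa only [sub_eq_add_neg] using h.add hS h₂.neg

/-- The energy inequality. -/
lemma IsClassical.energy [CompleteSpace H] (hΓ : IsDissipationGraph A Γ) (h𝒩 : IsDominated Γ 𝒩 C)
    (h : IsClassical S Γ 𝒩 w k y z g) {T : ℝ} (hT : 0 ≤ T) :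
    ‖y T‖ ^ 2 + ∫ s in (0 : ℝ)..T, ‖g s‖ ^ 2 ≤
      ‖y 0‖ ^ 2 + C ^ 2 * ∫ s in (0 : ℝ)..T, ‖w s‖ ^ 2 := by
  have hc : Continuous fun s => z s + k s := h.contZ.add h.contK
  have hd : ∀ t ∈ Ioo 0 T, HasDerivAt (fun s => ‖y s‖ ^ 2) (2 * ⟪y t, z t + k t⟫_ℝ) t := by
    intro t ht
    have h1 : HasDerivAt (fun t => y 0 + ∫ s in (0 : ℝ)..t, (z s + k s)) (z t + k t) t :=
      (intervalIntegral.integral_hasDerivAt_right (hc.intervalIntegrable 0 t)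
        (hc.stronglyMeasurableAtFilter _ _) hc.continuousAt).const_add _
    have h2 : HasDerivAt y (z t + k t) t := by
      refine h1.congr_of_eventuallyEq ?_
      filter_upwards [Ioi_mem_nhds ht.1] with s hs using h.eq s (le_of_lt hs)
    exact h2.norm_sq
  have hi : IntervalIntegrable (fun t => 2 * ⟪y t, z t + k t⟫_ℝ) volume 0 T :=
    (continuous_const.mul (h.contY.inner hc)).intervalIntegrable _ _
  have h1 := intervalIntegral.integral_eq_sub_of_hasDerivAt_of_le hT
    (h.contY.norm.pow 2).continuousOn hd hi
  have ig : IntervalIntegrable (fun t => ‖g t‖ ^ 2) volume 0 T :=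
    (h.contG.norm.pow 2).intervalIntegrable _ _
  have iw : IntervalIntegrable (fun t => C ^ 2 * ‖w t‖ ^ 2) volume 0 T :=
    (continuous_const.mul (h.contW.norm.pow 2)).intervalIntegrable _ _
  -- Pointwise, `2⟪y, z + k⟫ = -2‖g‖² + 2⟪k, y⟫ ≤ -2‖g‖² + 2C‖w‖‖g‖ ≤ C²‖w‖² - ‖g‖²`: half of the
  -- dissipation absorbs the forcing.
  have h2 : ∫ t in (0 : ℝ)..T, 2 * ⟪y t, z t + k t⟫_ℝ ≤
      ∫ t in (0 : ℝ)..T, (C ^ 2 * ‖w t‖ ^ 2 - ‖g t‖ ^ 2) := by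
    refine intervalIntegral.integral_mono_on hT hi (iw.sub ig) fun t _ => ?_
    have e1 := hΓ.norm_sq _ _ _ (h.mem t)
    have e2 := h𝒩 _ _ (h.memN t) _ _ _ (h.mem t)
    rw [inner_add_right, real_inner_comm, real_inner_comm (k t)]
    have e3 := (le_abs_self _).trans e2
    nlinarith [sq_nonneg (C * ‖w t‖ - ‖g t‖)]
  rw [intervalIntegral.integral_sub iw ig, intervalIntegral.integral_const_mul (C ^ 2), h1] at h2
  simp only [Pi.pow_apply] at h2
  linarith

/-- A continuous choice of elements assigned by `Γ` is automatic. -/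
lemma IsDissipationGraph.continuous (hΓ : IsDissipationGraph A Γ) (hy : Continuous y)
    (hz : Continuous z) (h : ∀ t, (y t, z t, g t) ∈ Γ) : Continuous g := by
  refine continuous_iff_continuousAt.2 fun t₀ => ?_
  have h1 : ∀ t, ‖g t - g t₀‖ ^ 2 = -⟪z t - z t₀, y t - y t₀⟫_ℝ := fun t =>
    hΓ.norm_sq _ _ _ (Γ.sub_mem (h t) (h t₀))
  have h2 : Tendsto (fun t => ‖g t - g t₀‖ ^ 2) (𝓝 t₀) (𝓝 0) := by
    simp only [h1]
    have : Tendsto (fun t => ⟪z t - z t₀, y t - y t₀⟫_ℝ) (𝓝 t₀) _ :=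
      (((hz.tendsto t₀).sub_const (z t₀)).inner ((hy.tendsto t₀).sub_const (y t₀)))
    simpa using this.neg
  have h3 := h2.sqrt
  simp only [Real.sqrt_sq (norm_nonneg _), Real.sqrt_zero] at h3
  exact tendsto_iff_norm_sub_tendsto_zero.2 h3

end Classical

section Classical

variable {H K : Type*} [NormedAddCommGroup H] [InnerProductSpace ℝ H]
  [NormedAddCommGroup K] [InnerProductSpace ℝ K]
  {A : H →ₗ.[ℝ] H} {S : ℝ → H →L[ℝ] H} {Γ : Submodule ℝ (H × H × K)}
  {𝒩 : Submodule ℝ (H × H)} {C : ℝ} {w k y z w' k' y' z' : ℝ → H} {g g' : ℝ → K}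

/-- Unforced orbits from the domain; added to a forced solution starting at zero, they supply the
initial value. -/
lemma isClassical_homogeneous (hS : IsContractionSemigroupOf A S)
    (hΓ : IsDissipationGraph A Γ) {y₀ z₀ : H}
    (h : (y₀, z₀) ∈ A.graph) :
    ∃ g, IsClassical S Γ 𝒩 (fun _ => 0) (fun _ => 0) (fun t => S t y₀) (fun t => S t z₀) g := by
  have h1 : ∀ t, (S t y₀, S t z₀) ∈ A.graph := fun t => by
    rcases le_total 0 t with ht | ht
    · exact hS.apply_mem_graph h ht
    · simpa [hS.neg t ht] using h
  choose g hg using fun t => hΓ.exists_mem _ _ (h1 t)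
  exact ⟨g, continuous_const, continuous_const, hS.continuous _, hS.continuous _,
    hΓ.continuous (hS.continuous _) (hS.continuous _) hg, hg, fun _ => 𝒩.zero_mem,
    fun t ht => by simpa [hS.zero] using hS.integral_eq _ _ h t ht, fun t _ => by simp [hS.zero]⟩

/-- Writing the Duhamel integral as a convolution over the whole line makes it differentiable in `t`
by the general theory, with the derivative falling on `χ`. -/
lemma convolution_indicator_eq {χ : ℝ → ℝ} (hχ : ∀ t ≤ 0, χ t = 0) (u : ℝ → H) {t : ℝ}
    (ht : 0 ≤ t) :
    (convolution χ ((Ici 0).indicator u) (ContinuousLinearMap.lsmul ℝ ℝ) volume : ℝ → H) t =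
      ∫ s in (0 : ℝ)..t, χ (t - s) • u s := by
  rw [convolution_lsmul_swap, intervalIntegral.integral_of_le ht, ← integral_Icc_eq_integral_Ioc,
    ← integral_indicator measurableSet_Icc]
  congr 1
  ext s
  by_cases h1 : 0 ≤ s
  · by_cases h2 : s ≤ t
    · rw [indicator_of_mem (show s ∈ Ici 0 from h1), indicator_of_mem (show s ∈ Icc 0 t from ⟨h1, h2⟩)]
    · rw [indicator_of_notMem (show s ∉ Icc 0 t from fun h => h2 h.2),
        hχ _ (by linarith), zero_smul]
  · rw [indicator_of_notMem (show s ∉ Ici 0 from h1),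
      indicator_of_notMem (show s ∉ Icc 0 t from fun h => h1 h.1), smul_zero]

lemma convolution_indicator_eq_zero {χ : ℝ → ℝ} (hχ : ∀ t ≤ 0, χ t = 0) (u : ℝ → H) {t : ℝ}
    (ht : t ≤ 0) :
    (convolution χ ((Ici 0).indicator u) (ContinuousLinearMap.lsmul ℝ ℝ) volume : ℝ → H) t = 0 := by
  rw [convolution_lsmul_swap]
  refine (integral_congr_ae (ae_of_all _ fun s => ?_)).trans (integral_zero _ _)
  by_cases h1 : 0 ≤ s
  · simp [hχ (t - s) (by linarith)]
  · simp [indicator_of_notMem (show s ∉ Ici 0 from h1)]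

/-- The forcing `k(t) = ψ(t) n` admits a classical solution. -/
lemma isClassical_forced [CompleteSpace H] {l₀ : ℝ} (hA : IsMDissipative A l₀)
    (hS : IsContractionSemigroupOf A S) (hΓ : IsDissipationGraph A Γ) {f n : H} (hn : (f, n) ∈ 𝒩)
    {ψ : ℝ → ℝ} (hψ : IsTest ψ) (hψ0 : ∀ t ≤ 0, ψ t = 0) :
    ∃ y z g, y 0 = 0 ∧ IsClassical S Γ 𝒩 (fun t => ψ t • f) (fun t => ψ t • n) y z g := by
  set L : ℝ →L[ℝ] H →L[ℝ] H := ContinuousLinearMap.lsmul ℝ ℝ with hL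
  set u : ℝ → H := (Ici 0).indicator fun s => S s n with hu
  have hψc : Continuous ψ := hψ.1.continuous
  have hψ1 : ContDiff ℝ 1 ψ := hψ.1.of_le (by exact_mod_cast le_top)
  have hψ'c : Continuous (deriv ψ) := hψ1.continuous_deriv le_rfl
  have hψd : ∀ t, HasDerivAt ψ (deriv ψ t) t := fun t =>
    (hψ1.differentiable one_ne_zero t).hasDerivAt
  -- The left derivative determines `deriv ψ t`, also at the endpoint `t = 0`.
  have hψ'0 : ∀ t ≤ 0, deriv ψ t = 0 := fun t ht => by
    have h1 : HasDerivWithinAt ψ (deriv ψ t) (Iic t) t := (hψd t).hasDerivWithinAt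
    have h2 : HasDerivWithinAt ψ 0 (Iic t) t :=
      (hasDerivWithinAt_const t (Iic t) (0 : ℝ)).congr (fun s hs => hψ0 s (hs.trans ht)) (hψ0 t ht)
    exact (uniqueDiffWithinAt_Iic t).eq_deriv _ h1 h2
  have hul : LocallyIntegrable u volume :=
    (hS.continuous n).locallyIntegrable.indicator measurableSet_Ici
  set y : ℝ → H := convolution ψ u L volume with hy
  set y₁ : ℝ → H := convolution (deriv ψ) u L volume with hy₁
  set z : ℝ → H := fun t => y₁ t - ψ t • n with hz
  have hyd : ∀ t, HasDerivAt y (y₁ t) t := fun t =>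
    hψ.2.hasDerivAt_convolution_left L hψ1 hul t
  have hy₁c : Continuous y₁ :=
    hψ.2.deriv.continuous_convolution_left L hψ'c hul
  have hyc : Continuous y := continuous_iff_continuousAt.2 fun t => (hyd t).continuousAt
  have hzc : Continuous z := hy₁c.sub (hψc.smul continuous_const)
  have hy0 : ∀ t ≤ 0, y t = 0 := fun t ht => convolution_indicator_eq_zero hψ0 _ ht
  have hyI : ∀ t ≥ 0, y t = ∫ s in (0 : ℝ)..t, ψ (t - s) • S s n := fun t ht =>
    convolution_indicator_eq hψ0 _ ht
  have hy₁I : ∀ t ≥ 0, y₁ t = ∫ s in (0 : ℝ)..t, deriv ψ (t - s) • S s n := fun t ht =>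
    convolution_indicator_eq hψ'0 _ ht
  have hgr : ∀ t, (y t, z t) ∈ A.graph := fun t => by
    rcases le_total t 0 with ht | ht
    · have h1 : z t = 0 := by
        simp only [hz, hψ0 t ht, zero_smul, sub_zero]
        exact convolution_indicator_eq_zero hψ'0 _ ht
      rw [hy0 t ht, h1]
      exact A.graph.zero_mem
    -- Membership in the graph amounts to `R (l₀ y - z) = y`. After application of `R`, the orbit `S
    -- s (R n)` is differentiable, although `S s n` need not be, and integration by parts relates
    -- the integral against `ψ` to the one against `ψ'`.
    obtain ⟨R, hRg, hRn, hRi⟩ := hA.exists_resolvent le_rfl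
    have hRS : ∀ s ≥ 0, R (S s n) = S s (R n) := fun s hs => by
      have h1 := hS.apply_mem_graph (hRg n) hs
      have h2 := hRi _ _ h1
      rwa [← map_smul, ← map_sub, sub_sub_cancel] at h2
    set b : H := l₀ • R n - n with hb
    have hbc : Continuous fun s => S s b := hS.continuous b
    have hv : ∀ s ∈ Ioo (min 0 t) (max 0 t), HasDerivAt (fun s => S s (R n)) (S s b) s := by
      intro s hs
      rw [min_eq_left ht, max_eq_right ht] at hs
      have h1 : HasDerivAt (fun s => R n + ∫ r in (0 : ℝ)..s, S r b) (S s b) s :=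
        (intervalIntegral.integral_hasDerivAt_right (hbc.intervalIntegrable 0 s)
          (hbc.stronglyMeasurableAtFilter _ _) hbc.continuousAt).const_add _
      refine h1.congr_of_eventuallyEq ?_
      filter_upwards [Ioi_mem_nhds hs.1] with r hr using hS.integral_eq _ _ (hRg n) r (le_of_lt hr)
    have hψt : Continuous fun s => ψ (t - s) := hψc.comp (continuous_const.sub continuous_id)
    have hψt' : Continuous fun s => deriv ψ (t - s) :=
      hψ'c.comp (continuous_const.sub continuous_id)
    have hibp := intervalIntegral.integral_smul_deriv_eq_deriv_smul_of_hasDerivAt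
      (u := fun s => ψ (t - s)) (u' := fun s => -deriv ψ (t - s)) (v := fun s => S s (R n))
      (v' := fun s => S s b) (a := 0) (b := t) hψt.continuousOn (hS.continuous _).continuousOn
      (fun s _ => by
        have := (hψd (t - s)).comp s ((hasDerivAt_id s).const_sub t)
        rw [mul_neg_one] at this
        exact this) hv (hψt'.neg.intervalIntegrable _ _) (hbc.intervalIntegrable _ _)
    simp only [sub_self, hψ0 0 le_rfl, zero_smul, sub_zero, hS.zero, ContinuousLinearMap.id_apply,
      neg_smul, intervalIntegral.integral_neg, zero_sub, sub_neg_eq_add] at hibp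
    have ci : ∀ x, IntervalIntegrable (fun s => ψ (t - s) • S s x) volume 0 t := fun x =>
      (hψt.smul (hS.continuous x)).intervalIntegrable _ _
    have ci' : ∀ x, IntervalIntegrable (fun s => deriv ψ (t - s) • S s x) volume 0 t := fun x =>
      (hψt'.smul (hS.continuous x)).intervalIntegrable _ _
    have hRy : R (y t) = ∫ s in (0 : ℝ)..t, ψ (t - s) • S s (R n) := by
      rw [hyI t ht, ← ContinuousLinearMap.intervalIntegral_comp_comm R (ci n)]
      refine intervalIntegral.integral_congr fun s hs => ?_
      rw [uIcc_of_le ht] at hs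
      simp [hRS s hs.1]
    have hRy₁ : R (y₁ t) = ∫ s in (0 : ℝ)..t, deriv ψ (t - s) • S s (R n) := by
      rw [hy₁I t ht, ← ContinuousLinearMap.intervalIntegral_comp_comm R (ci' n)]
      refine intervalIntegral.integral_congr fun s hs => ?_
      rw [uIcc_of_le ht] at hs
      simp [hRS s hs.1]
    have hb' : ∫ s in (0 : ℝ)..t, ψ (t - s) • S s b = l₀ • R (y t) - y t := by
      rw [hRy, hyI t ht, ← intervalIntegral.integral_smul, ← intervalIntegral.integral_sub]
      · refine intervalIntegral.integral_congr fun s _ => ?_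
        simp only [hb, map_sub, map_smul, smul_sub]
        rw [smul_comm]
      · exact (ci _).smul l₀
      · exact ci _
    rw [hb', ← hRy₁] at hibp
    have h1 : R (l₀ • y t - z t) = y t := by
      simp only [hz, map_sub, map_smul]
      have : R (y₁ t) = l₀ • R (y t) - y t + ψ t • R n := by rw [hibp]; abel
      rw [this]; abel
    have h2 := hRg (l₀ • y t - z t)
    rwa [h1, sub_sub_cancel] at h2
  choose g hg using fun t => hΓ.exists_mem _ _ (hgr t)
  refine ⟨y, z, g, hy0 0 le_rfl, hψc.smul continuous_const, hψc.smul continuous_const, hyc, hzc,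
    hΓ.continuous hyc hzc hg, hg, fun t => 𝒩.smul_mem (ψ t) hn, fun t _ => ?_, fun t ht => ?_⟩
  · have h1 := intervalIntegral.integral_eq_sub_of_hasDerivAt (fun s _ => hyd s)
      (hy₁c.intervalIntegrable 0 t)
    simp only [hz, sub_add_cancel, h1]
    abel
  · rw [hy0 0 le_rfl, map_zero, zero_add, hyI t ht]
    -- The substitution `s ↦ t - s` gives Duhamel's form.
    have h1 := intervalIntegral.integral_comp_sub_left (fun s => ψ (t - s) • S s n) t
      (a := 0) (b := t)
    simp only [sub_self, sub_zero, sub_sub_cancel] at h1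
    rw [← h1]
    simp

end Classical

/-! ### Dense classes of functions of time -/

section Density

lemma memLp_two_of_continuous {F : Type*} [NormedAddCommGroup F] {f : ℝ → F} (hf : Continuous f)
    (T : ℝ) : MemLp f 2 (volume.restrict (Ioo 0 T)) := by
  obtain ⟨M, hM⟩ := isCompact_Icc.exists_bound_of_continuousOn (s := Icc 0 T) hf.continuousOn
  refine MemLp.of_bound hf.aestronglyMeasurable M ?_
  exact (ae_restrict_iff' measurableSet_Ioo).2 (ae_of_all _ fun t ht => hM t (Ioo_subset_Icc_self ht))

lemma eLpNorm_two_eq_sqrt {F : Type*} [NormedAddCommGroup F] {f : ℝ → F} (hf : Continuous f) {T : ℝ}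
    (hT : 0 ≤ T) : eLpNorm f 2 (volume.restrict (Ioo 0 T)) =
      ENNReal.ofReal (√(∫ s in (0 : ℝ)..T, ‖f s‖ ^ 2)) := by
  rw [(memLp_two_of_continuous hf T).eLpNorm_eq_integral_rpow_norm two_ne_zero ENNReal.ofNat_ne_top,
    intervalIntegral.integral_of_le hT, integral_Ioc_eq_integral_Ioo, Real.sqrt_eq_rpow]
  simp

/-- Test functions that vanish for negative times are dense. -/
lemma exists_isTest_vanishing {ψ : ℝ → ℝ} (hψ : IsTest ψ) {ε : ℝ} (hε : 0 < ε) :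
    ∃ χ : ℝ → ℝ, IsTest χ ∧ (∀ t ≤ 0, χ t = 0) ∧
      eLpNorm (χ - ψ) 2 (volume.restrict (Ioi 0)) ≤ ENNReal.ofReal ε := by
  obtain ⟨M, hM⟩ := hψ.1.continuous.bounded_above_of_compact_support hψ.2
  have hM0 : 0 ≤ M := (norm_nonneg _).trans (hM 0)
  -- The cutoff changes `ψ` only on `(0, δ)`, at an `L²` cost of at most `M √δ = M ε / (M + 1) ≤ ε`.
  set δ : ℝ := (ε / (M + 1)) ^ 2 with hδ
  have hδ0 : 0 < δ := by positivity
  set θ : ℝ → ℝ := fun t => Real.smoothTransition (t / δ) with hθ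
  have hθc : ContDiff ℝ ∞ θ := Real.smoothTransition.contDiff.comp (contDiff_id.div_const δ)
  refine ⟨fun t => θ t * ψ t, ⟨hθc.mul hψ.1, hψ.2.mul_left⟩, fun t ht => ?_, ?_⟩
  · rw [hθ]
    simp only
    rw [Real.smoothTransition.zero_of_nonpos (div_nonpos_of_nonpos_of_nonneg ht hδ0.le), zero_mul]
  have h1 : eLpNorm ((fun t => θ t * ψ t) - ψ) 2 (volume.restrict (Ioi 0)) ≤
      eLpNorm ((Ioo 0 δ).indicator fun _ => M) 2 volume := by
    rw [← eLpNorm_indicator_eq_eLpNorm_restrict measurableSet_Ioi]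
    refine eLpNorm_mono_real fun t => ?_
    by_cases ht : 0 < t
    · rw [indicator_of_mem (show t ∈ Ioi 0 from ht)]
      by_cases ht' : t < δ
      · rw [indicator_of_mem (show t ∈ Ioo 0 δ from ⟨ht, ht'⟩)]
        have e1 := Real.smoothTransition.nonneg (t / δ)
        have e2 := Real.smoothTransition.le_one (t / δ)
        have e3 : (((fun t => θ t * ψ t) - ψ) t) = -((1 - θ t) * ψ t) := by
          simp only [Pi.sub_apply]; ring
        rw [e3, norm_neg, norm_mul, Real.norm_of_nonneg (by simp only [hθ]; linarith)]
        calc _ ≤ 1 * M := by gcongr; exacts [by simp only [hθ]; linarith, hM t]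
          _ = M := one_mul M
      · have e2 : θ t = 1 := Real.smoothTransition.one_of_one_le (by
          rw [le_div_iff₀ hδ0]; linarith)
        simp [e2, indicator_of_notMem (show t ∉ Ioo 0 δ from fun h => ht' h.2)]
    · rw [indicator_of_notMem (show t ∉ Ioi 0 from ht)]
      simpa using indicator_nonneg (fun _ _ => hM0) t
  refine h1.trans ?_
  rw [eLpNorm_indicator_const measurableSet_Ioo two_ne_zero ENNReal.ofNat_ne_top, Real.volume_Ioo,
    sub_zero, Real.enorm_eq_ofReal hM0, ENNReal.ofReal_rpow_of_nonneg hδ0.le (by simp),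
    ← ENNReal.ofReal_mul hM0]
  refine ENNReal.ofReal_le_ofReal ?_
  have e1 : δ ^ (1 / (2 : ℝ≥0∞).toReal) = ε / (M + 1) := by
    simp only [ENNReal.toReal_ofNat]
    rw [← Real.sqrt_eq_rpow, hδ, Real.sqrt_sq (by positivity)]
  rw [e1, mul_div_assoc', div_le_iff₀ (by positivity)]
  nlinarith

end Density

/-! ### Energy bounds and density of the solvable forcings -/

section Classical

variable {H K : Type*} [NormedAddCommGroup H] [InnerProductSpace ℝ H]
  [NormedAddCommGroup K] [InnerProductSpace ℝ K]
  {A : H →ₗ.[ℝ] H} {S : ℝ → H →L[ℝ] H} {Γ : Submodule ℝ (H × H × K)}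
  {𝒩 : Submodule ℝ (H × H)} {C : ℝ≥0} {w k y z : ℝ → H} {g : ℝ → K}

/-- Each bound drops one nonnegative term of the energy inequality and uses that `a² ≤ p² + q²`
implies `a ≤ p + q` for nonnegative `p` and `q`. -/
lemma IsClassical.energy_bounds [CompleteSpace H] (hΓ : IsDissipationGraph A Γ)
    (h𝒩 : IsDominated Γ 𝒩 C) (h : IsClassical S Γ 𝒩 w k y z g) {T : ℝ} (hT : 0 ≤ T) :
    (∀ t ∈ Icc 0 T, ‖y t‖ₑ ≤ ‖y 0‖ₑ + C * eLpNorm w 2 (volume.restrict (Ioo 0 T))) ∧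
      eLpNorm g 2 (volume.restrict (Ioo 0 T)) ≤
        ‖y 0‖ₑ + C * eLpNorm w 2 (volume.restrict (Ioo 0 T)) := by
  have key : ∀ t ≥ 0, ∀ a : ℝ, a ^ 2 ≤ ‖y 0‖ ^ 2 + C ^ 2 * ∫ s in (0 : ℝ)..t, ‖w s‖ ^ 2 →
      ENNReal.ofReal a ≤ ‖y 0‖ₑ + C * eLpNorm w 2 (volume.restrict (Ioo 0 t)) := by
    intro t ht a ha
    rw [eLpNorm_two_eq_sqrt h.contW ht, ← ofReal_norm, ← ENNReal.ofReal_coe_nnreal,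
      ← ENNReal.ofReal_mul C.coe_nonneg, ← ENNReal.ofReal_add (norm_nonneg _) (by positivity)]
    refine ENNReal.ofReal_le_ofReal ?_
    have h0 : 0 ≤ ∫ s in (0 : ℝ)..t, ‖w s‖ ^ 2 :=
      intervalIntegral.integral_nonneg ht fun s _ => by positivity
    refine abs_le_of_sq_le_sq' ?_ (by positivity) |>.2
    refine ha.trans ?_
    have h1 := Real.sq_sqrt h0
    nlinarith [mul_nonneg (norm_nonneg (y 0))
      (mul_nonneg C.coe_nonneg (Real.sqrt_nonneg (∫ s in (0 : ℝ)..t, ‖w s‖ ^ 2)))]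
  refine ⟨fun t ht => ?_, ?_⟩
  · have h1 := h.energy hΓ h𝒩 ht.1
    have h2 : 0 ≤ ∫ s in (0 : ℝ)..t, ‖g s‖ ^ 2 :=
      intervalIntegral.integral_nonneg ht.1 fun s _ => by positivity
    rw [← ofReal_norm (y t)]
    refine (key t ht.1 ‖y t‖ (by linarith)).trans ?_
    gcongr
    exact ht.2
  · have h1 := h.energy hΓ h𝒩 hT
    have h2 : 0 ≤ ∫ s in (0 : ℝ)..T, ‖g s‖ ^ 2 :=
      intervalIntegral.integral_nonneg hT fun s _ => by positivity
    rw [eLpNorm_two_eq_sqrt h.contG hT]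
    refine key T hT _ ?_
    rw [Real.sq_sqrt h2]
    nlinarith [sq_nonneg ‖y T‖]

/-- The forcings that admit classical solutions are dense. -/
lemma exists_isClassical_approx [CompleteSpace H] {l₀ : ℝ} (hA : IsMDissipative A l₀)
    (hS : IsContractionSemigroupOf A S) (hΓ : IsDissipationGraph A Γ)
    (hd : ∀ c : H, ∀ ε > 0, ∃ f n, (f, n) ∈ 𝒩 ∧ ‖f - c‖ < ε)
    (hw : MemLp w 2 (volume.restrict (Ioi (0 : ℝ)))) {ε : ℝ≥0∞} (hε : ε ≠ 0) :
    ∃ w', eLpNorm (w - w') 2 (volume.restrict (Ioi 0)) ≤ ε ∧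
      ∃ k y z g, y 0 = 0 ∧ IsClassical (K := K) S Γ 𝒩 w' k y z g := by
  -- It suffices to treat `1_s c` with `s` of finite measure: `c` is replaced by some `f` occurring
  -- in `𝒩`, and `1_s` by a test function vanishing for `t ≤ 0`, so that `isClassical_forced`
  -- applies.
  refine hw.induction_dense ENNReal.ofNat_ne_top (fun w' => ∃ k y z g, y 0 = 0 ∧
    IsClassical (K := K) S Γ 𝒩 w' k y z g) (fun c s hs hμs ε hε => ?_) ?_ ?_ hε
  · obtain ⟨δ, hδ, hδε⟩ : ∃ δ : ℝ, 0 < δ ∧ ENNReal.ofReal δ ≤ ε := by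
      rcases eq_or_ne ε ⊤ with rfl | h
      · exact ⟨1, one_pos, le_top⟩
      · exact ⟨ε.toReal, ENNReal.toReal_pos hε h, ENNReal.ofReal_toReal_le⟩
    set μ := volume.restrict (Ioi (0 : ℝ)) with hμ
    set m : ℝ := (μ s ^ (1 / (2 : ℝ≥0∞).toReal)).toReal with hm
    have hmt : μ s ^ (1 / (2 : ℝ≥0∞).toReal) ≠ ⊤ :=
      ENNReal.rpow_ne_top_of_nonneg (by simp) hμs.ne
    -- `m` is the `L²` norm of `1_s`, so `1_s (f - c)` costs at most `δ / 2`.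
    obtain ⟨f, n, hfn, hfc⟩ := hd c (δ / 2 / (m + 1)) (by positivity)
    have hM : MemLp (s.indicator fun _ => (1 : ℝ)) 2 μ :=
      memLp_indicator_const 2 hs 1 (Or.inr hμs.ne)
    have h3 : 0 < δ / 4 / (‖f‖ + 1) := by positivity
    obtain ⟨ψ, hψs, hψc, hψ⟩ := hM.exist_eLpNorm_sub_le ENNReal.ofNat_ne_top one_le_two h3
    obtain ⟨χ, hχ, hχ0, hχψ⟩ := exists_isTest_vanishing ⟨hψc, hψs⟩ h3
    obtain ⟨y, z, g, hy0, hcl⟩ := isClassical_forced hA hS hΓ hfn hχ hχ0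
    refine ⟨_, ?_, _, y, z, g, hy0, hcl⟩
    have e1 : ((fun t => χ t • f) - s.indicator fun _ => c) =
        (fun t => (χ t - s.indicator (fun _ => (1 : ℝ)) t) • f) + s.indicator fun _ => f - c := by
      ext t
      by_cases ht : t ∈ s
      · simp [ht, sub_smul]
      · simp [ht]
    have hsm : AEStronglyMeasurable (fun t => χ t - s.indicator (fun _ => (1 : ℝ)) t) μ :=
      hχ.1.continuous.aestronglyMeasurable.sub hM.1
    have e2 : eLpNorm (fun t => χ t - s.indicator (fun _ => (1 : ℝ)) t) 2 μ ≤
        ENNReal.ofReal (δ / 2 / (‖f‖ + 1)) := by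
      have : (fun t => χ t - s.indicator (fun _ => (1 : ℝ)) t) =
          (χ - ψ) - ((s.indicator fun _ => (1 : ℝ)) - ψ) := by
        ext t; simp
      rw [this]
      refine (eLpNorm_sub_le (hχ.1.continuous.sub hψc.continuous).aestronglyMeasurable
        (hM.1.sub hψc.continuous.aestronglyMeasurable) one_le_two).trans ?_
      refine (add_le_add hχψ hψ).trans ?_
      rw [← ENNReal.ofReal_add h3.le h3.le]
      refine ENNReal.ofReal_le_ofReal (le_of_eq ?_)
      ring
    rw [e1]
    refine (eLpNorm_add_le (hsm.smul_const f)
      (aestronglyMeasurable_const.indicator hs) one_le_two).trans (le_trans ?_ hδε)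
    have e3 : eLpNorm (fun t => (χ t - s.indicator (fun _ => (1 : ℝ)) t) • f) 2 μ ≤
        ENNReal.ofReal (δ / 2) := by
      have := eLpNorm_le_nnreal_smul_eLpNorm_of_ae_le_mul (μ := μ) (p := 2) (c := ‖f‖₊)
        (f := fun t => (χ t - s.indicator (fun _ => (1 : ℝ)) t) • f)
        (g := fun t => χ t - s.indicator (fun _ => (1 : ℝ)) t)
        (ae_of_all _ fun t => by rw [nnnorm_smul, mul_comm])
      refine this.trans ?_
      rw [ENNReal.smul_def, smul_eq_mul]
      calc (‖f‖₊ : ℝ≥0∞) * _ ≤ ‖f‖₊ * ENNReal.ofReal (δ / 2 / (‖f‖ + 1)) := by gcongr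
        _ = ENNReal.ofReal (‖f‖ * (δ / 2 / (‖f‖ + 1))) := by
            rw [ENNReal.ofReal_mul (norm_nonneg _), ofReal_norm]; rfl
        _ ≤ _ := by
            refine ENNReal.ofReal_le_ofReal ?_
            rw [mul_div_assoc', div_le_iff₀ (by positivity)]
            nlinarith [norm_nonneg f]
    have e4 : eLpNorm (s.indicator fun _ => f - c) 2 μ ≤ ENNReal.ofReal (δ / 2) := by
      rw [eLpNorm_indicator_const hs two_ne_zero ENNReal.ofNat_ne_top, ← ENNReal.ofReal_toReal hmt,
        ← ofReal_norm, ← ENNReal.ofReal_mul (norm_nonneg _)]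
      refine ENNReal.ofReal_le_ofReal ?_
      rw [lt_div_iff₀ (by positivity)] at hfc
      have hm0 : 0 ≤ m := ENNReal.toReal_nonneg
      nlinarith [norm_nonneg (f - c)]
    refine (add_le_add e3 e4).trans ?_
    rw [← ENNReal.ofReal_add (by positivity) (by positivity), add_halves]
  · rintro _ _ ⟨k, y, z, g, hy, h⟩ ⟨k', y', z', g', hy', h'⟩
    exact ⟨_, _, _, _, by simp [hy, hy'], h.add hS h'⟩
  · rintro _ ⟨k, y, z, g, -, h⟩
    exact h.contW.aestronglyMeasurable

end Classical

/-! ### Limits of classical solutions -/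

section Limit

variable {H K : Type*} [NormedAddCommGroup H] [InnerProductSpace ℝ H] [CompleteSpace H]
  [NormedAddCommGroup K] [InnerProductSpace ℝ K] [CompleteSpace K]
  {A : H →ₗ.[ℝ] H} {S : ℝ → H →L[ℝ] H} {Γ : Submodule ℝ (H × H × K)}
  {𝒩 : Submodule ℝ (H × H)} {C : ℝ≥0}

/-- A limit of classical solutions, for the initial value `y₀` and the control `w`. -/
structure IsLimitSolution (S : ℝ → H →L[ℝ] H) (Γ : Submodule ℝ (H × H × K))
    (𝒩 : Submodule ℝ (H × H)) (C : ℝ≥0) (y₀ : H) (w : ℝ → H) (W k Y Z : ℕ → ℝ → H) (G : ℕ → ℝ → K)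
    (y : ℝ → H) (g : ℝ → K) : Prop where
  classical : ∀ n, IsClassical S Γ 𝒩 (W n) (k n) (Y n) (Z n) (G n)
  tendsto_control : ∀ T > 0,
    Tendsto (fun n => eLpNorm (W n - w) 2 (volume.restrict (Ioo 0 T))) atTop (𝓝 0)
  tendsto_control_ae : ∀ᵐ t ∂volume.restrict (Ioi 0), Tendsto (fun n => W n t) atTop (𝓝 (w t))
  zero : y 0 = y₀
  continuousOn : ContinuousOn y (Ici 0)
  tendsto_unif : ∀ T > 0, TendstoUniformlyOn Y y atTop (Icc 0 T)
  tendsto_grad : ∀ᵐ t ∂volume.restrict (Ioi 0), Tendsto (fun n => G n t) atTop (𝓝 (g t))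
  measurable_grad : StronglyMeasurable g
  bound : ∀ T > 0, ∀ t ∈ Icc 0 T,
    ‖y t‖ₑ ≤ ‖y₀‖ₑ + C * eLpNorm w 2 (volume.restrict (Ioo 0 T))
  bound_grad : ∀ T > 0, eLpNorm g 2 (volume.restrict (Ioo 0 T)) ≤
    ‖y₀‖ₑ + C * eLpNorm w 2 (volume.restrict (Ioo 0 T))

lemma ae_restrict_Ioi_of_forall_Ioo {p : ℝ → Prop}
    (h : ∀ N : ℕ, ∀ᵐ t ∂volume.restrict (Ioo (0 : ℝ) N), p t) :
    ∀ᵐ t ∂volume.restrict (Ioi (0 : ℝ)), p t := by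
  have e : Ioi (0 : ℝ) = ⋃ N : ℕ, Ioo (0 : ℝ) N := by
    ext t
    simp only [mem_Ioi, mem_iUnion, mem_Ioo, exists_and_left]
    exact ⟨fun h => ⟨h, exists_nat_gt t⟩, fun h => h.1⟩
  rw [e, ae_restrict_iUnion_iff]
  exact h

/-- The geometric rate is summable, so the whole sequence converges almost everywhere and no
subsequence has to be extracted. -/
lemma ae_exists_tendsto_of_dist_le {F : Type*} [NormedAddCommGroup F] [CompleteSpace F]
    {f : ℕ → ℝ → F} (hf : ∀ n, Continuous (f n)) {M : ℝ≥0}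
    (h : ∀ N : ℕ, ∀ n ≥ N, ∀ m ≥ N, eLpNorm (f n - f m) 2 (volume.restrict (Ioo (0 : ℝ) N)) ≤
      M * 2⁻¹ ^ N) :
    ∀ᵐ t ∂volume.restrict (Ioi (0 : ℝ)), ∃ l, Tendsto (fun n => f n t) atTop (𝓝 l) := by
  refine ae_restrict_Ioi_of_forall_Ioo fun N₀ => ?_
  -- The rate on `(0, N₀)` is available only from the index `N₀` on, hence the shift; `M + 1`
  -- provides the strict inequality even if `M = 0`.
  have h1 := Lp.ae_tendsto_of_cauchy_eLpNorm (μ := volume.restrict (Ioo (0 : ℝ) N₀))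
    (f := fun n => f (n + N₀)) (p := 2) (B := fun n => ((M + 1 : ℝ≥0) : ℝ≥0∞) * 2⁻¹ ^ n)
    (fun n => (hf _).aestronglyMeasurable) one_le_two ?_ ?_
  · filter_upwards [h1] with t ht
    obtain ⟨l, hl⟩ := ht
    exact ⟨l, (tendsto_add_atTop_iff_nat N₀).1 hl⟩
  · rw [ENNReal.tsum_mul_left, ENNReal.tsum_geometric]
    refine ENNReal.mul_ne_top ENNReal.coe_ne_top ?_
    simp
  · intro N n m hn hm
    have h2 := h (N + N₀) (n + N₀) (by lia) (m + N₀) (by lia)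
    have h3 : eLpNorm (f (n + N₀) - f (m + N₀)) 2 (volume.restrict (Ioo (0 : ℝ) N₀)) ≤
        eLpNorm (f (n + N₀) - f (m + N₀)) 2 (volume.restrict (Ioo (0 : ℝ) (N + N₀ : ℕ))) := by
      refine eLpNorm_mono_measure _ (Measure.restrict_mono ?_ le_rfl)
      exact Ioo_subset_Ioo_right (by push_cast; linarith [Nat.cast_nonneg (α := ℝ) N])
    refine (h3.trans h2).trans_lt ?_
    have h4 : (2⁻¹ : ℝ≥0∞) ^ (N + N₀) ≤ 2⁻¹ ^ N :=
      pow_le_pow_right_of_le_one' (by simp) (by lia)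
    calc (M : ℝ≥0∞) * 2⁻¹ ^ (N + N₀) ≤ M * 2⁻¹ ^ N := by gcongr
      _ < ((M + 1 : ℝ≥0) : ℝ≥0∞) * 2⁻¹ ^ N := by
        refine ENNReal.mul_lt_mul_left (by simp) (by simp) ?_
        exact_mod_cast lt_add_one M

lemma tendsto_eLpNorm_of_tendsto_sub {X F : Type*} [MeasurableSpace X] {μ : Measure X}
    [NormedAddCommGroup F] {f : X → F} {u : ℕ → X → F} (hf : MemLp f 2 μ)
    (hu : ∀ n, AEStronglyMeasurable (u n) μ)
    (h : Tendsto (fun n => eLpNorm (u n - f) 2 μ) atTop (𝓝 0)) :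
    Tendsto (fun n => eLpNorm (u n) 2 μ) atTop (𝓝 (eLpNorm f 2 μ)) := by
  have h1 := ENNReal.Tendsto.sub (tendsto_const_nhds (x := eLpNorm f 2 μ)) h
    (Or.inl hf.eLpNorm_ne_top)
  have h2 := (tendsto_const_nhds (x := eLpNorm f 2 μ)).add h
  rw [tsub_zero] at h1
  rw [add_zero] at h2
  refine tendsto_of_tendsto_of_tendsto_of_le_of_le h1 h2 (fun n => ?_) fun n => ?_
  · rw [tsub_le_iff_right]
    have := eLpNorm_sub_le (hu n) ((hu n).sub hf.1) (p := 2) one_le_two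
    simpa using this
  · have := eLpNorm_add_le hf.1 ((hu n).sub hf.1) (p := 2) one_le_two
    simpa using this

/-- Differences of classical solutions are classical, so the energy bounds turn convergence of the
data into the Cauchy property, uniformly in time for the states and in `L²` for the gradients. The
forcings `k n` and the values `Z n` need not converge in `H`. -/
theorem exists_isLimitSolution {l₀ : ℝ} (hA : IsMDissipative A l₀)
    (hS : IsContractionSemigroupOf A S) (hΓ : IsDissipationGraph A Γ) (h𝒩 : IsDominated Γ 𝒩 C)
    (hd : ∀ c : H, ∀ ε > 0, ∃ f n, (f, n) ∈ 𝒩 ∧ ‖f - c‖ < ε) (y₀ : H) {w : ℝ → H}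
    (hw : MemL2Loc w) :
    ∃ W k Y Z G y g, IsLimitSolution S Γ 𝒩 C y₀ w W k Y Z G y g := by
  have hw1 : ∀ n : ℕ, MemLp ((Ioo (0 : ℝ) n).indicator w) 2 (volume.restrict (Ioi 0)) := fun n => by
    rw [memLp_indicator_iff_restrict measurableSet_Ioo, Measure.restrict_restrict measurableSet_Ioo,
      inter_eq_left.2 Ioo_subset_Ioi_self]
    rcases Nat.eq_zero_or_pos n with rfl | hn
    · simp
    · exact hw n (by exact_mod_cast hn)
  -- The `n`-th approximation is accurate to `2⁻ⁿ` on `(0, n)`: a forced solution starting from zero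
  -- carries the control, an unforced orbit the initial value.
  have happ : ∀ n : ℕ, ∃ W k Y Z G, IsClassical (K := K) S Γ 𝒩 W k Y Z G ∧
      eLpNorm (w - W) 2 (volume.restrict (Ioo (0 : ℝ) n)) ≤ 2⁻¹ ^ n ∧ ‖Y 0 - y₀‖ₑ ≤ 2⁻¹ ^ n := by
    intro n
    obtain ⟨W, hW, k, Y, Z, G, hY0, hcl⟩ := exists_isClassical_approx (K := K) hA hS hΓ hd (hw1 n)
      (ε := 2⁻¹ ^ n) (by simp)
    obtain ⟨x, hx, hxD⟩ := Metric.dense_iff.1 hA.dense y₀ ((2⁻¹ : ℝ) ^ n) (by positivity)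
    obtain ⟨x', hx'⟩ := LinearPMap.mem_domain_iff.1 hxD
    obtain ⟨G', hcl'⟩ := isClassical_homogeneous (𝒩 := 𝒩) hS hΓ hx'
    refine ⟨_, _, _, _, _, hcl.add hS hcl', ?_, ?_⟩
    · refine le_trans ?_ hW
      have e : (W + fun _ => 0) = W := by ext t; simp
      rw [e]
      have h1 : eLpNorm (w - W) 2 (volume.restrict (Ioo (0 : ℝ) n)) =
          eLpNorm ((Ioo (0 : ℝ) n).indicator w - W) 2 (volume.restrict (Ioo (0 : ℝ) n)) := by
        refine eLpNorm_congr_ae ?_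
        filter_upwards [ae_restrict_mem measurableSet_Ioo] with t ht
        simp [indicator_of_mem ht]
      rw [h1]
      exact eLpNorm_mono_measure _ (Measure.restrict_mono Ioo_subset_Ioi_self le_rfl)
    · simp only [Pi.add_apply, hY0, hS.zero, zero_add, ContinuousLinearMap.id_apply]
      rw [Metric.mem_ball, dist_eq_norm] at hx
      rw [← ofReal_norm]
      refine (ENNReal.ofReal_le_ofReal hx.le).trans (le_of_eq ?_)
      rw [ENNReal.ofReal_pow (by positivity), ENNReal.ofReal_inv_of_pos two_pos,
        ENNReal.ofReal_ofNat]
  choose W k Y Z G hcl hW hY using happ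
  -- the approximations are Cauchy sequences
  have hpow : ∀ {N n : ℕ}, N ≤ n → (2⁻¹ : ℝ≥0∞) ^ n ≤ 2⁻¹ ^ N := fun h =>
    pow_le_pow_right_of_le_one' (by simp) h
  have hWm : ∀ n T, AEStronglyMeasurable (W n) (volume.restrict (Ioo (0 : ℝ) T)) := fun n T =>
    (hcl n).contW.aestronglyMeasurable
  have hwm : ∀ N : ℕ, AEStronglyMeasurable w (volume.restrict (Ioo (0 : ℝ) N)) := fun N => by
    rcases Nat.eq_zero_or_pos N with rfl | hn
    · simp
    · exact (hw N (by exact_mod_cast hn)).1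
  have hWN : ∀ N : ℕ, ∀ n ≥ N, eLpNorm (w - W n) 2 (volume.restrict (Ioo (0 : ℝ) N)) ≤ 2⁻¹ ^ N :=
    fun N n hn => by
      refine le_trans ?_ ((hW n).trans (hpow hn))
      exact eLpNorm_mono_measure _ (Measure.restrict_mono
        (Ioo_subset_Ioo_right (by exact_mod_cast hn)) le_rfl)
  have hWc : ∀ N : ℕ, ∀ n ≥ N, ∀ m ≥ N,
      eLpNorm (W n - W m) 2 (volume.restrict (Ioo (0 : ℝ) N)) ≤ (2 : ℝ≥0) * 2⁻¹ ^ N := by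
    intro N n hn m hm
    have e : W n - W m = (w - W m) - (w - W n) := by abel
    rw [e]
    refine (eLpNorm_sub_le ((hwm N).sub (hWm m N)) ((hwm N).sub (hWm n N)) one_le_two).trans ?_
    refine (add_le_add (hWN N m hm) (hWN N n hn)).trans (le_of_eq ?_)
    push_cast; ring
  have hY0c : ∀ N : ℕ, ∀ n ≥ N, ∀ m ≥ N, ‖(Y n - Y m) 0‖ₑ ≤ 2 * 2⁻¹ ^ N := by
    intro N n hn m hm
    have e : (Y n - Y m) 0 = (Y n 0 - y₀) - (Y m 0 - y₀) := by simp
    rw [e]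
    refine (enorm_sub_le).trans ?_
    refine (add_le_add ((hY n).trans (hpow hn)) ((hY m).trans (hpow hm))).trans (le_of_eq ?_)
    ring
  have hcau : ∀ N : ℕ, ∀ n ≥ N, ∀ m ≥ N,
      (∀ t ∈ Icc (0 : ℝ) N, ‖Y n t - Y m t‖ₑ ≤ (2 + 2 * C : ℝ≥0) * 2⁻¹ ^ N) ∧
      eLpNorm (G n - G m) 2 (volume.restrict (Ioo (0 : ℝ) N)) ≤ (2 + 2 * C : ℝ≥0) * 2⁻¹ ^ N := by
    intro N n hn m hm
    have h1 := ((hcl n).sub hS (hcl m)).energy_bounds hΓ h𝒩 (T := N) (by positivity)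
    have h2 : ‖(Y n - Y m) 0‖ₑ +
        C * eLpNorm (W n - W m) 2 (volume.restrict (Ioo (0 : ℝ) N)) ≤
        (2 + 2 * C : ℝ≥0) * 2⁻¹ ^ N := by
      calc _ ≤ (2 : ℝ≥0∞) * 2⁻¹ ^ N + (C : ℝ≥0∞) * (((2 : ℝ≥0) : ℝ≥0∞) * 2⁻¹ ^ N) :=
            add_le_add (hY0c N n hn m hm) (mul_le_mul_right (hWc N n hn m hm) _)
        _ = _ := by push_cast; ring
    exact ⟨fun t ht => (h1.1 t ht).trans h2, h1.2.trans h2⟩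
  -- limits of the solutions
  have hunif : ∀ T : ℝ, UniformCauchySeqOn Y atTop (Icc 0 T) := fun T => by
    refine Metric.uniformCauchySeqOn_iff.2 fun ε hε => ?_
    have ht : Tendsto (fun N : ℕ => (2 + 2 * C : ℝ) * 2⁻¹ ^ N) atTop (𝓝 0) := by
      simpa using (tendsto_pow_atTop_nhds_zero_of_lt_one (r := (2⁻¹ : ℝ)) (by norm_num)
        (by norm_num)).const_mul (2 + 2 * C : ℝ)
    obtain ⟨N, hN1, hN2⟩ := ((ht.eventually_lt_const hε).and
      (tendsto_natCast_atTop_atTop.eventually_ge_atTop T)).exists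
    refine ⟨N, fun m hm n hn t ht => ?_⟩
    have h1 := (hcau N m hm n hn).1 t ⟨ht.1, ht.2.trans hN2⟩
    rw [dist_eq_norm]
    refine lt_of_le_of_lt ?_ hN1
    rw [← ENNReal.ofReal_le_ofReal_iff (by positivity), ofReal_norm]
    refine h1.trans (le_of_eq ?_)
    rw [ENNReal.ofReal_mul (by positivity), ENNReal.ofReal_pow (by positivity),
      ENNReal.ofReal_inv_of_pos two_pos, ENNReal.ofReal_ofNat]
    congr 1
    rw [← ENNReal.ofReal_coe_nnreal]; simp
  have hlim : ∀ t, ∃ l, 0 ≤ t → Tendsto (fun n => Y n t) atTop (𝓝 l) := fun t => by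
    by_cases ht : 0 ≤ t
    · obtain ⟨l, hl⟩ := cauchySeq_tendsto_of_complete ((hunif t).cauchySeq ⟨ht, le_rfl⟩)
      exact ⟨l, fun _ => hl⟩
    · exact ⟨0, fun h => absurd h ht⟩
  choose y hy using hlim
  have hyu : ∀ T > 0, TendstoUniformlyOn Y y atTop (Icc 0 T) := fun T _ =>
    (hunif T).tendstoUniformlyOn_of_tendsto fun t ht => hy t ht.1
  have hyc : ContinuousOn y (Ici 0) := fun t ht => by
    have h1 := (hyu (t + 1) (by linarith [show (0 : ℝ) ≤ t from ht])).continuousOn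
      (Frequently.of_forall fun n => (hcl n).contY.continuousOn)
    refine (h1 t ⟨ht, by linarith⟩).mono_of_mem_nhdsWithin ?_
    have : Icc 0 (t + 1) = Ici 0 ∩ Iic (t + 1) := rfl
    rw [this]
    exact inter_mem_nhdsWithin _ (Iic_mem_nhds (by linarith))
  obtain ⟨g, hgm, hg⟩ := exists_stronglyMeasurable_limit_of_tendsto_ae
    (fun n => (hcl n).contG.aestronglyMeasurable)
    (ae_exists_tendsto_of_dist_le (fun n => (hcl n).contG) fun N n hn m hm => (hcau N n hn m hm).2)
  -- the controls
  have hWt : ∀ T > 0,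
      Tendsto (fun n => eLpNorm (W n - w) 2 (volume.restrict (Ioo 0 T))) atTop (𝓝 0) := by
    intro T _
    have ht : Tendsto (fun N : ℕ => (2⁻¹ : ℝ≥0∞) ^ N) atTop (𝓝 0) :=
      ENNReal.tendsto_pow_atTop_nhds_zero_of_lt_one (by simp)
    refine tendsto_of_tendsto_of_tendsto_of_le_of_le' tendsto_const_nhds ht
      (Eventually.of_forall fun _ => zero_le) ?_
    filter_upwards [tendsto_natCast_atTop_atTop.eventually_ge_atTop T] with n hn
    rw [eLpNorm_sub_comm]
    refine le_trans ?_ (hW n)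
    exact eLpNorm_mono_measure _ (Measure.restrict_mono (Ioo_subset_Ioo_right hn) le_rfl)
  have hWae : ∀ᵐ t ∂volume.restrict (Ioi 0), Tendsto (fun n => W n t) atTop (𝓝 (w t)) := by
    obtain ⟨v, hvm, hv⟩ := exists_stronglyMeasurable_limit_of_tendsto_ae
      (fun n => (hcl n).contW.aestronglyMeasurable)
      (ae_exists_tendsto_of_dist_le (fun n => (hcl n).contW) hWc)
    -- `L²` convergence makes a subsequence tend to `w` almost everywhere, which identifies the
    -- limit `v`.
    have hvw : ∀ᵐ t ∂volume.restrict (Ioi (0 : ℝ)), v t = w t := by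
      refine ae_restrict_Ioi_of_forall_Ioo fun N => ?_
      rcases Nat.eq_zero_or_pos N with rfl | hN
      · simp
      have hN' : (0 : ℝ) < N := by exact_mod_cast hN
      have h1 : TendstoInMeasure (volume.restrict (Ioo (0 : ℝ) N)) W atTop w :=
        tendstoInMeasure_of_tendsto_eLpNorm two_ne_zero (fun n => hWm n N) (hwm N) (hWt N hN')
      obtain ⟨ns, hns, h2⟩ := h1.exists_seq_tendsto_ae
      have h3 := ae_restrict_of_ae_restrict_of_subset (t := Ioi (0 : ℝ)) (s := Ioo (0 : ℝ) N)
        Ioo_subset_Ioi_self hv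
      filter_upwards [h2, h3] with t e2 e3
      exact tendsto_nhds_unique (e3.comp hns.tendsto_atTop) e2
    filter_upwards [hv, hvw] with t h1 h2
    rwa [h2] at h1
  have hbt : ∀ T > 0, Tendsto (fun n => ‖Y n 0‖ₑ + C * eLpNorm (W n) 2 (volume.restrict (Ioo 0 T)))
      atTop (𝓝 (‖y 0‖ₑ + C * eLpNorm w 2 (volume.restrict (Ioo 0 T)))) := by
    intro T hT
    refine Tendsto.add ((continuous_enorm.tendsto _).comp (hy 0 le_rfl)) ?_
    refine ENNReal.Tendsto.const_mul ?_ (Or.inr ENNReal.coe_ne_top)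
    exact tendsto_eLpNorm_of_tendsto_sub (hw T hT) (fun n => hWm n T) (hWt T hT)
  have hy00 : y 0 = y₀ := by
    refine tendsto_nhds_unique (hy 0 le_rfl) (tendsto_iff_edist_tendsto_0.2 ?_)
    have ht : Tendsto (fun N : ℕ => (2⁻¹ : ℝ≥0∞) ^ N) atTop (𝓝 0) :=
      ENNReal.tendsto_pow_atTop_nhds_zero_of_lt_one (by simp)
    refine tendsto_of_tendsto_of_tendsto_of_le_of_le tendsto_const_nhds ht
      (fun _ => zero_le) fun n => ?_
    rw [edist_eq_enorm_sub]
    exact hY n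
  refine ⟨W, k, Y, Z, G, y, g, hcl, hWt, hWae, hy00, hyc, hyu, hg, hgm, fun T hT t ht => ?_,
    fun T hT => ?_⟩
  · rw [← hy00]
    exact le_of_tendsto_of_tendsto' ((continuous_enorm.tendsto _).comp (hy t ht.1)) (hbt T hT)
      fun n => ((hcl n).energy_bounds hΓ h𝒩 hT.le).1 t ht
  · have h1 := Lp.eLpNorm_lim_le_liminf_eLpNorm (p := 2)
      (μ := volume.restrict (Ioo (0 : ℝ) T)) (fun n => (hcl n).contG.aestronglyMeasurable) g
      (ae_restrict_of_ae_restrict_of_subset Ioo_subset_Ioi_self hg)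
    rw [← hy00, ← (hbt T hT).liminf_eq]
    exact h1.trans (liminf_le_liminf (Eventually.of_forall fun n =>
      ((hcl n).energy_bounds hΓ h𝒩 hT.le).2))

end Limit

/-! ### The forced problem in `Y_{-1}` -/

section Extrapolation

variable {d : ℕ} {G α : E d → ℝ}

lemma mem_graph_adjoint_iff (hd : Dense ((opA G).domain : Set (Y G))) {a b : Y G} :
    (a, b) ∈ (opA G)†.graph ↔ ∀ y z, (y, z) ∈ (opA G).graph → ⟪z, a⟫_ℝ = ⟪y, b⟫_ℝ := by
  rw [LinearPMap.adjoint_graph_eq_graph_adjoint hd, Submodule.mem_adjoint_iff]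
  simp only [sub_eq_zero]

lemma dIncl_dAdj_mem (x : DAdj G) : (dIncl G x, dAdj G x) ∈ (opA G)†.graph := x.2

/-- The element `(a, A† a)` of `𝓓(A†)`. -/
def mkDAdj {a b : Y G} (h : (a, b) ∈ (opA G)†.graph) : DAdj G := ⟨WithLp.toLp 2 (a, b), h⟩

@[simp] lemma dIncl_mkDAdj {a b : Y G} (h : (a, b) ∈ (opA G)†.graph) : dIncl G (mkDAdj h) = a := rfl

@[simp] lemma dAdj_mkDAdj {a b : Y G} (h : (a, b) ∈ (opA G)†.graph) : dAdj G (mkDAdj h) = b := rfl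

lemma norm_sq_DAdj (x : DAdj G) : ‖x‖ ^ 2 = ‖dIncl G x‖ ^ 2 + ‖dAdj G x‖ ^ 2 :=
  WithLp.prod_norm_sq_eq_of_L2 (x : WithLp 2 (Y G × Y G))

lemma DAdj_ext {x x' : DAdj G} (h : dIncl G x = dIncl G x') (h' : dAdj G x = dAdj G x') :
    x = x' := by
  have h0 : ‖x - x'‖ ^ 2 = 0 := by rw [norm_sq_DAdj]; simp [h, h']
  exact sub_eq_zero.1 (norm_eq_zero.1 (by simpa using h0))

lemma extA_eq_emb (hd : Dense ((opA G).domain : Set (Y G))) {y z : Y G}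
    (h : (y, z) ∈ (opA G).graph) : extA G y = emb G z := by
  ext x
  simp only [extA, emb, dualMap_apply]
  exact ((mem_graph_adjoint_iff hd).1 (dIncl_dAdj_mem x) y z h).symm

/-- `(A†)' a ∈ Y` only for `a` in the domain of `A`. -/
lemma mem_graph_of_extA_eq_emb {l₀ : ℝ} (hA : IsMDissipative (opA G) l₀)
    (hA' : ∀ h, ∃ x : DAdj G, l₀ • dIncl G x - dAdj G x = h) {a b : Y G}
    (h : extA G a = emb G b) : (a, b) ∈ (opA G).graph := by
  -- A genuine domain element `y` with `l₀ y - A y = l₀ a - b`; the difference `a - y` is then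
  -- orthogonal to the range of `l₀ - A†`, which is everything.
  obtain ⟨y, z, hyz, he⟩ := hA.range l₀ le_rfl (l₀ • a - b)
  have h1 : extA G (a - y) = emb G (b - z) := by
    rw [map_sub, map_sub, h, extA_eq_emb hA.dense hyz]
  have h2 : b - z = l₀ • (a - y) := by
    rw [smul_sub]
    have : l₀ • a = l₀ • y - z + b := by rw [he]; abel
    rw [this]; abel
  have h3 : a - y = 0 := by
    obtain ⟨x, hx⟩ := hA' (a - y)
    have h4 := congrArg (fun u : Yneg G => u x) h1
    simp only [extA, emb, dualMap_apply, h2, real_inner_smul_left] at h4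
    have h5 : ⟪a - y, l₀ • dIncl G x - dAdj G x⟫_ℝ = 0 := by
      rw [inner_sub_right, real_inner_smul_right, h4, sub_self]
    rw [hx] at h5
    exact inner_self_eq_zero.1 h5
  rw [h3, smul_zero] at h2
  rwa [sub_eq_zero.1 h3, sub_eq_zero.1 h2]

/-- The extension of the semigroup to `Y_{-1}`. -/
lemma exists_extension_semigroup {S : ℝ → Y G →L[ℝ] Y G}
    (hd : Dense ((opA G).domain : Set (Y G))) (hS : IsContractionSemigroupOf (opA G) S) :
    ∃ B : ℝ → Yneg G →L[ℝ] Yneg G, (∀ t ≥ 0, ∀ f, B t (emb G f) = emb G (S t f)) ∧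
      ∀ t u, ‖B t u‖ ≤ ‖u‖ := by
  have hSa : ∀ t x, ‖ContinuousLinearMap.adjoint (S t) x‖ ≤ ‖x‖ := fun t x => by
    have h1 : ‖S t‖ ≤ 1 := (S t).opNorm_le_bound zero_le_one fun x => by
      simpa using hS.norm_le t x
    refine (ContinuousLinearMap.le_opNorm _ _).trans ?_
    rw [LinearIsometryEquiv.norm_map]
    nlinarith [norm_nonneg x]
  have hmem : ∀ t ≥ 0, ∀ a b, (a, b) ∈ (opA G)†.graph →
      (ContinuousLinearMap.adjoint (S t) a, ContinuousLinearMap.adjoint (S t) b) ∈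
        (opA G)†.graph := fun t ht a b hab => by
    rw [mem_graph_adjoint_iff hd] at hab ⊢
    intro y z hyz
    rw [ContinuousLinearMap.adjoint_inner_right, ContinuousLinearMap.adjoint_inner_right]
    exact hab _ _ (hS.apply_mem_graph hyz ht)
  -- The Hilbert adjoint of `S t` maps `𝓓(A†)` to itself and contracts its graph norm; the extension
  -- of `S t` to `Y_{-1}` is the transpose of this restriction. For negative times the choice `0` is
  -- a filler.
  have hE : ∀ t : ℝ, ∃ F : DAdj G →L[ℝ] DAdj G, (∀ x, ‖F x‖ ≤ ‖x‖) ∧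
      (0 ≤ t → ∀ x, dIncl G (F x) = ContinuousLinearMap.adjoint (S t) (dIncl G x)) := fun t => by
    by_cases ht : 0 ≤ t
    · let F₀ : DAdj G →ₗ[ℝ] DAdj G :=
        { toFun := fun x => mkDAdj (hmem t ht _ _ (dIncl_dAdj_mem x))
          map_add' := fun x y => DAdj_ext (by simp) (by simp)
          map_smul' := fun c x => DAdj_ext (by simp) (by simp) }
      have hF : ∀ x, ‖F₀ x‖ ≤ ‖x‖ := fun x => by
        refine abs_le_of_sq_le_sq' ?_ (norm_nonneg x) |>.2
        rw [norm_sq_DAdj, norm_sq_DAdj x]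
        refine add_le_add ?_ ?_
        · exact pow_le_pow_left₀ (norm_nonneg _) (hSa t _) 2
        · exact pow_le_pow_left₀ (norm_nonneg _) (hSa t _) 2
      exact ⟨F₀.mkContinuous 1 fun x => by simpa using hF x, hF, fun _ x => rfl⟩
    · exact ⟨0, fun x => by simp, fun h => absurd h ht⟩
  choose F hFn hF using hE
  refine ⟨fun t => ContinuousLinearMap.precomp ℝ (F t),
    fun t ht f => ?_, fun t u => ?_⟩
  · ext x
    change ⟪f, dIncl G (F t x)⟫_ℝ = ⟪S t f, dIncl G x⟫_ℝ
    rw [hF t ht, ContinuousLinearMap.adjoint_inner_right]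
  · refine ContinuousLinearMap.opNorm_le_bound _ u.opNorm_nonneg fun x => ?_
    change ‖u (F t x)‖ ≤ _
    refine (u.le_opNorm _).trans ?_
    gcongr
    exact hFn t x

/-- Convergence of integrals on `(0,t)` under `L²` convergence of the integrands. -/
lemma tendsto_intervalIntegral_of_eLpNorm {F : Type*} [NormedAddCommGroup F] [NormedSpace ℝ F]
    {f : ℝ → F} {u : ℕ → ℝ → F} {t : ℝ} (ht : 0 ≤ t)
    (hf : MemLp f 2 (volume.restrict (Ioo 0 t)))
    (hu : ∀ n, MemLp (u n) 2 (volume.restrict (Ioo 0 t)))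
    (h : Tendsto (fun n => eLpNorm (u n - f) 2 (volume.restrict (Ioo 0 t))) atTop (𝓝 0)) :
    Tendsto (fun n => ∫ s in (0 : ℝ)..t, u n s) atTop (𝓝 (∫ s in (0 : ℝ)..t, f s)) := by
  simp only [intervalIntegral.integral_of_le ht, integral_Ioc_eq_integral_Ioo]
  refine tendsto_integral_of_L1' f hf.1
    (Eventually.of_forall fun n => (hu n).integrable one_le_two) ?_
  set c : ℝ≥0∞ := (volume.restrict (Ioo 0 t)) univ ^
    (1 / (1 : ℝ≥0∞).toReal - 1 / (2 : ℝ≥0∞).toReal) with hc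
  have hct : c ≠ ⊤ := ENNReal.rpow_ne_top_of_nonneg (by norm_num) (measure_ne_top _ _)
  have h1 := ENNReal.Tendsto.mul_const h (Or.inr hct)
  rw [zero_mul] at h1
  refine tendsto_of_tendsto_of_tendsto_of_le_of_le tendsto_const_nhds h1 (fun _ => zero_le)
    fun n => ?_
  exact eLpNorm_le_eLpNorm_mul_rpow_measure_univ one_le_two ((hu n).1.sub hf.1)

end Extrapolation

/-! ### The equation in the extrapolation space, uniqueness, the time derivative -/

section TimeDependent


variable {H K F : Type*} [NormedAddCommGroup H] [InnerProductSpace ℝ H] [CompleteSpace H]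
  [NormedAddCommGroup K] [InnerProductSpace ℝ K] [CompleteSpace K]
  [NormedAddCommGroup F] [NormedSpace ℝ F] [CompleteSpace F]
  {A : H →ₗ.[ℝ] H} {S : ℝ → H →L[ℝ] H} {Γ : Submodule ℝ (H × H × K)}
  {𝒩 : Submodule ℝ (H × H)} {C : ℝ≥0} {l₀ : ℝ}
  {y₀ : H} {w : ℝ → H} {W k U Z : ℕ → ℝ → H} {D : ℕ → ℝ → K} {y : ℝ → H}
  {g : ℝ → K} {ι L N : H →L[ℝ] F}

lemma eLpNorm_clm_le {X F F' : Type*} [MeasurableSpace X] {μ : Measure X}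
    [NormedAddCommGroup F] [NormedSpace ℝ F] [NormedAddCommGroup F'] [NormedSpace ℝ F']
    (L : F →L[ℝ] F') (f : X → F) (p : ℝ≥0∞) :
    eLpNorm (fun s => L (f s)) p μ ≤ ‖L‖₊ * eLpNorm f p μ := by
  have h2 := eLpNorm_le_nnreal_smul_eLpNorm_of_ae_le_mul
    (f := fun s => L (f s)) (g := f) (μ := μ) (c := ‖L‖₊)
    (ae_of_all _ fun s => L.le_opNNNorm _) p
  simpa [ENNReal.smul_def] using h2

lemma tendsto_eLpNorm_clm {X F F' : Type*} [MeasurableSpace X] {μ : Measure X}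
    [NormedAddCommGroup F] [NormedSpace ℝ F] [NormedAddCommGroup F'] [NormedSpace ℝ F']
    (L : F →L[ℝ] F') {f : X → F} {u : ℕ → X → F}
    (h : Tendsto (fun n => eLpNorm (u n - f) 2 μ) atTop (𝓝 0)) :
    Tendsto (fun n => eLpNorm ((fun s => L (u n s)) - fun s => L (f s)) 2 μ) atTop (𝓝 0) := by
  have h1 := ENNReal.Tendsto.const_mul (a := (‖L‖₊ : ℝ≥0∞)) h (Or.inr ENNReal.coe_ne_top)
  rw [mul_zero] at h1
  refine tendsto_of_tendsto_of_tendsto_of_le_of_le tendsto_const_nhds h1 (fun _ => zero_le)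
    fun n => ?_
  refine le_trans (le_of_eq ?_) (eLpNorm_clm_le L (u n - f) 2)
  congr 1
  funext s
  simp

namespace IsLimitSolution

lemma aestronglyMeasurable (hl : IsLimitSolution S Γ 𝒩 C y₀ w W k U Z D y g) (T : ℝ) :
    AEStronglyMeasurable y (volume.restrict (Ioo 0 T)) :=
  (hl.continuousOn.mono (Ioo_subset_Ioi_self.trans Ioi_subset_Ici_self)).aestronglyMeasurable
    measurableSet_Ioo

lemma ae_bound (hl : IsLimitSolution S Γ 𝒩 C y₀ w W k U Z D y g) {T : ℝ} (hT : 0 < T) :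
    ∀ᵐ t ∂volume.restrict (Ioo 0 T),
      ‖y t‖ₑ ≤ ‖y₀‖ₑ + C * eLpNorm w 2 (volume.restrict (Ioo 0 T)) :=
  (ae_restrict_mem measurableSet_Ioo).mono fun t ht => hl.bound T hT t (Ioo_subset_Icc_self ht)

lemma eLpNorm_top_le (hl : IsLimitSolution S Γ 𝒩 C y₀ w W k U Z D y g) {T : ℝ} (hT : 0 < T) :
    eLpNorm y ⊤ (volume.restrict (Ioo 0 T)) ≤
      ‖y₀‖ₑ + C * eLpNorm w 2 (volume.restrict (Ioo 0 T)) := by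
  rw [eLpNorm_exponent_top]
  exact essSup_le_of_ae_le _ (hl.ae_bound hT)

lemma memLp_top (hl : IsLimitSolution S Γ 𝒩 C y₀ w W k U Z D y g) {T : ℝ} (hT : 0 < T)
    (hw : MemL2Loc w) : MemLp y ⊤ (volume.restrict (Ioo 0 T)) := by
  refine ⟨hl.aestronglyMeasurable T, (hl.eLpNorm_top_le hT).trans_lt ?_⟩
  exact ENNReal.add_lt_top.2 ⟨enorm_lt_top, ENNReal.mul_lt_top ENNReal.coe_lt_top (hw T hT).2⟩

lemma memL2Loc (hl : IsLimitSolution S Γ 𝒩 C y₀ w W k U Z D y g) (hw : MemL2Loc w) :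
    MemL2Loc y := fun _ hT => (hl.memLp_top hT hw).mono_exponent le_top

lemma memL2Loc_grad (hl : IsLimitSolution S Γ 𝒩 C y₀ w W k U Z D y g) (hw : MemL2Loc w) :
    MemL2Loc g := fun T hT => by
  refine ⟨hl.measurable_grad.aestronglyMeasurable, (hl.bound_grad T hT).trans_lt ?_⟩
  exact ENNReal.add_lt_top.2 ⟨enorm_lt_top, ENNReal.mul_lt_top ENNReal.coe_lt_top (hw T hT).2⟩

lemma tendsto_state (hl : IsLimitSolution S Γ 𝒩 C y₀ w W k U Z D y g) {T : ℝ} (hT : 0 < T) :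
    Tendsto (fun n => eLpNorm (U n - y) 2 (volume.restrict (Ioo 0 T))) atTop (𝓝 0) := by
  set c : ℝ≥0∞ := (volume.restrict (Ioo 0 T)) univ ^ (2 : ℝ≥0∞).toReal⁻¹ with hc
  have hct : c ≠ ⊤ := ENNReal.rpow_ne_top_of_nonneg (by norm_num) (measure_ne_top _ _)
  refine ENNReal.tendsto_atTop_zero.2 fun ε hε => ?_
  have h0 : ∃ δ : ℝ, 0 < δ ∧ c * ENNReal.ofReal δ ≤ ε := by
    have h1 : Tendsto (fun δ : ℝ => c * ENNReal.ofReal δ) (𝓝[>] 0) (𝓝 0) := by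
      have h2 := ENNReal.Tendsto.const_mul (a := c)
        (ENNReal.tendsto_ofReal (tendsto_id (x := 𝓝 (0 : ℝ)))) (Or.inr hct)
      simp only [ENNReal.ofReal_zero, mul_zero, id] at h2
      exact h2.mono_left nhdsWithin_le_nhds
    obtain ⟨δ, h3, h4⟩ := ((h1.eventually (gt_mem_nhds hε)).and self_mem_nhdsWithin).exists
    exact ⟨δ, h4, h3.le⟩
  obtain ⟨δ, hδ, hδε⟩ := h0
  obtain ⟨N, hN⟩ := eventually_atTop.1
    (Metric.tendstoUniformlyOn_iff.1 (hl.tendsto_unif T hT) δ hδ)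
  refine ⟨N, fun n hn => (eLpNorm_le_of_ae_bound (C := δ) ?_).trans hδε⟩
  refine (ae_restrict_mem measurableSet_Ioo).mono fun t ht => ?_
  have := (hN n hn t (Ioo_subset_Icc_self ht)).le
  rwa [dist_comm, dist_eq_norm] at this

lemma tendsto_apply (hl : IsLimitSolution S Γ 𝒩 C y₀ w W k U Z D y g) {t : ℝ} (ht : 0 ≤ t) :
    Tendsto (fun n => U n t) atTop (𝓝 (y t)) :=
  (hl.tendsto_unif (t + 1) (by linarith)).tendsto_at ⟨ht, by linarith⟩

end IsLimitSolution

lemma memLp_clm_add_clm {X F F₁ F' : Type*} [MeasurableSpace X] {μ : Measure X} {p : ℝ≥0∞}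
    [NormedAddCommGroup F] [NormedSpace ℝ F] [NormedAddCommGroup F₁] [NormedSpace ℝ F₁]
    [NormedAddCommGroup F'] [NormedSpace ℝ F'] (L : F →L[ℝ] F') (L' : F₁ →L[ℝ] F') {f : X → F}
    {f' : X → F₁} (hf : MemLp f p μ) (hf' : MemLp f' p μ) :
    MemLp (fun s => L (f s) + L' (f' s)) p μ :=
  (L.comp_memLp' hf).add (L'.comp_memLp' hf')

lemma IsClassical.clm_eq {W k U Z : ℝ → H} {D : ℝ → K} (hΓ : IsDissipationGraph A Γ)
    (hL : ∀ y z, (y, z) ∈ A.graph → L y = ι z) (hN : ∀ f n, (f, n) ∈ 𝒩 → N f = ι n)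
    (hc : IsClassical S Γ 𝒩 W k U Z D) {t : ℝ} (ht : 0 ≤ t) :
    ι (U t) - ι (U 0) = ∫ s in (0 : ℝ)..t, (L (U s) + N (W s)) := by
  have h1 : ∀ s, L (U s) + N (W s) = ι (Z s + k s) := fun s => by
    rw [hL _ _ (hΓ.mem_graph _ _ _ (hc.mem s)), hN _ _ (hc.memN s), map_add]
  simp only [h1]
  have hc1 : Continuous fun s => Z s + k s := hc.contZ.add hc.contK
  rw [ι.intervalIntegral_comp_comm (hc1.intervalIntegrable 0 t), ← map_sub]
  congr 1
  rw [hc.eq t ht]; abel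

/-- The right-hand side involves only the states and the controls, through the bounded maps `L` and
`N`; both converge in `L²`, so the integrated equation passes to the limit in `F`. -/
lemma IsLimitSolution.clm_eq (hΓ : IsDissipationGraph A Γ)
    (hL : ∀ y z, (y, z) ∈ A.graph → L y = ι z) (hN : ∀ f n, (f, n) ∈ 𝒩 → N f = ι n)
    (hl : IsLimitSolution S Γ 𝒩 C y₀ w W k U Z D y g) (hw : MemL2Loc w) {t : ℝ} (ht : 0 ≤ t) :
    ι (y t) - ι y₀ = ∫ s in (0 : ℝ)..t, (L (y s) + N (w s)) := by
  rcases ht.eq_or_lt with rfl | ht'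
  · simp [hl.zero]
  have h1 : Tendsto (fun n => ι (U n t) - ι (U n 0)) atTop (𝓝 (ι (y t) - ι y₀)) := by
    rw [← hl.zero]
    exact ((ι.continuous.tendsto _).comp (hl.tendsto_apply ht)).sub
      ((ι.continuous.tendsto _).comp (hl.tendsto_apply le_rfl))
  have hU : ∀ n, MemL2Loc (U n) := fun n T _ => memLp_two_of_continuous (hl.classical n).contY T
  have hW : ∀ n, MemL2Loc (W n) := fun n T _ => memLp_two_of_continuous (hl.classical n).contW T
  have h2 := tendsto_intervalIntegral_of_eLpNorm ht
    (memLp_clm_add_clm L N (hl.memL2Loc hw t ht') (hw t ht'))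
    (fun n => memLp_clm_add_clm L N (hU n t ht') (hW n t ht')) ?_
  · refine tendsto_nhds_unique h1 (h2.congr fun n => ?_)
    exact ((hl.classical n).clm_eq hΓ hL hN ht).symm
  · have h3 := (tendsto_eLpNorm_clm L (hl.tendsto_state ht')).add
      (tendsto_eLpNorm_clm N (hl.tendsto_control t ht'))
    rw [add_zero] at h3
    refine tendsto_of_tendsto_of_tendsto_of_le_of_le tendsto_const_nhds h3 (fun _ => zero_le)
      fun n => ?_
    refine le_trans (le_of_eq ?_) (eLpNorm_add_le
      ((L.comp_memLp' (hU n t ht')).sub (L.comp_memLp' (hl.memL2Loc hw t ht'))).1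
      ((N.comp_memLp' (hW n t ht')).sub (N.comp_memLp' (hw t ht'))).1 one_le_two)
    congr 1
    funext s
    simp only [Pi.sub_apply, Pi.add_apply]
    abel

lemma IsLimitSolution.clm_mild (hS : IsContractionSemigroupOf A S)
    {B : ℝ → F →L[ℝ] F} (hB : ∀ t ≥ 0, ∀ f, B t (ι f) = ι (S t f)) (hB' : ∀ t u, ‖B t u‖ ≤ ‖u‖)
    (hN : ∀ f n, (f, n) ∈ 𝒩 → N f = ι n)
    (hl : IsLimitSolution S Γ 𝒩 C y₀ w W k U Z D y g) (hw : MemL2Loc w) {t : ℝ} (ht : 0 ≤ t) :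
    ι (y t) = ι (S t y₀) + ∫ s in (0 : ℝ)..t, B (t - s) (N (w s)) := by
  rcases ht.eq_or_lt with rfl | ht'
  · simp [hl.zero, hS.zero]
  have hW : ∀ n, MemL2Loc (W n) := fun n T _ => memLp_two_of_continuous (hl.classical n).contW T
  have hk : ∀ n, Continuous fun s => ι (S (t - s) (k n s)) := fun n =>
    ι.continuous.comp (continuous_semigroup_apply hS (continuous_const.sub continuous_id)
      (hl.classical n).contK)
  have he : ∀ n, ∀ s ∈ Icc 0 t, B (t - s) (N (W n s)) = ι (S (t - s) (k n s)) := fun n s hs => by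
    rw [hN _ _ ((hl.classical n).memN s), hB _ (by linarith [hs.2])]
  have hm : ∀ n, AEStronglyMeasurable (fun s => B (t - s) (N (W n s)))
      (volume.restrict (Ioo 0 t)) := fun n =>
    (hk n).aestronglyMeasurable.congr ((ae_restrict_mem measurableSet_Ioo).mono fun s hs =>
      (he n s (Ioo_subset_Icc_self hs)).symm)
  -- No continuity of `t ↦ B t` is available; measurability is inherited from the approximations,
  -- whose integrands agree on the interval with continuous functions.
  have hm' : AEStronglyMeasurable (fun s => B (t - s) (N (w s))) (volume.restrict (Ioo 0 t)) := by
    refine aestronglyMeasurable_of_tendsto_ae atTop hm ?_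
    refine (ae_restrict_of_ae_restrict_of_subset Ioo_subset_Ioi_self hl.tendsto_control_ae).mono
      fun s hs => ?_
    exact (((B (t - s)).continuous.comp N.continuous).tendsto _).comp hs
  have hb : ∀ s (a : H), ‖B s (N a)‖ ≤ ‖N‖ * ‖a‖ := fun s a => (hB' _ _).trans (N.le_opNorm a)
  have h1 : Tendsto (fun n => ι (U n t)) atTop (𝓝 (ι (y t))) :=
    (ι.continuous.tendsto _).comp (hl.tendsto_apply ht)
  have h0 : Tendsto (fun n => ι (S t (U n 0))) atTop (𝓝 (ι (S t y₀))) := by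
    rw [← hl.zero]
    exact ((ι.continuous.comp (S t).continuous).tendsto _).comp (hl.tendsto_apply le_rfl)
  have h2 := tendsto_intervalIntegral_of_eLpNorm ht
    ((hw t ht').of_le_mul hm' (ae_of_all _ fun s => hb (t - s) (w s)))
    (fun n => (hW n t ht').of_le_mul (hm n) (ae_of_all _ fun s => hb (t - s) (W n s))) ?_
  · refine tendsto_nhds_unique h1 ((h0.add h2).congr fun n => ?_)
    have h4 : ∫ s in (0 : ℝ)..t, B (t - s) (N (W n s)) =
        ∫ s in (0 : ℝ)..t, ι (S (t - s) (k n s)) :=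
      intervalIntegral.integral_congr fun s hs => he n s (by rwa [uIcc_of_le ht] at hs)
    have hk' : Continuous fun s => S (t - s) (k n s) :=
      continuous_semigroup_apply hS (continuous_const.sub continuous_id) (hl.classical n).contK
    rw [h4, ι.intervalIntegral_comp_comm (hk'.intervalIntegrable 0 t), ← map_add,
      ← (hl.classical n).mild t ht]
  · have h1 := ENNReal.Tendsto.const_mul (a := (‖N‖₊ : ℝ≥0∞)) (hl.tendsto_control t ht')
      (Or.inr ENNReal.coe_ne_top)
    rw [mul_zero] at h1
    refine tendsto_of_tendsto_of_tendsto_of_le_of_le tendsto_const_nhds h1 (fun _ => zero_le)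
      fun n => ?_
    have h2 := eLpNorm_le_nnreal_smul_eLpNorm_of_ae_le_mul
      (f := (fun s => B (t - s) (N (W n s))) - fun s => B (t - s) (N (w s))) (g := W n - w)
      (μ := volume.restrict (Ioo 0 t)) (c := ‖N‖₊)
      (ae_of_all _ fun s => by
        simp only [Pi.sub_apply, ← map_sub]
        exact hb _ _) 2
    simpa [ENNReal.smul_def] using h2

/-- Uniqueness for the integrated homogeneous problem with zero initial value. -/
lemma eq_zero_of_integral_eq (hA : IsMDissipative A l₀)
    (hL : ∀ a b, L a = ι b → (a, b) ∈ A.graph) {u : ℝ → F}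
    (hy : ∀ T > 0, IntegrableOn y (Ioo 0 T))
    (hae : ∀ᵐ t ∂volume.restrict (Ioi 0), u t = ι (y t))
    (heq : ∀ t ≥ 0, u t = ∫ s in (0 : ℝ)..t, L (y s)) {t : ℝ} (ht : 0 ≤ t) : u t = 0 := by
  -- Nothing is known about `y` at negative times; the truncation is integrable on every bounded
  -- interval.
  set x : ℝ → H := (Ioi (0 : ℝ)).indicator y with hx
  have hxi : ∀ a b, IntervalIntegrable x volume a b := fun a b => by
    have h1 : Integrable x (volume.restrict (uIoc a b)) := by
      rw [hx, integrable_indicator_iff measurableSet_Ioi, IntegrableOn,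
        Measure.restrict_restrict measurableSet_Ioi]
      refine (hy (|a| + |b| + 1) (by positivity)).mono_set fun s hs => ⟨hs.1, ?_⟩
      have := hs.2.2
      have h2 : max a b ≤ |a| + |b| := max_le (by linarith [le_abs_self a, abs_nonneg b])
        (by linarith [le_abs_self b, abs_nonneg a])
      linarith
    exact intervalIntegrable_iff.2 h1
  have hxe : ∀ {M : H →L[ℝ] F} {t : ℝ}, 0 ≤ t → ∫ s in (0 : ℝ)..t, M (y s) =
      M (∫ s in (0 : ℝ)..t, x s) := fun {M t} ht => by
    rw [← M.intervalIntegral_comp_comm (hxi 0 t)]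
    refine intervalIntegral.integral_congr_ae (ae_of_all _ fun s hs => ?_)
    rw [uIoc_of_le ht] at hs
    rw [hx, indicator_of_mem (mem_Ioi.2 hs.1)]
  -- The equation is integrated once more, since neither `y` nor `P` need lie in the domain of `A`.
  -- For `Q = ∫ P` one finds `L Q = ι P`, so that `Q` lies in the domain and `A Q = P = Q'`.
  -- Dissipativity makes `‖Q‖` nonincreasing from `Q 0 = 0`; hence `Q = 0`, so for positive times `P
  -- = Q' = 0` and `u = L P = 0`.
  set P : ℝ → H := fun t => ∫ s in (0 : ℝ)..t, x s with hP
  have hPc : Continuous P := intervalIntegral.continuous_primitive hxi 0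
  set Q : ℝ → H := fun t => ∫ s in (0 : ℝ)..t, P s with hQ
  have hQd : ∀ t, HasDerivAt Q (P t) t := fun t =>
    intervalIntegral.integral_hasDerivAt_right (hPc.intervalIntegrable _ _)
      (hPc.stronglyMeasurableAtFilter _ _) hPc.continuousAt
  have hLP : ∀ t, 0 ≤ t → L (P t) = u t := fun t ht => by rw [heq t ht, hxe ht]
  have hιP : ∀ t, 0 ≤ t → ι (P t) = ∫ s in (0 : ℝ)..t, u s := fun t ht => by
    rw [← hxe ht]
    refine intervalIntegral.integral_congr_ae ?_
    rw [ae_restrict_iff' measurableSet_Ioi] at hae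
    filter_upwards [hae] with s hs h
    rw [uIoc_of_le ht] at h
    exact (hs h.1).symm
  have hmem : ∀ t, 0 ≤ t → (Q t, P t) ∈ A.graph := fun t ht => by
    refine hL _ _ ?_
    rw [hιP t ht, hQ, ← L.intervalIntegral_comp_comm (hPc.intervalIntegrable _ _)]
    refine intervalIntegral.integral_congr fun s hs => ?_
    rw [uIcc_of_le ht] at hs
    exact hLP s hs.1
  have hanti : AntitoneOn (fun t => ‖Q t‖ ^ 2) (Ici 0) := by
    have hd : ∀ t, HasDerivAt (fun t => ‖Q t‖ ^ 2) (2 * ⟪Q t, P t⟫_ℝ) t := fun t =>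
      (hQd t).norm_sq
    refine antitoneOn_of_deriv_nonpos (convex_Ici 0)
      (fun t _ => (hd t).continuousAt.continuousWithinAt)
      (fun t _ => (hd t).differentiableAt.differentiableWithinAt) fun t ht => ?_
    rw [interior_Ici] at ht
    rw [(hd t).deriv, real_inner_comm]
    linarith [hA.diss _ _ (hmem t (le_of_lt ht))]
  have hQ0 : ∀ t, 0 ≤ t → Q t = 0 := fun t ht => by
    have h1 := hanti (mem_Ici.2 le_rfl) (mem_Ici.2 ht) ht
    have h2 : Q 0 = 0 := by simp [hQ]
    simp only [h2, norm_zero] at h1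
    exact norm_eq_zero.1 (by nlinarith [norm_nonneg (Q t)])
  rcases ht.eq_or_lt with rfl | ht'
  · simp [heq 0 le_rfl]
  have hP0 : P t = 0 := by
    have h1 : Q =ᶠ[𝓝 t] fun _ => 0 :=
      eventually_of_mem (Ioi_mem_nhds ht') fun s hs => hQ0 s (le_of_lt hs)
    exact (hQd t).unique ((hasDerivAt_const t (0 : H)).congr_of_eventuallyEq h1)
  rw [← hLP t ht, hP0, map_zero]

/-- An integral of `h` has the weak derivative `h`. -/
lemma isWeakTimeDeriv_of_integral_eq {u h : ℝ → F} (hh : MemL2Loc h)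
    (hu : ∀ t ≥ 0, u t - u 0 = ∫ s in (0 : ℝ)..t, h s) : IsWeakTimeDeriv u h := by
  intro ψ hψ hsupp
  obtain ⟨T, hT, hψT⟩ : ∃ T > 0, ∀ t ≥ T, ψ t = 0 := by
    obtain ⟨R, hR⟩ := hψ.2.isCompact.isBounded.subset_closedBall (0 : ℝ)
    refine ⟨|R| + 1, by positivity, fun t ht => image_eq_zero_of_notMem_tsupport fun h => ?_⟩
    have := hR h
    rw [mem_closedBall_zero_iff, Real.norm_eq_abs] at this
    linarith [le_abs_self t, le_abs_self R]
  have hψ0 : ∀ t ≤ 0, ψ t = 0 := fun t ht => image_eq_zero_of_notMem_tsupport fun h =>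
    absurd (hsupp h) (not_lt.2 ht)
  have hψ'T : ∀ t > T, deriv ψ t = 0 := fun t ht => by
    have : ψ =ᶠ[𝓝 t] fun _ => 0 := eventually_of_mem (Ioi_mem_nhds ht) fun s hs => hψT s (le_of_lt hs)
    rw [this.deriv_eq]; simp
  have hd : ∀ t, HasDerivAt ψ (deriv ψ t) t := fun t =>
    ((hψ.1.differentiable (by simp)) t).hasDerivAt
  have hdc : Continuous (deriv ψ) := hψ.1.continuous_deriv (by simp)
  have hint : ∀ a, ∫ t in a..T, deriv ψ t = -ψ a := fun a => by
    rw [intervalIntegral.integral_eq_sub_of_hasDerivAt (fun t _ => hd t)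
      (hdc.intervalIntegrable _ _), hψT T le_rfl, zero_sub]
  have hr : ∀ (f : ℝ → F), (∀ t > T, f t = 0) →
      ∫ t in Ioi (0 : ℝ), f t = ∫ t in Ioc 0 T, f t := fun f hf =>
    setIntegral_eq_of_subset_of_forall_sdiff_eq_zero measurableSet_Ioi Ioc_subset_Ioi_self
      fun t ht => hf t (not_le.1 fun h => ht.2 ⟨ht.1, h⟩)
  rw [hr _ fun t ht => by rw [hψ'T t ht, zero_smul],
    hr _ fun t ht => by rw [hψT t ht.le, zero_smul]]
  have hhi : Integrable h (volume.restrict (Ioc 0 T)) := by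
    rw [restrict_Ioo_eq_restrict_Ioc.symm]
    exact (hh T hT).integrable one_le_two
  have hdi : Integrable (deriv ψ) (volume.restrict (Ioc 0 T)) :=
    (hdc.intervalIntegrable 0 T).1
  -- Fubini's theorem on the triangle `s ≤ t`: integrating in `s` first produces `u`, integrating in
  -- `t` first produces `-ψ`.
  set J : ℝ → ℝ → F := fun t s => {p : ℝ × ℝ | p.2 ≤ p.1}.indicator
    (fun p => deriv ψ p.1 • h p.2) (t, s) with hJ
  have hJi : Integrable (Function.uncurry J)
      ((volume.restrict (Ioc 0 T)).prod (volume.restrict (Ioc 0 T))) :=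
    (hdi.smul_prod hhi).indicator (measurableSet_le measurable_snd measurable_fst)
  have h1 : ∫ t in Ioc 0 T, deriv ψ t • u 0 = 0 := by
    rw [integral_smul_const, ← intervalIntegral.integral_of_le hT.le, hint, hψ0 0 le_rfl]
    simp
  have h2 : ∀ t ∈ Ioc 0 T, deriv ψ t • u t - deriv ψ t • u 0 = ∫ s in Ioc 0 T, J t s := by
    intro t ht
    have e : (fun s => J t s) = (Iic t).indicator fun s => deriv ψ t • h s := by
      funext s
      simp only [hJ, indicator_apply, mem_ofPred_eq, mem_Iic]
    rw [← smul_sub, hu t ht.1.le, e, setIntegral_indicator measurableSet_Iic,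
      integral_smul, intervalIntegral.integral_of_le ht.1.le]
    congr 3
    ext s
    simp only [mem_Ioc, mem_inter_iff, mem_Iic]
    exact ⟨fun h => ⟨⟨h.1, h.2.trans ht.2⟩, h.2⟩, fun h => ⟨h.1.1, h.2⟩⟩
  have h3 : ∀ s ∈ Ioc 0 T, ∫ t in Ioc 0 T, J t s = -(ψ s • h s) := by
    intro s hs
    have e : (fun t => J t s) = (Ici s).indicator fun t => deriv ψ t • h s := by
      funext t
      simp only [hJ, indicator_apply, mem_ofPred_eq, mem_Ici]
    rw [e, setIntegral_indicator measurableSet_Ici, integral_smul_const]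
    have e' : Ioc 0 T ∩ Ici s = Icc s T := by
      ext t
      simp only [mem_Ioc, mem_inter_iff, mem_Ici, mem_Icc]
      exact ⟨fun h => ⟨h.2, h.1.2⟩, fun h => ⟨⟨hs.1.trans_le h.1, h.2⟩, h.1⟩⟩
    rw [e', integral_Icc_eq_integral_Ioc, ← intervalIntegral.integral_of_le hs.2, hint, neg_smul]
  have h4 : ∫ t in Ioc 0 T, deriv ψ t • u t = ∫ t in Ioc 0 T, ∫ s in Ioc 0 T, J t s := by
    have hc : Integrable (fun t => deriv ψ t • u 0) (volume.restrict (Ioc 0 T)) :=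
      hdi.smul_const _
    have e : ∫ t in Ioc 0 T, deriv ψ t • u t =
        ∫ t in Ioc 0 T, ((∫ s in Ioc 0 T, J t s) + deriv ψ t • u 0) :=
      setIntegral_congr_fun measurableSet_Ioc fun t ht => by
        simp only [← h2 t ht, sub_add_cancel]
    have hJt : Integrable (fun t => ∫ s in Ioc 0 T, J t s) (volume.restrict (Ioc 0 T)) :=
      hJi.integral_prod_left
    rw [e, integral_add hJt hc, h1, add_zero]
  rw [h4, integral_integral_swap hJi, ← integral_neg]
  exact setIntegral_congr_fun measurableSet_Ioc fun s hs => h3 s hs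

end TimeDependent

/-! ### The abstract well-posedness theorem -/

section WellPosed

variable {H K F : Type*} [NormedAddCommGroup H] [InnerProductSpace ℝ H] [CompleteSpace H]
  [NormedAddCommGroup K] [InnerProductSpace ℝ K] [CompleteSpace K]
  [NormedAddCommGroup F] [NormedSpace ℝ F] [CompleteSpace F]
  {A : H →ₗ.[ℝ] H} {S : ℝ → H →L[ℝ] H} {Γ : Submodule ℝ (H × H × K)}
  {𝒩 : Submodule ℝ (H × H)} {C : ℝ≥0} {l₀ : ℝ} {ι L N : H →L[ℝ] F}

/-- `u` solves `u' = L u + N w`, `u(0) = ι y₀`, where `ι : H → F` is the embedding of the state space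
into the extrapolation space. -/
def IsExtrapolatedSolution (ι L N : H →L[ℝ] F) (y₀ : H) (w : ℝ → H) (u : ℝ → F) : Prop :=
  ContinuousOn u (Ici 0) ∧ ∃ y : ℝ → H,
    (∀ T > 0, IntegrableOn y (Ioo 0 T)) ∧
    (∀ᵐ t ∂volume.restrict (Ioi 0), u t = ι (y t)) ∧
    ∀ t ≥ 0, u t - ι y₀ = ∫ s in (0 : ℝ)..t, (L (y s) + N (w s))

lemma IsExtrapolatedSolution.sub {y₀ : H} {w : ℝ → H} (hw : MemL2Loc w) {u u' : ℝ → F}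
    (h : IsExtrapolatedSolution ι L N y₀ w u) (h' : IsExtrapolatedSolution ι L N y₀ w u') :
    ∃ y : ℝ → H,
      (∀ T > 0, IntegrableOn y (Ioo 0 T)) ∧
      (∀ᵐ t ∂volume.restrict (Ioi 0), u t - u' t = ι (y t)) ∧
      ∀ t ≥ 0, u t - u' t = ∫ s in (0 : ℝ)..t, L (y s) := by
  obtain ⟨-, y, hy, hae, heq⟩ := h
  obtain ⟨-, y', hy', hae', heq'⟩ := h'
  refine ⟨fun s => y s - y' s, fun T hT => (hy T hT).sub (hy' T hT), ?_, fun t ht => ?_⟩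
  · filter_upwards [hae, hae'] with t h1 h2
    rw [h1, h2, map_sub]
  rcases ht.eq_or_lt with rfl | ht'
  · have h1 := heq 0 le_rfl
    have h2 := heq' 0 le_rfl
    rw [intervalIntegral.integral_same] at h1 h2 ⊢
    rw [sub_eq_zero.1 h1, sub_eq_zero.1 h2, sub_self]
  have hi : ∀ {L : H →L[ℝ] F} {x : ℝ → H}, IntegrableOn x (Ioo 0 t) →
      IntervalIntegrable (fun s => L (x s)) volume 0 t := fun {L x} hx => by
    rw [intervalIntegrable_iff_integrableOn_Ioo_of_le ht]
    exact L.integrable_comp hx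
  have hwi := hi (L := N) ((hw t ht').integrable one_le_two)
  have h1 : u t - u' t = (u t - ι y₀) - (u' t - ι y₀) := by abel
  rw [h1, heq t ht, heq' t ht,
    ← intervalIntegral.integral_sub ((hi (hy t ht')).add hwi) ((hi (hy' t ht')).add hwi)]
  refine intervalIntegral.integral_congr fun s _ => ?_
  simp only [map_sub]
  abel

lemma eLpNorm_toLp_le {X F F' : Type*} [MeasurableSpace X] {μ : Measure X}
    [NormedAddCommGroup F] [NormedAddCommGroup F'] {f : X → F} {f' : X → F'}
    (hf : AEStronglyMeasurable f μ) (hf' : AEStronglyMeasurable f' μ) :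
    eLpNorm (fun t => WithLp.toLp 2 (f t, f' t)) 2 μ ≤ eLpNorm f 2 μ + eLpNorm f' 2 μ := by
  calc eLpNorm (fun t => WithLp.toLp 2 (f t, f' t)) 2 μ
      ≤ eLpNorm ((fun t => ‖f t‖) + fun t => ‖f' t‖) 2 μ := by
        refine eLpNorm_mono_real fun t => ?_
        have h := WithLp.prod_norm_sq_eq_of_L2 (WithLp.toLp 2 (f t, f' t))
        simp only [Pi.add_apply, WithLp.toLp_fst, WithLp.toLp_snd] at h ⊢
        refine abs_le_of_sq_le_sq' ?_ (by positivity) |>.2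
        rw [h]
        nlinarith [norm_nonneg (f t), norm_nonneg (f' t)]
    _ ≤ _ := by
        refine (eLpNorm_add_le hf.norm hf'.norm one_le_two).trans ?_
        rw [eLpNorm_norm, eLpNorm_norm]

/-- Well-posedness of `y' = A y + N w` for a maximally dissipative operator `A` whose dissipation
dominates `N`. -/
theorem exists_solution_of_isDissipationGraph (hA : IsMDissipative A l₀)
    (hS : IsContractionSemigroupOf A S) {B : ℝ → F →L[ℝ] F}
    (hB : ∀ t ≥ 0, ∀ f, B t (ι f) = ι (S t f)) (hB' : ∀ t u, ‖B t u‖ ≤ ‖u‖)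
    (hL : ∀ a b, L a = ι b ↔ (a, b) ∈ A.graph)
    (hΓ : IsDissipationGraph A Γ) (h𝒩 : IsDominated Γ 𝒩 C)
    (hN : ∀ f n, (f, n) ∈ 𝒩 → N f = ι n)
    (hd : ∀ c : H, ∀ ε > 0, ∃ f n, (f, n) ∈ 𝒩 ∧ ‖f - c‖ < ε)
    {P : H → K → Prop} (hP : ∀ y z g, (y, z, g) ∈ Γ → P y g)
    (hlim : ∀ (y : H) (g : K) (u : ℕ → H) (D : ℕ → K), (∀ n, P (u n) (D n)) →
      Tendsto u atTop (𝓝 y) → Tendsto D atTop (𝓝 g) → P y g) :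
    ∃ (C₁ : ℝ≥0) (C₂ C₃ : ℝ → ℝ≥0),
      ∀ (y₀ : H) (w : ℝ → H), MemL2Loc w →
        ∃ (y : ℝ → H) (g : ℝ → K) (ydot : ℝ → F),
          IsExtrapolatedSolution ι L N y₀ w (fun t => ι (y t)) ∧
          (∀ u, IsExtrapolatedSolution ι L N y₀ w u → ∀ t ≥ 0, u t = ι (y t)) ∧
          (∀ t ≥ 0, ι (y t) = ι (S t y₀) + ∫ s in (0 : ℝ)..t, B (t - s) (N (w s))) ∧
          (∀ᵐ t ∂volume.restrict (Ioi (0 : ℝ)), P (y t) (g t)) ∧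
          MemL2Loc g ∧
          IsWeakTimeDeriv (fun t => ι (y t)) ydot ∧
          MemL2Loc ydot ∧
          ∀ T > 0,
            MemLp y ⊤ (volume.restrict (Ioo 0 T)) ∧
            max (eLpNorm y ⊤ (volume.restrict (Ioo 0 T)))
                (eLpNorm g 2 (volume.restrict (Ioo 0 T))) ≤
              C₁ * (‖y₀‖ₑ + eLpNorm w 2 (volume.restrict (Ioo 0 T))) ∧
            eLpNorm (fun t => WithLp.toLp 2 (y t, g t)) 2 (volume.restrict (Ioo 0 T)) ≤
              C₂ T * (‖y₀‖ₑ + eLpNorm w 2 (volume.restrict (Ioo 0 T))) ∧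
            eLpNorm ydot 2 (volume.restrict (Ioo 0 T)) ≤
              C₃ T * (‖y₀‖ₑ + eLpNorm w 2 (volume.restrict (Ioo 0 T))) := by
  -- `M T = √T`, the constant of the embedding of `L^∞(0,T)` into `L²(0,T)`; the real value of `⊤`
  -- is `0` and `1 / 0 = 0`, so the exponent is `1/2`.
  set M : ℝ → ℝ≥0 := fun T => (((volume.restrict (Ioo 0 T)) univ) ^ (1 / (2 : ℝ≥0∞).toReal -
    1 / (⊤ : ℝ≥0∞).toReal)).toNNReal with hM
  have hMe : ∀ T, (M T : ℝ≥0∞) = ((volume.restrict (Ioo 0 T)) univ) ^ (1 / (2 : ℝ≥0∞).toReal -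
    1 / (⊤ : ℝ≥0∞).toReal) := fun T =>
    ENNReal.coe_toNNReal (ENNReal.rpow_ne_top_of_nonneg (by norm_num) (measure_ne_top _ _))
  -- The energy bound `‖y₀‖ + C‖w‖` gives `1 + C`. The second constant adds the `L²` bounds of `y`
  -- and `g`, and the third bounds the time derivative, which is `L y + N w`.
  refine ⟨1 + C, fun T => (1 + C) * M T + (1 + C),
    fun T => ‖L‖₊ * ((1 + C) * M T) + ‖N‖₊, fun y₀ w hw => ?_⟩
  obtain ⟨W, k, U, Z, D, y, g, hl⟩ := exists_isLimitSolution hA hS hΓ h𝒩 hd y₀ hw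
  have heq : ∀ t ≥ 0, ι (y t) - ι y₀ =
      ∫ s in (0 : ℝ)..t, (L (y s) + N (w s)) := fun t ht =>
    hl.clm_eq hΓ (fun a b h => (hL a b).2 h) hN hw ht
  have hsol : IsExtrapolatedSolution ι L N y₀ w fun t => ι (y t) :=
    ⟨(ι).continuous.comp_continuousOn hl.continuousOn, y,
      fun T hT => (hl.memL2Loc hw T hT).integrable one_le_two, ae_of_all _ fun _ => rfl, heq⟩
  have hrhs : MemL2Loc fun s => L (y s) + N (w s) := fun T hT =>
    memLp_clm_add_clm (L) (N) (hl.memL2Loc hw T hT) (hw T hT)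
  have hb : ∀ {T : ℝ}, ‖y₀‖ₑ + C * eLpNorm w 2 (volume.restrict (Ioo 0 T)) ≤
      ((1 + C : ℝ≥0) : ℝ≥0∞) * (‖y₀‖ₑ + eLpNorm w 2 (volume.restrict (Ioo 0 T))) := fun {T} => by
    push_cast
    have h1 : (1 : ℝ≥0∞) ≤ 1 + C := le_self_add
    have h2 : (C : ℝ≥0∞) ≤ 1 + C := le_add_self
    rw [mul_add]
    gcongr
    exact le_mul_of_one_le_left zero_le h1
  have hy2 : ∀ {T : ℝ}, 0 < T → eLpNorm y 2 (volume.restrict (Ioo 0 T)) ≤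
      (((1 + C) * M T : ℝ≥0) : ℝ≥0∞) *
        (‖y₀‖ₑ + eLpNorm w 2 (volume.restrict (Ioo 0 T))) := fun {T} hT => by
    refine (eLpNorm_le_eLpNorm_mul_rpow_measure_univ le_top (hl.aestronglyMeasurable T)).trans ?_
    rw [← hMe, ENNReal.coe_mul, mul_right_comm]
    gcongr
    exact (hl.eLpNorm_top_le hT).trans hb
  refine ⟨y, g, fun s => L (y s) + N (w s), hsol, fun u hu t ht => ?_,
    fun t ht => ?_, ?_, hl.memL2Loc_grad hw, ?_, hrhs,
    fun T hT => ⟨hl.memLp_top hT hw, ?_, ?_, ?_⟩⟩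
  · obtain ⟨x, h2, h3, h4⟩ := hu.sub hw hsol
    exact sub_eq_zero.1 (eq_zero_of_integral_eq (u := fun t => u t - ι (y t)) hA (fun a b h => (hL a b).1 h) h2 h3 h4 ht)
  · exact hl.clm_mild hS hB hB' hN hw ht
  · filter_upwards [hl.tendsto_grad, ae_restrict_mem measurableSet_Ioi] with t ht ht0
    exact hlim _ _ _ _ (fun n => hP _ _ _ ((hl.classical n).mem t))
      (hl.tendsto_apply (le_of_lt ht0)) ht
  · refine isWeakTimeDeriv_of_integral_eq hrhs fun t ht => ?_
    simp only [hl.zero]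
    exact heq t ht
  · exact max_le ((hl.eLpNorm_top_le hT).trans hb) ((hl.bound_grad T hT).trans hb)
  · refine (eLpNorm_toLp_le (hl.aestronglyMeasurable T)
      hl.measurable_grad.aestronglyMeasurable).trans ?_
    rw [ENNReal.coe_add, add_mul]
    exact add_le_add (hy2 hT) ((hl.bound_grad T hT).trans hb)
  · refine (eLpNorm_add_le (f := fun s => L (y s)) (g := fun s => N (w s))
      ((L).continuous.comp_aestronglyMeasurable (hl.aestronglyMeasurable T))
      ((N).continuous.comp_aestronglyMeasurable (hw T hT).1) one_le_two).trans ?_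
    have h1 := eLpNorm_clm_le (μ := volume.restrict (Ioo 0 T)) (L) y 2
    have h2 := eLpNorm_clm_le (μ := volume.restrict (Ioo 0 T)) (N) w 2
    rw [ENNReal.coe_add, add_mul, ENNReal.coe_mul, mul_assoc]
    refine add_le_add (h1.trans ?_) (h2.trans ?_)
    · gcongr
      exact hy2 hT
    · gcongr
      exact le_add_self

end WellPosed

/-! ### Reduction of the theorem to properties of `opA` and `opN` -/

section Final

variable {d : ℕ} {G α : E d → ℝ} {Γ : Submodule ℝ (Y G × Y G × Yd G)}
  {𝒩 : Submodule ℝ (Y G × Y G)} {C : ℝ≥0} {l₀ : ℝ}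

theorem exists_solution_opA (hA : IsMDissipative (opA G) l₀)
    (hA' : ∀ h, ∃ x : DAdj G, l₀ • dIncl G x - dAdj G x = h)
    (hΓ : IsDissipationGraph (opA G) Γ) (h𝒩 : IsDominated Γ 𝒩 C)
    (hN : ∀ f n, (f, n) ∈ 𝒩 → opN G α f = emb G n)
    (hd : ∀ c : Y G, ∀ ε > 0, ∃ f n, (f, n) ∈ 𝒩 ∧ ‖f - c‖ < ε)
    (hgrad : ∀ y z g, (y, z, g) ∈ Γ → IsWeakGradV y g)
    (hlim : ∀ (y : Y G) (g : Yd G) (u : ℕ → Y G) (D : ℕ → Yd G), (∀ n, IsWeakGradV (u n) (D n)) →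
      Tendsto u atTop (𝓝 y) → Tendsto D atTop (𝓝 g) → IsWeakGradV y g) :
    ∃ (C₁ : ℝ≥0) (C₂ C₃ : ℝ → ℝ≥0),
      ∀ (y₀ : Y G) (w : ℝ → Y G), MemL2Loc w →
        ∃ (y : ℝ → Y G) (gradvy : ℝ → Yd G) (ydot : ℝ → Yneg G),
          IsSolution G α y₀ w (fun t => emb G (y t)) ∧
          (∀ u, IsSolution G α y₀ w u → ∀ t ≥ 0, u t = emb G (y t)) ∧
          IsMildSolution G α y₀ w y ∧
          (∀ᵐ t ∂volume.restrict (Ioi (0 : ℝ)), IsWeakGradV (y t) (gradvy t)) ∧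
          MemL2Loc gradvy ∧
          IsWeakTimeDeriv (fun t => emb G (y t)) ydot ∧
          MemL2Loc ydot ∧
          ∀ T > 0,
            MemLp y ⊤ (volume.restrict (Ioo 0 T)) ∧
            max (eLpNorm y ⊤ (volume.restrict (Ioo 0 T)))
                (eLpNorm gradvy 2 (volume.restrict (Ioo 0 T))) ≤
              C₁ * (‖y₀‖ₑ + eLpNorm w 2 (volume.restrict (Ioo 0 T))) ∧
            eLpNorm (fun t => WithLp.toLp 2 (y t, gradvy t)) 2 (volume.restrict (Ioo 0 T)) ≤
              C₂ T * (‖y₀‖ₑ + eLpNorm w 2 (volume.restrict (Ioo 0 T))) ∧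
            eLpNorm ydot 2 (volume.restrict (Ioo 0 T)) ≤
              C₃ T * (‖y₀‖ₑ + eLpNorm w 2 (volume.restrict (Ioo 0 T))) := by
  obtain ⟨S, hS⟩ := hA.exists_semigroup
  obtain ⟨B, hB, hB'⟩ := exists_extension_semigroup hA.dense hS
  obtain ⟨C₁, C₂, C₃, h⟩ := exists_solution_of_isDissipationGraph (F := Yneg G) (ι := emb G)
    (L := extA G) (N := opN G α) (P := fun y g => IsWeakGradV y g) hA hS hB hB'
    (fun a b => ⟨mem_graph_of_extA_eq_emb hA hA', extA_eq_emb hA.dense⟩) hΓ h𝒩 hN hd hgrad hlim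
  refine ⟨C₁, C₂, C₃, fun y₀ w hw => ?_⟩
  obtain ⟨y, g, ydot, h1, h2, h3, h4⟩ := h y₀ w hw
  exact ⟨y, g, ydot, h1, h2, ⟨S, B, hS.toIsSemigroupOf, hB, h3⟩, h4⟩

end Final

/-! ### Locally bounded coefficients -/

section LocallyBounded

variable {X : Type*} [NormedAddCommGroup X] [MeasureSpace X]

/-- `c ∈ L^∞_loc(X)`. -/
def LocBdd (c : X → ℝ) : Prop :=
  AEStronglyMeasurable c volume ∧ ∀ R : ℝ, ∃ M : ℝ, ∀ᵐ p, ‖p‖ ≤ R → |c p| ≤ M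

namespace LocBdd

variable {c c' : X → ℝ}

lemma exists_nonneg (h : LocBdd c) (R : ℝ) : ∃ M : ℝ, 0 ≤ M ∧ ∀ᵐ p, ‖p‖ ≤ R → |c p| ≤ M := by
  obtain ⟨M, hM⟩ := h.2 R
  exact ⟨|M|, abs_nonneg _, hM.mono fun p hp hR => (hp hR).trans (le_abs_self _)⟩

lemma const (a : ℝ) : LocBdd fun _ : X => a :=
  ⟨aestronglyMeasurable_const, fun _ => ⟨|a|, ae_of_all _ fun _ _ => le_rfl⟩⟩

lemma add (h : LocBdd c) (h' : LocBdd c') : LocBdd fun p => c p + c' p := by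
  refine ⟨h.1.add h'.1, fun R => ?_⟩
  obtain ⟨M, hM⟩ := h.2 R
  obtain ⟨M', hM'⟩ := h'.2 R
  refine ⟨M + M', ?_⟩
  filter_upwards [hM, hM'] with p h1 h2 hR
  exact (abs_add_le _ _).trans (add_le_add (h1 hR) (h2 hR))

lemma mul (h : LocBdd c) (h' : LocBdd c') : LocBdd fun p => c p * c' p := by
  refine ⟨h.1.mul h'.1, fun R => ?_⟩
  obtain ⟨M, hM0, hM⟩ := h.exists_nonneg R
  obtain ⟨M', hM'⟩ := h'.2 R
  refine ⟨M * M', ?_⟩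
  filter_upwards [hM, hM'] with p h1 h2 hR
  rw [abs_mul]
  exact mul_le_mul (h1 hR) (h2 hR) (abs_nonneg _) hM0

lemma neg (h : LocBdd c) : LocBdd fun p => -c p := by
  simpa using (const (-1)).mul h

lemma sub (h : LocBdd c) (h' : LocBdd c') : LocBdd fun p => c p - c' p := by
  simpa [sub_eq_add_neg] using h.add h'.neg

lemma sum {ι : Type*} {s : Finset ι} {c : ι → X → ℝ} (h : ∀ i ∈ s, LocBdd (c i)) :
    LocBdd fun p => ∑ i ∈ s, c i p := by
  classical
  induction s using Finset.induction_on with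
  | empty => simpa using const 0
  | insert i s hi ih =>
    simp only [Finset.sum_insert hi]
    exact (h i (Finset.mem_insert_self i s)).add
      (ih fun j hj => h j (Finset.mem_insert_of_mem hj))

lemma comp_continuous (h : LocBdd c) {f : ℝ → ℝ} (hf : Continuous f) : LocBdd fun p => f (c p) := by
  refine ⟨hf.comp_aestronglyMeasurable h.1, fun R => ?_⟩
  obtain ⟨M, hM⟩ := h.2 R
  obtain ⟨M', hM'⟩ := (isCompact_Icc (a := -M) (b := M)).exists_bound_of_continuousOn hf.continuousOn
  exact ⟨M', hM.mono fun p hp hR => hM' _ (abs_le.1 (hp hR))⟩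

variable [BorelSpace X] [ProperSpace X]

lemma of_continuous (h : Continuous c) : LocBdd c := by
  refine ⟨h.aestronglyMeasurable, fun R => ?_⟩
  obtain ⟨M, hM⟩ := (isCompact_closedBall (0 : X) R).exists_bound_of_continuousOn h.continuousOn
  exact ⟨M, ae_of_all _ fun p hp => hM p (mem_closedBall_zero_iff.2 hp)⟩

variable [IsFiniteMeasureOnCompacts (volume : Measure X)]

lemma locallyIntegrable (h : LocBdd c) : LocallyIntegrable c volume := by
  refine locallyIntegrable_iff.2 fun K hK => ?_
  obtain ⟨R, hR⟩ := hK.isBounded.subset_closedBall (0 : X)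
  obtain ⟨M, hM⟩ := h.2 R
  refine Measure.integrableOn_of_bounded hK.measure_lt_top.ne h.1 (M := M) ?_
  filter_upwards [ae_restrict_of_ae hM, ae_restrict_mem hK.measurableSet] with p h1 h2
  exact h1 (mem_closedBall_zero_iff.1 (hR h2))

lemma integrable_mul {ψ : X → ℝ} (h : LocBdd c) (hψ : Continuous ψ) (hψc : HasCompactSupport ψ) :
    Integrable fun p => c p * ψ p :=
  h.locallyIntegrable.integrable_smul_right_of_hasCompactSupport hψ hψc

/-- A locally bounded function times a compactly supported one is bounded. -/
lemma exists_ae_bound_mul {ψ : X → ℝ} (h : LocBdd c) (hψ : Continuous ψ)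
    (hψ' : HasCompactSupport ψ) : ∃ M, ∀ᵐ p, ‖c p * ψ p‖ ≤ M := by
  obtain ⟨R, hR⟩ := hψ'.isCompact.isBounded.subset_closedBall (0 : X)
  obtain ⟨M, hM⟩ := h.2 R
  obtain ⟨M', hM'⟩ := hψ.bounded_above_of_compact_support hψ'
  refine ⟨|M| * M', hM.mono fun p hp => ?_⟩
  have h0 : 0 ≤ M' := (norm_nonneg _).trans (hM' p)
  by_cases h : p ∈ tsupport ψ
  · rw [norm_mul]
    exact mul_le_mul ((hp (mem_closedBall_zero_iff.1 (hR h))).trans (le_abs_self M)) (hM' p)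
      (norm_nonneg _) (abs_nonneg _)
  · rw [image_eq_zero_of_notMem_tsupport h, mul_zero, norm_zero]
    positivity

end LocBdd

end LocallyBounded

/-! ### Directional derivatives of smooth functions -/

section PartialDerivatives

variable {X : Type*} [NormedAddCommGroup X] [NormedSpace ℝ X]

/-- The derivative of `φ` in the direction `e`. -/
def pd (e : X) (φ : X → ℝ) (p : X) : ℝ := fderiv ℝ φ p e

lemma pd_mul {e : X} {φ ψ : X → ℝ} (h : Differentiable ℝ φ) (h' : Differentiable ℝ ψ) (p : X) :
    pd e (fun q => φ q * ψ q) p = pd e φ p * ψ p + φ p * pd e ψ p := by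
  simp only [pd]
  rw [fderiv_fun_mul (h p) (h' p)]
  simp only [add_apply, smul_apply, smul_eq_mul]
  ring

lemma contDiff_pd {e : X} {φ : X → ℝ} (h : ContDiff ℝ ∞ φ) : ContDiff ℝ ∞ (pd e φ) :=
  (h.fderiv_right (m := ∞) (by simp)).clm_apply contDiff_const

lemma continuous_pd {e : X} {φ : X → ℝ} (h : ContDiff ℝ ∞ φ) : Continuous (pd e φ) :=
  (contDiff_pd h).continuous

lemma IsTest.differentiable {φ : X → ℝ} (h : IsTest φ) : Differentiable ℝ φ :=
  h.1.differentiable (by simp)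

lemma IsTest.continuous {φ : X → ℝ} (h : IsTest φ) : Continuous φ := h.1.continuous

lemma IsTest.pd {e : X} {φ : X → ℝ} (h : IsTest φ) : IsTest (pd e φ) :=
  ⟨contDiff_pd h.1, (h.2.fderiv (𝕜 := ℝ)).comp_left (g := fun L : X →L[ℝ] ℝ => L e) (by simp)⟩

lemma IsTest.mul_left {φ ψ : X → ℝ} (h : IsTest φ) (h' : ContDiff ℝ ∞ ψ) :
    IsTest fun p => ψ p * φ p := ⟨h'.mul h.1, h.2.mul_left⟩

lemma IsTest.mul_right {φ ψ : X → ℝ} (h : IsTest φ) (h' : ContDiff ℝ ∞ ψ) :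
    IsTest fun p => φ p * ψ p := ⟨h.1.mul h', h.2.mul_right⟩

variable [MeasureSpace X] [BorelSpace X] [FiniteDimensional ℝ X]
  [(volume : Measure X).IsAddHaarMeasure]

/-- Integration by parts against a coefficient that is constant in the direction `e`. -/
lemma integral_mul_pd_eq_zero {c φ : X → ℝ} {e : X} (hc : LocBdd c)
    (hce : ∀ p (t : ℝ), c (p + t • e) = c p) (hφ : IsTest φ) : ∫ p, c p * pd e φ p = 0 := by
  have : ProperSpace X := FiniteDimensional.proper ℝ X
  have h := integral_bilinear_hasLineDerivAt_right_eq_neg_left_of_integrable (μ := (volume : Measure X))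
    (f := c) (f' := fun _ => 0) (g := φ) (g' := pd e φ) (v := e) (B := ContinuousLinearMap.mul ℝ ℝ)
    (by simp) (hc.integrable_mul hφ.pd.continuous hφ.pd.2)
    (hc.integrable_mul hφ.continuous hφ.2)
    (fun p _ => by
      simp only [HasLineDerivAt, hce]
      exact hasDerivAt_const _ _)
    (fun p _ => (hφ.differentiable p).hasFDerivAt.hasLineDerivAt e)
  simpa using h

end PartialDerivatives

/-! ### Convolution and mollifiers -/

section Convolution

variable {X : Type*} [NormedAddCommGroup X] [NormedSpace ℝ X] [MeasureSpace X] [BorelSpace X]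
  [FiniteDimensional ℝ X] [(volume : Measure X).IsAddHaarMeasure]

/-- The convolution `k * f`. -/
def cv (k f : X → ℝ) (p : X) : ℝ := ∫ q, k (p - q) * f q

lemma cv_eq_convolution (k f : X → ℝ) :
    cv k f = convolution f k (ContinuousLinearMap.lsmul ℝ ℝ) volume := by
  funext p
  simp only [cv, convolution_def, ContinuousLinearMap.lsmul_apply, smul_eq_mul, mul_comm]

lemma contDiff_cv {k f : X → ℝ} (hk : IsTest k) (hf : LocallyIntegrable f volume) :
    ContDiff ℝ ∞ (cv k f) := by
  rw [cv_eq_convolution]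
  exact hk.2.contDiff_convolution_right _ hf hk.1

lemma pd_cv {k f : X → ℝ} (hk : IsTest k) (hf : LocallyIntegrable f volume) (e p : X) :
    pd e (cv k f) p = cv (pd e k) f p := by
  have h1 : ContDiff ℝ 1 k := hk.1.of_le (by simp)
  have h := hk.2.hasFDerivAt_convolution_right (ContinuousLinearMap.lsmul ℝ ℝ) hf h1 p
  rw [pd, cv_eq_convolution, h.fderiv, convolution_precompR_apply _ hf (hk.2.fderiv ℝ)
    (h1.continuous_fderiv (by simp)), cv_eq_convolution]
  rfl

lemma IsTest.comp_sub {k : X → ℝ} (hk : IsTest k) (p : X) : IsTest fun q => k (p - q) :=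
  ⟨hk.1.comp (contDiff_const.sub contDiff_id),
    hk.2.comp_homeomorph (Homeomorph.subLeft p)⟩

lemma pd_comp_sub {k : X → ℝ} (hk : Differentiable ℝ k) (e p q : X) :
    pd e (fun q => k (p - q)) q = -pd e k (p - q) := by
  have h : HasFDerivAt (fun q => k (p - q)) ((fderiv ℝ k (p - q)).comp
      (-ContinuousLinearMap.id ℝ X)) q :=
    (hk (p - q)).hasFDerivAt.comp q ((hasFDerivAt_id q).const_sub p)
  simp [pd, h.fderiv]

lemma integrable_cv {k f : X → ℝ} (hk : Continuous k) (hk' : HasCompactSupport k)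
    (hf : LocallyIntegrable f volume) (p : X) : Integrable fun q => k (p - q) * f q :=
  hf.integrable_smul_left_of_hasCompactSupport (hk.comp (continuous_const.sub continuous_id))
    (hk'.comp_homeomorph (Homeomorph.subLeft p))

/-- A smooth nonnegative kernel of integral one, supported in the ball of radius `r`. -/
structure IsMollifier (k : X → ℝ) (r : ℝ) : Prop where
  isTest : IsTest k
  nonneg : ∀ p, 0 ≤ k p
  integral_eq : ∫ p, k p = 1
  eq_zero : ∀ p, r ≤ ‖p‖ → k p = 0

lemma ContDiffBump.isMollifier (b : ContDiffBump (0 : X)) :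
    IsMollifier (b.normed volume) b.rOut where
  isTest := ⟨b.contDiff_normed, b.hasCompactSupport_normed⟩
  nonneg := b.nonneg_normed
  integral_eq := b.integral_normed
  eq_zero := fun p hp => by
    have : p ∉ Function.support (b.normed (volume : Measure X)) := by
      rw [b.support_normed_eq]; simpa using hp
    simpa using this

lemma IsMollifier.abs_cv_le' {k f : X → ℝ} {r M : ℝ} (hk : IsMollifier k r) {p : X}
    (hM : ∀ᵐ q, ‖p - q‖ < r → |f q| ≤ M) : |cv k f p| ≤ M := by
  have h1 : ∫ q, k (p - q) = 1 := by
    rw [integral_sub_left_eq_self k volume p, hk.integral_eq]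
  have hi : Integrable fun q => k (p - q) :=
    (hk.isTest.comp_sub p).continuous.integrable_of_hasCompactSupport (hk.isTest.comp_sub p).2
  calc |cv k f p| ≤ ∫ q, k (p - q) * M := by
        change ‖∫ q, k (p - q) * f q‖ ≤ _
        refine norm_integral_le_of_norm_le (hi.mul_const M) ?_
        filter_upwards [hM] with q hq
        rw [norm_mul, Real.norm_of_nonneg (hk.nonneg _)]
        by_cases h : r ≤ ‖p - q‖
        · rw [hk.eq_zero _ h]; simp
        · exact mul_le_mul_of_nonneg_left (hq (not_le.1 h)) (hk.nonneg _)
    _ = M := by rw [integral_mul_const, h1, one_mul]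

lemma IsMollifier.abs_cv_le {k f : X → ℝ} {r R M : ℝ} (hk : IsMollifier k r)
    (hM : ∀ᵐ q, ‖q‖ ≤ R + r → |f q| ≤ M) {p : X} (hp : ‖p‖ ≤ R) : |cv k f p| ≤ M := by
  refine hk.abs_cv_le' (hM.mono fun q hq h => hq ?_)
  have h2 : ‖q‖ ≤ ‖p‖ + ‖p - q‖ := by simpa using norm_sub_le p (p - q)
  linarith

/-- The reflected and translated kernel `q ↦ k (p - q)` is an admissible test function. -/
lemma HasWeakDeriv.pd_cv {k f g : X → ℝ} {e : X} (h : HasWeakDeriv f g e) (hk : IsTest k) (p : X) :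
    pd e (cv k f) p = cv k g p := by
  rw [KFP.pd_cv hk h.locInt]
  have h1 := h.eq _ (hk.comp_sub p)
  change ∫ q, f q * pd e (fun q => k (p - q)) q = _ at h1
  simp only [pd_comp_sub hk.differentiable, mul_neg, integral_neg, neg_inj] at h1
  simpa only [cv, mul_comm] using h1

lemma HasWeakDeriv.ae_eq {f g g' : X → ℝ} {e : X} (h : HasWeakDeriv f g e)
    (h' : HasWeakDeriv f g' e) : g =ᵐ[volume] g' := by
  refine ae_eq_of_integral_contDiff_smul_eq h.locInt' h'.locInt' fun φ hφ hφ' => ?_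
  have h1 := h.eq φ ⟨hφ, hφ'⟩
  rw [h'.eq φ ⟨hφ, hφ'⟩, neg_inj] at h1
  simpa only [smul_eq_mul, mul_comm] using h1.symm

/-- A sequence of mollifiers whose convolutions converge almost everywhere. -/
lemma exists_mollifier_seq (X : Type*) [NormedAddCommGroup X] [NormedSpace ℝ X] [MeasureSpace X]
    [BorelSpace X] [FiniteDimensional ℝ X] [(volume : Measure X).IsAddHaarMeasure]
    [HasContDiffBump X] :
    ∃ k : ℕ → X → ℝ, (∀ n, IsMollifier (k n) (1 / (n + 1))) ∧
      ∀ f : X → ℝ, LocallyIntegrable f volume →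
        ∀ᵐ x, Tendsto (fun n => cv (k n) f x) atTop (𝓝 (f x)) := by
  let b : ℕ → ContDiffBump (0 : X) := fun n =>
    ⟨1 / (n + 1) / 2, 1 / (n + 1), by positivity, by linarith [Nat.one_div_pos_of_nat (α := ℝ) (n := n)]⟩
  refine ⟨fun n => (b n).normed volume, fun n => ContDiffBump.isMollifier (b n), fun f hf => ?_⟩
  have h := ContDiffBump.ae_convolution_tendsto_right_of_locallyIntegrable (φ := b) (l := atTop)
    (K := 2) (μ := (volume : Measure X)) (g := f) tendsto_one_div_add_atTop_nhds_zero_nat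
    (Eventually.of_forall fun n => by change (1 : ℝ) / (n + 1) ≤ 2 * (1 / (n + 1) / 2); linarith) hf
  filter_upwards [h] with x hx
  refine hx.congr fun n => ?_
  simp only [cv, convolution_lsmul_swap, smul_eq_mul]

end Convolution

/-! ### The potentials and their smooth approximation -/

section Potential

variable {d : ℕ} {G α : E d → ℝ}

lemma isWeakGrad_weakGrad {f : E d → ℝ} (h : ∃ g, IsWeakGrad f g) : IsWeakGrad f (weakGrad f) := by
  rw [weakGrad, dif_pos h]
  exact h.choose_spec

lemma locBdd_of_memLp {X : Type*} [NormedAddCommGroup X] [MeasureSpace X] [BorelSpace X]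
    [ProperSpace X] {f : X → ℝ}
    (h : ∀ K : Set X, IsCompact K → MemLp f ⊤ (volume.restrict K)) : LocBdd f := by
  have hf : AEStronglyMeasurable f volume := by
    rw [← Measure.restrict_univ (μ := volume), ← Metric.iUnion_closedBall_nat (0 : X),
      aestronglyMeasurable_iUnion_iff]
    exact fun n => (h _ (isCompact_closedBall _ _)).1
  refine ⟨hf, fun R => ⟨(eLpNorm f ⊤ (volume.restrict (Metric.closedBall 0 R))).toReal, ?_⟩⟩
  have h1 := h _ (isCompact_closedBall (0 : X) R)
  have h2 := ae_le_eLpNormEssSup (f := f) (μ := volume.restrict (Metric.closedBall (0 : X) R))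
  rw [ae_restrict_iff' Metric.isClosed_closedBall.measurableSet] at h2
  filter_upwards [h2] with p hp hR
  have h3 := hp (mem_closedBall_zero_iff.2 hR)
  rw [← eLpNorm_exponent_top] at h3
  have h4 := ENNReal.toReal_mono h1.2.ne h3
  simpa using h4

lemma memLp_proj {X : Type*} [MeasurableSpace X] {μ : Measure X} {g : X → E d} {p : ℝ≥0∞}
    (h : MemLp g p μ) (i : Fin d) : MemLp (fun x => g x i) p μ :=
  (EuclideanSpace.proj i : E d →L[ℝ] ℝ).comp_memLp' h

lemma IsWeakGrad.ae_eq {f : E d → ℝ} {g g' : E d → E d} (h : IsWeakGrad f g)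
    (h' : IsWeakGrad f g') : g =ᵐ[volume] g' := by
  filter_upwards [ae_all_iff.2 fun i => (h i).ae_eq (h' i)] with x hx
  ext i
  exact hx i

lemma AssumptionA1.isWeakGrad (hG : AssumptionA1 G) : IsWeakGrad G (weakGrad G) :=
  isWeakGrad_weakGrad (hG.memW.2.imp fun _ h => h.1)

lemma AssumptionA1.locBdd_weakGrad (hG : AssumptionA1 G) (i : Fin d) :
    LocBdd fun x => weakGrad G x i := by
  obtain ⟨g, hg, hgb⟩ := hG.memW.2
  refine locBdd_of_memLp fun K hK => memLp_proj ((hgb K hK).ae_eq ?_) i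
  exact ae_restrict_of_ae (hg.ae_eq hG.isWeakGrad)

lemma AssumptionA1.locBdd (hG : AssumptionA1 G) : LocBdd G := locBdd_of_memLp hG.memW.1

lemma AssumptionA2.memLp_weakGrad (hα : AssumptionA2 α) : MemLp (weakGrad α) ⊤ volume := by
  obtain ⟨g, hg, hgb⟩ := hα.2
  exact hgb.ae_eq (hg.ae_eq (isWeakGrad_weakGrad ⟨g, hg⟩))

lemma AssumptionA2.locBdd_weakGrad (hα : AssumptionA2 α) (i : Fin d) :
    LocBdd fun x => weakGrad α x i :=
  locBdd_of_memLp fun _ _ => memLp_proj (hα.memLp_weakGrad.mono_measure Measure.restrict_le_self) i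

lemma AssumptionA2.exists_bound (hα : AssumptionA2 α) : ∃ C : ℝ≥0, ∀ᵐ x, ‖weakGrad α x‖ ≤ C := by
  refine ⟨(eLpNorm (weakGrad α) ⊤ volume).toNNReal, ?_⟩
  filter_upwards [ae_le_eLpNormEssSup (f := weakGrad α) (μ := volume)] with x hx
  rw [← eLpNorm_exponent_top] at hx
  have h4 := ENNReal.toReal_mono hα.memLp_weakGrad.2.ne hx
  rwa [toReal_enorm] at h4

/-- Smooth approximations of the potential `G`. -/
structure IsPotentialApprox (G : E d → ℝ) (Gn : ℕ → E d → ℝ) : Prop where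
  contDiff : ∀ n, ContDiff ℝ ∞ (Gn n)
  tendsto : ∀ᵐ x, Tendsto (fun n => Gn n x) atTop (𝓝 (G x))
  tendsto_pd : ∀ᵐ x, ∀ i : Fin d,
    Tendsto (fun n => pd (EuclideanSpace.single i 1) (Gn n) x) atTop (𝓝 (weakGrad G x i))
  bound : ∀ R, ∃ M, ∀ n x, ‖x‖ ≤ R → |Gn n x| ≤ M
  bound_pd : ∀ R, ∃ M, ∀ n x, ‖x‖ ≤ R → ∀ i : Fin d, |pd (EuclideanSpace.single i 1) (Gn n) x| ≤ M

/-- Mollification: the derivatives of `cv (k n) G` are the mollified weak derivatives, so values and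
derivatives converge almost everywhere. Kernels of radius at most `1` see only the ball of radius `R
+ 1`, which makes the bounds uniform in `n`. -/
lemma AssumptionA1.exists_isPotentialApprox (hG : AssumptionA1 G) :
    ∃ Gn, IsPotentialApprox G Gn := by
  obtain ⟨k, hk, hk'⟩ := exists_mollifier_seq (E d)
  have hb : ∀ {f : E d → ℝ}, LocBdd f → ∀ R, ∃ M, ∀ n x, ‖x‖ ≤ R → |cv (k n) f x| ≤ M := by
    intro f hf R
    obtain ⟨M, hM⟩ := hf.2 (R + 1)
    refine ⟨M, fun n x hx => (hk n).abs_cv_le (R := R) (hM.mono fun q hq hR => hq ?_) hx⟩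
    have : (1 : ℝ) / (n + 1) ≤ 1 := by
      rw [div_le_one (by positivity)]; linarith [Nat.cast_nonneg (α := ℝ) n]
    linarith
  refine ⟨fun n => cv (k n) G, fun n => contDiff_cv (hk n).isTest hG.locBdd.locallyIntegrable,
    hk' _ hG.locBdd.locallyIntegrable, ?_, hb hG.locBdd, fun R => ?_⟩
  · filter_upwards [ae_all_iff.2 fun i => hk' _ (hG.locBdd_weakGrad i).locallyIntegrable] with x hx i
    exact (hx i).congr fun n => ((hG.isWeakGrad i).pd_cv (hk n).isTest x).symm
  · choose M hM using fun i => hb (hG.locBdd_weakGrad i) R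
    refine ⟨∑ i, |M i|, fun n x hx i => ?_⟩
    rw [(hG.isWeakGrad i).pd_cv (hk n).isTest x]
    exact (hM i n x hx).trans ((le_abs_self _).trans
      (Finset.single_le_sum (f := fun i => |M i|) (fun i _ => abs_nonneg _) (Finset.mem_univ i)))

end Potential

/-! ### Coordinate form of the differential operators -/

section Coordinates

variable {d : ℕ} {G α : E d → ℝ}

/-- The coordinate direction `xᵢ` of phase space. -/
def ex (i : Fin d) : Phase d := (EuclideanSpace.single i 1, 0)

/-- The coordinate direction `vᵢ` of phase space. -/
def ev (i : Fin d) : Phase d := (0, EuclideanSpace.single i 1)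

lemma eq_sum_single (a : E d) : a = ∑ i, a i • EuclideanSpace.single i (1 : ℝ) := by
  have := (EuclideanSpace.basisFun (Fin d) ℝ).sum_repr a
  simpa using this.symm

lemma clm_eq_sum (L : E d →L[ℝ] ℝ) (a : E d) :
    L a = ∑ i, a i * L (EuclideanSpace.single i 1) := by
  conv_lhs => rw [eq_sum_single a]
  simp [map_sum]

lemma inner_gradient (a : E d) (f : E d → ℝ) (x : E d) :
    ⟪a, ∇ f x⟫_ℝ = ∑ i, a i * pd (EuclideanSpace.single i 1) f x := by
  rw [real_inner_comm, gradient, InnerProductSpace.toDual_symm_apply, clm_eq_sum]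
  rfl

lemma pd_sliceX {φ : Phase d → ℝ} (h : Differentiable ℝ φ) (e : E d) (p : Phase d) :
    pd e (fun x => φ (x, p.2)) p.1 = pd (e, 0) φ p := by
  have h1 : HasFDerivAt (fun x => φ (x, p.2)) ((fderiv ℝ φ p).comp
      (ContinuousLinearMap.inl ℝ (E d) (E d))) p.1 :=
    HasFDerivAt.comp p.1 (f := fun x => (x, p.2)) (h p).hasFDerivAt (hasFDerivAt_prodMk_left p.1 p.2)
  simp [pd, h1.fderiv]

lemma pd_sliceV {φ : Phase d → ℝ} (h : Differentiable ℝ φ) (e : E d) (p : Phase d) :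
    pd e (fun v => φ (p.1, v)) p.2 = pd (0, e) φ p := by
  have h1 : HasFDerivAt (fun v => φ (p.1, v)) ((fderiv ℝ φ p).comp
      (ContinuousLinearMap.inr ℝ (E d) (E d))) p.2 :=
    HasFDerivAt.comp p.2 (f := fun v => (p.1, v)) (h p).hasFDerivAt (hasFDerivAt_prodMk_right p.1 p.2)
  simp [pd, h1.fderiv]

lemma inner_gradX {φ : Phase d → ℝ} (h : Differentiable ℝ φ) (a : E d) (p : Phase d) :
    ⟪a, gradX φ p⟫_ℝ = ∑ i, a i * pd (ex i) φ p := by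
  rw [gradX, inner_gradient]
  exact Finset.sum_congr rfl fun i _ => by rw [pd_sliceX h]; rfl

lemma inner_gradV {φ : Phase d → ℝ} (h : Differentiable ℝ φ) (a : E d) (p : Phase d) :
    ⟪a, gradV φ p⟫_ℝ = ∑ i, a i * pd (ev i) φ p := by
  rw [gradV, inner_gradient]
  exact Finset.sum_congr rfl fun i _ => by rw [pd_sliceV h]; rfl

lemma gradV_apply {φ : Phase d → ℝ} (h : Differentiable ℝ φ) (p : Phase d) (i : Fin d) :
    gradV φ p i = pd (ev i) φ p := by
  have h1 := inner_gradV h (EuclideanSpace.single i 1) p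
  simpa [EuclideanSpace.inner_single_left, Finset.sum_ite_eq] using h1

lemma lapV_eq {φ : Phase d → ℝ} (h : ContDiff ℝ ∞ φ) (p : Phase d) :
    lapV φ p = ∑ i, pd (ev i) (pd (ev i) φ) p := by
  have hd : Differentiable ℝ φ := h.differentiable (by simp)
  rw [lapV, InnerProductSpace.laplacian_eq_iteratedFDeriv_orthonormalBasis _
    (EuclideanSpace.basisFun (Fin d) ℝ)]
  refine Finset.sum_congr rfl fun i _ => ?_
  have hs : ContDiff ℝ ∞ fun v => φ (p.1, v) := h.comp (contDiff_const.prodMk contDiff_id)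
  rw [iteratedFDeriv_two_apply]
  simp only [Matrix.cons_val_zero, Matrix.cons_val_one, EuclideanSpace.basisFun_apply]
  have h1 : (fun v => fderiv ℝ (fun v => φ (p.1, v)) v (EuclideanSpace.single i 1)) =
      fun v => pd (ev i) φ (p.1, v) := by
    funext v
    exact pd_sliceV hd _ (p.1, v)
  have h2 : DifferentiableAt ℝ (fderiv ℝ fun v => φ (p.1, v)) p.2 :=
    ((hs.fderiv_right (m := ∞) (by simp)).differentiable (by simp)) _
  have h3 : fderiv ℝ (fun v => fderiv ℝ (fun v => φ (p.1, v)) v (EuclideanSpace.single i 1)) p.2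
      (EuclideanSpace.single i 1) = fderiv ℝ (fderiv ℝ fun v => φ (p.1, v)) p.2
      (EuclideanSpace.single i 1) (EuclideanSpace.single i 1) := by
    rw [fderiv_clm_apply h2 (differentiableAt_const _)]
    simp
  rw [← h3, h1]
  exact pd_sliceV ((contDiff_pd h).differentiable (by simp)) _ p

/-- The Hamiltonian vector field `v·∇_x - ∇_x G·∇_v`. -/
def transport (G : E d → ℝ) (φ : Phase d → ℝ) (p : Phase d) : ℝ :=
  ∑ i, p.2 i * pd (ex i) φ p - ∑ i, weakGrad G p.1 i * pd (ev i) φ p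

/-- The Ornstein-Uhlenbeck operator `Δ_v - v·∇_v`. -/
def ornstein (φ : Phase d → ℝ) (p : Phase d) : ℝ :=
  ∑ i, (pd (ev i) (pd (ev i) φ) p - p.2 i * pd (ev i) φ p)

/-- This split is the structure behind the dissipation: in `L²_μ`, on test functions, the first part
is antisymmetric, the second symmetric and nonpositive. -/
lemma Lstar_eq {φ : Phase d → ℝ} (h : ContDiff ℝ ∞ φ) (p : Phase d) :
    Lstar G φ p = -transport G φ p + ornstein φ p := by
  have hd : Differentiable ℝ φ := h.differentiable (by simp)
  simp only [Lstar, inner_gradX hd, inner_gradV hd, lapV_eq h, transport, ornstein,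
    Finset.sum_sub_distrib]
  ring

/-- In `L²_μ` each `∂_{v_i} - v_i` is minus the formal adjoint of `∂_{v_i}`, so this form exhibits
the control as a divergence in `v`. -/
lemma ctrl_eq {φ : Phase d → ℝ} (h : Differentiable ℝ φ) (p : Phase d) :
    ctrl α φ p = ∑ i, weakGrad α p.1 i * (pd (ev i) φ p - p.2 i * φ p) := by
  simp only [ctrl, inner_gradV h, PiLp.inner_apply, mul_sub, Finset.sum_sub_distrib,
    Finset.mul_sum]
  congr 1
  refine Finset.sum_congr rfl fun i _ => ?_
  simp only [RCLike.inner_apply, conj_trivial]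
  ring

end Coordinates

/-! ### The Gibbs measure and its relation to Lebesgue measure -/

section Gibbs

variable {d : ℕ} {G α : E d → ℝ}

lemma LocBdd.comp_fst {c : E d → ℝ} (h : LocBdd c) : LocBdd fun p : Phase d => c p.1 := by
  refine ⟨h.1.comp_quasiMeasurePreserving Measure.quasiMeasurePreserving_fst, fun R => ?_⟩
  obtain ⟨M, hM⟩ := h.2 R
  refine ⟨M, ?_⟩
  filter_upwards [Measure.quasiMeasurePreserving_fst.ae hM] with p hp hR
  exact hp ((norm_fst_le p).trans hR)

lemma ae_comp_fst {P : E d → Prop} (h : ∀ᵐ x, P x) : ∀ᵐ p : Phase d, P p.1 :=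
  Measure.quasiMeasurePreserving_fst.ae h

/-- The weight `exp(-H)`. -/
def wt (G : E d → ℝ) (p : Phase d) : ℝ := Real.exp (-hamiltonian G p)

lemma wt_pos (p : Phase d) : 0 < wt G p := Real.exp_pos _

lemma locBdd_hamiltonian (hG : AssumptionA1 G) : LocBdd (hamiltonian G) :=
  (LocBdd.of_continuous (c := fun p : Phase d => ‖p.2‖ ^ 2 / 2) (by fun_prop)).add
    hG.locBdd.comp_fst

lemma locBdd_wt (hG : AssumptionA1 G) : LocBdd (wt G) :=
  (locBdd_hamiltonian hG).comp_continuous (f := fun s => Real.exp (-s)) (by fun_prop)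

lemma integrable_gaussian (d : ℕ) : Integrable fun v : E d => Real.exp (-(‖v‖ ^ 2 / 2)) := by
  have h := (GaussianFourier.integrable_cexp_neg_mul_sq_norm_add (V := E d) (b := 1 / 2)
    (by norm_num) 0 0).norm
  refine h.congr (ae_of_all _ fun v => ?_)
  simp only [Complex.norm_exp]
  have e : (-(1 / 2 : ℂ) * (‖v‖ : ℂ) ^ 2 + 0 * (⟪(0 : E d), v⟫_ℝ : ℂ)) =
      ((-(‖v‖ ^ 2 / 2) : ℝ) : ℂ) := by
    push_cast
    ring
  rw [e, Complex.ofReal_re]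

lemma integrable_wt (hG : AssumptionA1 G) : Integrable (wt G) := by
  have h := hG.integrable.mul_prod (integrable_gaussian d)
  refine h.congr (ae_of_all _ fun p => ?_)
  simp only [wt, hamiltonian, ← Real.exp_add]
  congr 1
  ring

lemma partitionFn_pos (hG : AssumptionA1 G) : 0 < partitionFn G := by
  change 0 < ∫ p, wt G p
  rw [integral_pos_iff_support_of_nonneg (fun p => (wt_pos p).le) (integrable_wt hG)]
  have : Function.support (wt G) = univ := by
    ext p; simpa using (wt_pos p).ne'
  rw [this]
  exact Measure.measure_univ_pos.2 (NeZero.ne _)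

lemma aemeasurable_density (hG : AssumptionA1 G) : AEMeasurable (fun p : Phase d =>
    ENNReal.ofReal ((partitionFn G)⁻¹ * Real.exp (-hamiltonian G p))) volume :=
  ((locBdd_wt hG).1.aemeasurable.const_mul _).ennreal_ofReal

lemma isFiniteMeasure_gibbs (hG : AssumptionA1 G) : IsFiniteMeasure (gibbs G) :=
  isFiniteMeasure_withDensity_ofReal ((integrable_wt hG).const_mul _).2

lemma gibbs_absolutelyContinuous : gibbs G ≪ volume := withDensity_absolutelyContinuous _ _

lemma volume_absolutelyContinuous_gibbs (hG : AssumptionA1 G) : (volume : Measure (Phase d)) ≪ gibbs G := by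
  refine withDensity_absolutelyContinuous' (aemeasurable_density hG) (ae_of_all _ fun p => ?_)
  simp only [ne_eq, ENNReal.ofReal_eq_zero, not_le]
  exact mul_pos (inv_pos.2 (partitionFn_pos hG)) (Real.exp_pos _)

lemma integral_gibbs (hG : AssumptionA1 G) (f : Phase d → ℝ) :
    ∫ p, f p ∂gibbs G = (partitionFn G)⁻¹ * ∫ p, f p * wt G p := by
  rw [gibbs, integral_withDensity_eq_integral_toReal_smul₀ (aemeasurable_density hG)
    (ae_of_all _ fun p => ENNReal.ofReal_lt_top), ← integral_const_mul]
  refine integral_congr_ae (ae_of_all _ fun p => ?_)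
  simp only [smul_eq_mul]
  rw [ENNReal.toReal_ofReal (mul_pos (inv_pos.2 (partitionFn_pos hG)) (Real.exp_pos _)).le]
  simp only [wt]
  ring

lemma integrable_gibbs_iff (hG : AssumptionA1 G) {f : Phase d → ℝ} :
    Integrable f (gibbs G) ↔ Integrable fun p => f p * wt G p := by
  rw [gibbs, integrable_withDensity_iff_integrable_smul₀' (aemeasurable_density hG)
    (ae_of_all _ fun p => ENNReal.ofReal_lt_top)]
  have h : (fun p => (ENNReal.ofReal ((partitionFn G)⁻¹ * Real.exp (-hamiltonian G p))).toReal • f p)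
      = fun p => (partitionFn G)⁻¹ * (f p * wt G p) := by
    funext p
    rw [ENNReal.toReal_ofReal (mul_pos (inv_pos.2 (partitionFn_pos hG)) (Real.exp_pos _)).le]
    simp only [wt, smul_eq_mul]
    ring
  rw [h]
  exact integrable_const_mul_iff (IsUnit.mk0 _ (inv_ne_zero (partitionFn_pos hG).ne')) _

lemma inner_Y (hG : AssumptionA1 G) {a b : Y G} {f g : Phase d → ℝ} (ha : a =ᵐ[gibbs G] f)
    (hb : b =ᵐ[gibbs G] g) : ⟪a, b⟫_ℝ = (partitionFn G)⁻¹ * ∫ p, f p * g p * wt G p := by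
  rw [L2.inner_def, ← integral_gibbs hG]
  refine integral_congr_ae ?_
  filter_upwards [ha, hb] with p h1 h2
  simp [h1, h2, mul_comm]

lemma LocBdd.memLp_gibbs (hG : AssumptionA1 G) {c ψ : Phase d → ℝ} (h : LocBdd c)
    (hψ : Continuous ψ) (hψ' : HasCompactSupport ψ) (q : ℝ≥0∞) :
    MemLp (fun p => c p * ψ p) q (gibbs G) := by
  have := isFiniteMeasure_gibbs hG
  obtain ⟨M, hM⟩ := h.exists_ae_bound_mul hψ hψ'
  exact MemLp.of_bound ((h.1.mul hψ.aestronglyMeasurable).mono_ac gibbs_absolutelyContinuous) M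
    (gibbs_absolutelyContinuous.ae_le hM)

lemma IsTest.memLp_gibbs (hG : AssumptionA1 G) {φ : Phase d → ℝ} (h : IsTest φ) :
    MemLp φ 2 (gibbs G) := by
  simpa using (LocBdd.const 1).memLp_gibbs hG h.continuous h.2 2

lemma exists_isTest_norm_sub_lt (hG : AssumptionA1 G) (c : Y G) {ε : ℝ} (hε : 0 < ε) :
    ∃ (φ : Phase d → ℝ) (f : Y G), IsTest φ ∧ f =ᵐ[gibbs G] φ ∧ ‖f - c‖ < ε := by
  have := isFiniteMeasure_gibbs hG
  have h := Lp.dense_hasCompactSupport_contDiff (E := Phase d) (F := ℝ) (μ := gibbs G) (p := 2)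
    (by simp)
  obtain ⟨f, ⟨φ, h1, h2, h3⟩, hf⟩ := h.exists_dist_lt c hε
  exact ⟨φ, f, ⟨h3, h2⟩, h1, by rwa [← dist_eq_norm, dist_comm]⟩

end Gibbs

/-! ### Integration by parts against the Gibbs weight -/

section IntegrationByParts

variable {d : ℕ} {G α : E d → ℝ}

lemma pd_exp {X : Type*} [NormedAddCommGroup X] [NormedSpace ℝ X] {f : X → ℝ}
    (hf : Differentiable ℝ f) (e p : X) :
    pd e (fun q => Real.exp (f q)) p = pd e f p * Real.exp (f p) := by
  have h := (hf p).hasFDerivAt.exp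
  simp [pd, h.fderiv, mul_comm]

lemma pd_add {X : Type*} [NormedAddCommGroup X] [NormedSpace ℝ X] {f g : X → ℝ}
    (hf : Differentiable ℝ f) (hg : Differentiable ℝ g) (e p : X) :
    pd e (fun q => f q + g q) p = pd e f p + pd e g p := by
  simp [pd, fderiv_fun_add (hf p) (hg p)]

lemma pd_const_mul {X : Type*} [NormedAddCommGroup X] [NormedSpace ℝ X] {f : X → ℝ}
    (hf : Differentiable ℝ f) (a : ℝ) (e p : X) :
    pd e (fun q => a * f q) p = a * pd e f p := by
  simp [pd, fderiv_const_mul (hf p)]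

lemma pd_comp_fst {f : E d → ℝ} (hf : Differentiable ℝ f) (e p : Phase d) :
    pd e (fun q : Phase d => f q.1) p = pd e.1 f p.1 := by
  have h : HasFDerivAt (fun q : Phase d => f q.1) ((fderiv ℝ f p.1).comp
    (ContinuousLinearMap.fst ℝ (E d) (E d))) p := (hf p.1).hasFDerivAt.comp p hasFDerivAt_fst
  simp [pd, h.fderiv]

lemma pd_comp_snd {f : E d → ℝ} (hf : Differentiable ℝ f) (e p : Phase d) :
    pd e (fun q : Phase d => f q.2) p = pd e.2 f p.2 := by
  have h : HasFDerivAt (fun q : Phase d => f q.2) ((fderiv ℝ f p.2).comp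
    (ContinuousLinearMap.snd ℝ (E d) (E d))) p := (hf p.2).hasFDerivAt.comp p hasFDerivAt_snd
  simp [pd, h.fderiv]

lemma pd_zero {X : Type*} [NormedAddCommGroup X] [NormedSpace ℝ X] (f : X → ℝ) (p : X) :
    pd 0 f p = 0 := by simp [pd]

lemma differentiable_norm_sq : Differentiable ℝ fun v : E d => ‖v‖ ^ 2 :=
  (contDiff_norm_sq ℝ (n := 1)).differentiable (by simp)

lemma pd_norm_sq (i : Fin d) (v : E d) :
    pd (EuclideanSpace.single i 1) (fun v : E d => ‖v‖ ^ 2) v = 2 * v i := by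
  have h : HasFDerivAt (fun v : E d => ‖v‖ ^ 2) _ v := (hasFDerivAt_id v).norm_sq
  rw [pd, h.fderiv]
  simp [EuclideanSpace.inner_single_right]

lemma pd_ev_coeff_norm_sq (a : ℝ) (i : Fin d) (p : Phase d) :
    pd (ev i) (fun q : Phase d => a * ‖q.2‖ ^ 2) p = 2 * a * p.2 i := by
  have h1 : Differentiable ℝ fun q : Phase d => ‖q.2‖ ^ 2 :=
    differentiable_norm_sq.comp differentiable_snd
  rw [pd_const_mul h1, pd_comp_snd (f := fun v => ‖v‖ ^ 2) differentiable_norm_sq]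
  simp only [ev, pd_norm_sq]
  ring

lemma pd_ex_coeff_norm_sq (a : ℝ) (i : Fin d) (p : Phase d) :
    pd (ex i) (fun q : Phase d => a * ‖q.2‖ ^ 2) p = 0 := by
  have h1 : Differentiable ℝ fun q : Phase d => ‖q.2‖ ^ 2 :=
    differentiable_norm_sq.comp differentiable_snd
  rw [pd_const_mul h1, pd_comp_snd (f := fun v => ‖v‖ ^ 2) differentiable_norm_sq]
  simp only [ex, pd_zero, mul_zero]

lemma contDiff_coeff_norm_sq (a : ℝ) : ContDiff ℝ ∞ fun q : Phase d => a * ‖q.2‖ ^ 2 :=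
  contDiff_const.mul ((contDiff_norm_sq ℝ).comp contDiff_snd)

instance isAddHaarMeasure_phase : (volume : Measure (Phase d)).IsAddHaarMeasure :=
  inferInstanceAs ((volume : Measure (E d)).prod volume).IsAddHaarMeasure

lemma integral_coeffX_mul_pd_ev {c : E d → ℝ} (hc : LocBdd c) {φ : Phase d → ℝ} (hφ : IsTest φ)
    (i : Fin d) : ∫ p : Phase d, c p.1 * pd (ev i) φ p = 0 :=
  integral_mul_pd_eq_zero hc.comp_fst (fun p t => by simp [ev]) hφ

lemma integral_coord_mul_pd_ex {φ : Phase d → ℝ} (hφ : IsTest φ) (i : Fin d) :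
    ∫ p : Phase d, p.2 i * pd (ex i) φ p = 0 :=
  integral_mul_pd_eq_zero (LocBdd.of_continuous (by fun_prop)) (fun p t => by simp [ex]) hφ

lemma wt_eq (p : Phase d) :
    wt G p = Real.exp (-G p.1) * Real.exp (-(1 / 2) * ‖p.2‖ ^ 2) := by
  rw [wt, hamiltonian, ← Real.exp_add]
  congr 1
  ring

/-- The coefficient `c(x) exp(-G(x))` is constant in `v`, so only the Gaussian factor is
differentiated; this produces the term `-v_i φ`. -/
lemma integral_coeffX_mul_ornstein (hG : AssumptionA1 G) {c : E d → ℝ} (hc : LocBdd c)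
    {φ : Phase d → ℝ} (hφ : IsTest φ) (i : Fin d) :
    ∫ p : Phase d, c p.1 * (pd (ev i) φ p - p.2 i * φ p) * wt G p = 0 := by
  have hs : ContDiff ℝ ∞ fun p : Phase d => Real.exp (-(1 / 2) * ‖p.2‖ ^ 2) :=
    (contDiff_coeff_norm_sq _).exp
  have h := integral_coeffX_mul_pd_ev
    (hc.mul (hG.locBdd.comp_continuous (f := fun s => Real.exp (-s)) (by fun_prop)))
    (hφ.mul_right hs) i
  rw [← h]
  refine integral_congr_ae (ae_of_all _ fun p => ?_)
  simp only
  rw [pd_mul hφ.differentiable (hs.differentiable (by simp)),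
    pd_exp ((contDiff_coeff_norm_sq _).differentiable (by simp)), pd_ev_coeff_norm_sq, wt_eq]
  ring

lemma eq_zero_of_norm_gt {φ : Phase d → ℝ} {R : ℝ} (hR : tsupport φ ⊆ Metric.closedBall 0 R)
    {p : Phase d} (hp : ¬ ‖p‖ ≤ R) (e : Phase d) : φ p = 0 ∧ pd e φ p = 0 := by
  have h : p ∉ tsupport φ := fun h => hp (mem_closedBall_zero_iff.1 (hR h))
  refine ⟨image_eq_zero_of_notMem_tsupport h, ?_⟩
  have h2 : fderiv ℝ φ p = 0 := by
    by_contra hne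
    exact h (support_fderiv_subset ℝ hne)
  rw [pd, h2]
  rfl

/-- Liouville's theorem: the flow of the Hamiltonian vector field preserves the Gibbs measure. -/
lemma integral_transport_coord (hG : AssumptionA1 G) {φ : Phase d → ℝ} (hφ : IsTest φ)
    (i : Fin d) :
    ∫ p : Phase d, (p.2 i * pd (ex i) φ p - weakGrad G p.1 i * pd (ev i) φ p) * wt G p = 0 := by
  obtain ⟨Gn, hGn⟩ := hG.exists_isPotentialApprox
  obtain ⟨R, hR⟩ := hφ.2.isCompact.isBounded.subset_closedBall (0 : Phase d)
  obtain ⟨M, hM⟩ := hGn.bound R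
  obtain ⟨M', hM'⟩ := hGn.bound_pd R
  -- The weight with `G` replaced by its mollification: it is smooth, so it may be included in the
  -- test function. The contributions of its `x` and `v` derivatives cancel exactly.
  set γ : ℕ → Phase d → ℝ := fun n p => Real.exp (-(1 / 2) * ‖p.2‖ ^ 2 + -1 * Gn n p.1) with hγ
  have hGd : ∀ n, Differentiable ℝ (Gn n) := fun n => (hGn.contDiff n).differentiable (by simp)
  have hGs : ∀ n, ContDiff ℝ ∞ fun p : Phase d => Gn n p.1 := fun n =>
    (hGn.contDiff n).comp contDiff_fst
  have hGs' : ∀ n, ContDiff ℝ ∞ fun p : Phase d => -1 * Gn n p.1 := fun n =>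
    contDiff_const.mul (hGs n)
  have hγs : ∀ n, ContDiff ℝ ∞ (γ n) := fun n => ((contDiff_coeff_norm_sq _).add (hGs' n)).exp
  have hpd : ∀ n e p, pd e (γ n) p = (pd e (fun q : Phase d => -(1 / 2) * ‖q.2‖ ^ 2) p -
      pd e.1 (Gn n) p.1) * γ n p := fun n e p => by
    have h1 : Differentiable ℝ fun q : Phase d => -(1 / 2) * ‖q.2‖ ^ 2 :=
      (contDiff_coeff_norm_sq _).differentiable (by simp)
    have h2 : Differentiable ℝ fun q : Phase d => -1 * Gn n q.1 :=
      (hGs' n).differentiable (by simp)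
    have h12 : Differentiable ℝ fun q : Phase d => -(1 / 2) * ‖q.2‖ ^ 2 + -1 * Gn n q.1 :=
      h1.add h2
    simp only [hγ]
    rw [pd_exp h12, pd_add h1 h2,
      pd_const_mul ((hGs n).differentiable (by simp)), pd_comp_fst (hGd n)]
    ring
  have hn : ∀ n, ∫ p : Phase d, (p.2 i * pd (ex i) φ p -
      pd (EuclideanSpace.single i 1) (Gn n) p.1 * pd (ev i) φ p) * γ n p = 0 := fun n => by
    have hc : Continuous (pd (EuclideanSpace.single i 1) (Gn n)) := continuous_pd (hGn.contDiff n)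
    have ht := hφ.mul_right (hγs n)
    have h1 := integral_coord_mul_pd_ex ht i
    have h2 := integral_coeffX_mul_pd_ev (LocBdd.of_continuous hc) ht i
    have h3 := integral_sub
      ((LocBdd.of_continuous (c := fun p : Phase d => p.2 i) (by fun_prop)).integrable_mul
        (ht.pd (e := ex i)).continuous (ht.pd (e := ex i)).2)
      ((LocBdd.of_continuous hc).comp_fst.integrable_mul
        (ht.pd (e := ev i)).continuous (ht.pd (e := ev i)).2)
    rw [h1, h2, sub_zero] at h3
    rw [← h3]
    refine integral_congr_ae (ae_of_all _ fun p => ?_)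
    simp only
    rw [pd_mul hφ.differentiable ((hγs n).differentiable (by simp)),
      pd_mul hφ.differentiable ((hγs n).differentiable (by simp)), hpd, hpd,
      pd_ev_coeff_norm_sq, pd_ex_coeff_norm_sq]
    simp only [ex, ev, pd_zero]
    ring
  -- Everything is supported in the ball of radius `R`, where the mollified potentials and their
  -- derivatives are bounded uniformly in `n`.
  have hlim := tendsto_integral_of_dominated_convergence (μ := (volume : Measure (Phase d)))
    (F := fun n (p : Phase d) => (p.2 i * pd (ex i) φ p -
      pd (EuclideanSpace.single i 1) (Gn n) p.1 * pd (ev i) φ p) * γ n p)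
    (f := fun p => (p.2 i * pd (ex i) φ p - weakGrad G p.1 i * pd (ev i) φ p) * wt G p)
    (fun p => (|p.2 i| * |pd (ex i) φ p| + M' * |pd (ev i) φ p|) * Real.exp M) ?_ ?_ ?_ ?_
  · simp only [hn] at hlim
    exact (tendsto_nhds_unique hlim tendsto_const_nhds)
  · intro n
    have h1 : Continuous (pd (EuclideanSpace.single i 1) (Gn n)) := continuous_pd (hGn.contDiff n)
    have h2 := (hφ.pd (e := ex i)).continuous
    have h3 := (hφ.pd (e := ev i)).continuous
    have h4 := (hγs n).continuous
    exact Continuous.aestronglyMeasurable (by fun_prop)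
  · have h2 := (hφ.pd (e := ex i)).continuous
    have h3 := (hφ.pd (e := ev i)).continuous
    refine Continuous.integrable_of_hasCompactSupport (by fun_prop) ?_
    refine HasCompactSupport.of_support_subset_isCompact
      (isCompact_closedBall (0 : Phase d) R) fun p hp => ?_
    by_contra h
    refine hp ?_
    simp only [mem_closedBall_zero_iff] at h
    simp [(eq_zero_of_norm_gt hR h _).2]
  · refine fun n => ae_of_all _ fun p => ?_
    by_cases hp : ‖p‖ ≤ R
    · have hp1 : ‖p.1‖ ≤ R := (norm_fst_le p).trans hp
      rw [norm_mul]
      refine mul_le_mul ?_ ?_ (norm_nonneg _) ?_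
      · refine (norm_sub_le _ _).trans ?_
        rw [norm_mul, norm_mul]
        exact add_le_add le_rfl (mul_le_mul_of_nonneg_right (hM' n _ hp1 i) (norm_nonneg _))
      · rw [Real.norm_of_nonneg (Real.exp_pos _).le]
        refine Real.exp_le_exp.2 ?_
        have := (abs_le.1 (hM n _ hp1)).1
        nlinarith [sq_nonneg ‖p.2‖]
      · have : 0 ≤ M' := (abs_nonneg _).trans (hM' n _ hp1 i)
        positivity
    · simp [(eq_zero_of_norm_gt hR hp _).2]
  · filter_upwards [ae_comp_fst hGn.tendsto, ae_comp_fst hGn.tendsto_pd] with p h1 h2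
    have h3 : Tendsto (fun n => γ n p) atTop (𝓝 (wt G p)) := by
      have : wt G p = Real.exp (-(1 / 2) * ‖p.2‖ ^ 2 + -1 * G p.1) := by
        rw [wt, hamiltonian]; congr 1; ring
      rw [this]
      exact (Real.continuous_exp.tendsto _).comp (tendsto_const_nhds.add (h1.const_mul _))
    exact (tendsto_const_nhds.sub ((h2 i).mul_const _)).mul h3

end IntegrationByParts

/-! ### Bilinear identities for `𝓛*` and for the control -/

section Bilinear

variable {d : ℕ} {G α : E d → ℝ} {φ ψ : Phase d → ℝ}

lemma LocBdd.coord (i : Fin d) : LocBdd fun p : Phase d => p.2 i :=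
  LocBdd.of_continuous (by fun_prop)

lemma locBdd_pd (hφ : ContDiff ℝ ∞ φ) (e : Phase d) : LocBdd (pd e φ) :=
  LocBdd.of_continuous (continuous_pd hφ)

lemma locBdd_transport (hG : AssumptionA1 G) (hφ : ContDiff ℝ ∞ φ) : LocBdd (transport G φ) :=
  (LocBdd.sum fun i _ => (LocBdd.coord i).mul (locBdd_pd hφ _)).sub
    (LocBdd.sum fun i _ => (hG.locBdd_weakGrad i).comp_fst.mul (locBdd_pd hφ _))

lemma locBdd_ornstein (hφ : ContDiff ℝ ∞ φ) : LocBdd (ornstein φ) :=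
  LocBdd.sum fun i _ => (locBdd_pd (contDiff_pd hφ) _).sub ((LocBdd.coord i).mul (locBdd_pd hφ _))

lemma LocBdd.integrable_mul_wt (hG : AssumptionA1 G) {c : Phase d → ℝ} (hc : LocBdd c)
    (hψ : IsTest ψ) : Integrable fun p => c p * ψ p * wt G p := by
  refine ((hc.mul (locBdd_wt hG)).integrable_mul hψ.continuous hψ.2).congr (ae_of_all _ fun p => ?_)
  simp only
  ring

/-- `transport` is a derivation, so this is Liouville's theorem for the product `φ ψ`. -/
lemma integral_transport_mul (hG : AssumptionA1 G) (hφ : IsTest φ) (hψ : IsTest ψ) :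
    ∫ p, transport G φ p * ψ p * wt G p = -∫ p, φ p * transport G ψ p * wt G p := by
  have h1 := fun i => integral_transport_coord hG (hφ.mul_right hψ.1) i
  have hi1 := (locBdd_transport hG hφ.1).integrable_mul_wt hG hψ
  have hi2 : Integrable fun p => φ p * transport G ψ p * wt G p :=
    ((locBdd_transport hG hψ.1).integrable_mul_wt hG hφ).congr
      (ae_of_all _ fun p => by simp only; ring)
  rw [← add_eq_zero_iff_eq_neg, ← integral_add hi1 hi2]
  have h2 : ∫ p : Phase d, ∑ i, (p.2 i * pd (ex i) (fun p => φ p * ψ p) p -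
      weakGrad G p.1 i * pd (ev i) (fun p => φ p * ψ p) p) * wt G p = 0 := by
    rw [integral_finsetSum]
    · exact Finset.sum_eq_zero fun i _ => h1 i
    · intro i _
      have ht := hφ.mul_right hψ.1
      have h3 := ((LocBdd.coord i).integrable_mul_wt hG (ht.pd (e := ex i))).sub
        ((hG.locBdd_weakGrad i).comp_fst.integrable_mul_wt hG (ht.pd (e := ev i)))
      exact h3.congr (ae_of_all _ fun p => by simp only [Pi.sub_apply]; ring)
  rw [← h2]
  refine integral_congr_ae (ae_of_all _ fun p => ?_)
  simp only [pd_mul hφ.differentiable hψ.differentiable, transport]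
  simp only [← Finset.sum_sub_distrib, Finset.sum_mul, Finset.mul_sum, ← Finset.sum_add_distrib]
  exact Finset.sum_congr rfl fun i _ => by ring

lemma integral_coeffX_sum_ornstein (hG : AssumptionA1 G) {c : Fin d → E d → ℝ}
    (hc : ∀ i, LocBdd (c i)) {χ : Fin d → Phase d → ℝ} (hχ : ∀ i, IsTest (χ i)) :
    ∫ p : Phase d, ∑ i, c i p.1 * (pd (ev i) (χ i) p - p.2 i * χ i p) * wt G p = 0 := by
  rw [integral_finsetSum]
  · exact Finset.sum_eq_zero fun i _ => integral_coeffX_mul_ornstein hG (hc i) (hχ i) i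
  · intro i _
    have h3 := ((hc i).comp_fst.integrable_mul_wt hG ((hχ i).pd (e := ev i))).sub
      (((hc i).comp_fst.mul (LocBdd.coord i)).integrable_mul_wt hG (hχ i))
    exact h3.congr (ae_of_all _ fun p => by simp only [Pi.sub_apply]; ring)

/-- The divergence identity in `v`, applied to the vector field `ψ ∇_v φ`. -/
lemma integral_ornstein_mul (hG : AssumptionA1 G) (hφ : IsTest φ) (hψ : IsTest ψ) :
    ∫ p, ornstein φ p * ψ p * wt G p = -∫ p, (∑ i, pd (ev i) φ p * pd (ev i) ψ p) * wt G p := by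
  have hi1 := (locBdd_ornstein hφ.1).integrable_mul_wt hG hψ
  have hi2 : Integrable fun p => (∑ i, pd (ev i) φ p * pd (ev i) ψ p) * wt G p := by
    simp only [Finset.sum_mul]
    exact integrable_finsetSum _ fun i _ => (locBdd_pd hφ.1 _).integrable_mul_wt hG hψ.pd
  rw [← add_eq_zero_iff_eq_neg, ← integral_add hi1 hi2]
  rw [← integral_coeffX_sum_ornstein hG (c := fun _ _ => 1) (fun _ => LocBdd.const 1)
    (χ := fun i p => pd (ev i) φ p * ψ p) fun i => hφ.pd.mul_right hψ.1]
  refine integral_congr_ae (ae_of_all _ fun p => ?_)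
  simp only [pd_mul hφ.pd.differentiable hψ.differentiable, ornstein]
  simp only [Finset.sum_mul, ← Finset.sum_add_distrib]
  exact Finset.sum_congr rfl fun i _ => by ring

/-- The divergence identity for the field `φ ψ ∇α`. All derivatives move to `ψ`, and those are
controlled by the dissipation. -/
lemma integral_ctrl_mul (hG : AssumptionA1 G) (hα : AssumptionA2 α) (hφ : IsTest φ)
    (hψ : IsTest ψ) : ∫ p, ctrl α φ p * ψ p * wt G p =
      -∫ p, φ p * (∑ i, weakGrad α p.1 i * pd (ev i) ψ p) * wt G p := by
  have hα' := fun i => (hα.locBdd_weakGrad i).comp_fst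
  have hc : LocBdd fun p => ∑ i, weakGrad α p.1 i * (pd (ev i) φ p - p.2 i * φ p) :=
    LocBdd.sum fun i _ => (hα' i).mul ((locBdd_pd hφ.1 _).sub
      ((LocBdd.coord i).mul (LocBdd.of_continuous hφ.continuous)))
  have hi1 := hc.integrable_mul_wt hG hψ
  have hi2 : Integrable fun p => φ p * (∑ i, weakGrad α p.1 i * pd (ev i) ψ p) * wt G p := by
    have h : LocBdd fun p : Phase d => ∑ i, weakGrad α p.1 i * pd (ev i) ψ p :=
      LocBdd.sum fun i _ => (hα' i).mul (locBdd_pd hψ.1 _)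
    exact (h.integrable_mul_wt hG hφ).congr (ae_of_all _ fun p => by simp only; ring)
  simp only [ctrl_eq hφ.differentiable]
  rw [← add_eq_zero_iff_eq_neg, ← integral_add hi1 hi2]
  rw [← integral_coeffX_sum_ornstein hG (c := fun i x => weakGrad α x i) hα.locBdd_weakGrad
    (χ := fun i p => φ p * ψ p) fun i => hφ.mul_right hψ.1]
  refine integral_congr_ae (ae_of_all _ fun p => ?_)
  simp only [pd_mul hφ.differentiable hψ.differentiable]
  simp only [Finset.sum_mul, Finset.mul_sum, ← Finset.sum_add_distrib]
  exact Finset.sum_congr rfl fun i _ => by ring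

/-- The formal adjoint `v·∇_x - ∇_x G·∇_v - v·∇_v + Δ_v` of `𝓛*` in `L²_μ`. -/
def LstarAdj (G : E d → ℝ) (φ : Phase d → ℝ) (p : Phase d) : ℝ := transport G φ p + ornstein φ p

lemma integrable_test_mul_wt (hG : AssumptionA1 G) {c : Phase d → ℝ} (hc : LocBdd c)
    (hφ : IsTest φ) : Integrable fun p => φ p * c p * wt G p :=
  (hc.integrable_mul_wt hG hφ).congr (ae_of_all _ fun p => by simp only; ring)

lemma integral_Lstar_eq (hG : AssumptionA1 G) (hφ : IsTest φ) (hψ : IsTest ψ) :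
    ∫ p, Lstar G φ p * ψ p * wt G p =
      (∫ p, ornstein φ p * ψ p * wt G p) - ∫ p, transport G φ p * ψ p * wt G p := by
  rw [← integral_sub ((locBdd_ornstein hφ.1).integrable_mul_wt hG hψ)
    ((locBdd_transport hG hφ.1).integrable_mul_wt hG hψ)]
  refine integral_congr_ae (ae_of_all _ fun p => ?_)
  simp only [Lstar_eq hφ.1]
  ring

lemma integral_Lstar_mul (hG : AssumptionA1 G) (hφ : IsTest φ) (hψ : IsTest ψ) :
    ∫ p, Lstar G φ p * ψ p * wt G p = ∫ p, φ p * LstarAdj G ψ p * wt G p := by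
  have h2 : ∫ p, φ p * LstarAdj G ψ p * wt G p =
      (∫ p, φ p * transport G ψ p * wt G p) + ∫ p, ornstein ψ p * φ p * wt G p := by
    rw [← integral_add (integrable_test_mul_wt hG (locBdd_transport hG hψ.1) hφ)
      ((locBdd_ornstein hψ.1).integrable_mul_wt hG hφ)]
    refine integral_congr_ae (ae_of_all _ fun p => ?_)
    simp only [LstarAdj]
    ring
  have h3 := integral_ornstein_mul hG hψ hφ
  simp only [mul_comm (pd _ ψ _)] at h3
  rw [integral_Lstar_eq hG hφ hψ, h2, integral_transport_mul hG hφ hψ,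
    integral_ornstein_mul hG hφ hψ, h3]
  ring

/-- The antisymmetric transport part drops out of the quadratic form, so the velocity gradient is
the whole dissipation. -/
lemma integral_Lstar_self (hG : AssumptionA1 G) (hφ : IsTest φ) :
    ∫ p, Lstar G φ p * φ p * wt G p = -∫ p, (∑ i, pd (ev i) φ p ^ 2) * wt G p := by
  have h2 := integral_transport_mul hG hφ hφ
  have h3 : ∫ p, φ p * transport G φ p * wt G p = ∫ p, transport G φ p * φ p * wt G p := by
    simp only [mul_comm (φ _)]
  rw [h3] at h2
  rw [integral_Lstar_eq hG hφ hφ, integral_ornstein_mul hG hφ hφ]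
  simp only [← pow_two]
  linarith

/-! ### The velocity reflection -/

/-- The reflection `(x, v) ↦ (x, -v)`. -/
def reflV : Phase d ≃L[ℝ] Phase d :=
  (ContinuousLinearEquiv.refl ℝ (E d)).prodCongr (ContinuousLinearEquiv.neg ℝ)

lemma reflV_apply (p : Phase d) : reflV p = (p.1, -p.2) := rfl

lemma reflV_reflV (p : Phase d) : reflV (reflV p) = p := by simp [reflV_apply]

lemma IsTest.comp_reflV (hφ : IsTest φ) : IsTest fun p => φ (reflV p) :=
  ⟨hφ.1.comp reflV.contDiff, hφ.2.comp_homeomorph reflV.toHomeomorph⟩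

lemma pd_comp_reflV (hφ : Differentiable ℝ φ) (e p : Phase d) :
    pd e (fun q => φ (reflV q)) p = pd (reflV e) φ (reflV p) := by
  have hr : HasFDerivAt (fun q : Phase d => reflV q) (reflV (d := d)).toContinuousLinearMap p :=
    reflV.hasFDerivAt
  have h : HasFDerivAt (fun q => φ (reflV q)) ((fderiv ℝ φ (reflV p)).comp
    (reflV (d := d)).toContinuousLinearMap) p :=
    HasFDerivAt.comp (f := fun q => reflV q) p (hφ (reflV p)).hasFDerivAt hr
  simp [pd, h.fderiv]

lemma pd_ev_comp_reflV (hφ : Differentiable ℝ φ) (i : Fin d) (p : Phase d) :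
    pd (ev i) (fun q => φ (reflV q)) p = -pd (ev i) φ (reflV p) := by
  rw [pd_comp_reflV hφ]
  have : reflV (ev i : Phase d) = -ev i := by simp [reflV_apply, ev]
  rw [this, pd, map_neg]
  rfl

lemma pd_ex_comp_reflV (hφ : Differentiable ℝ φ) (i : Fin d) (p : Phase d) :
    pd (ex i) (fun q => φ (reflV q)) p = pd (ex i) φ (reflV p) := by
  rw [pd_comp_reflV hφ]
  have : reflV (ex i : Phase d) = ex i := by simp [reflV_apply, ex]
  rw [this]

/-- Reversing velocities changes the sign of the transport part and leaves the Ornstein-Uhlenbeck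
part unchanged. This transfers all results on `A` to its adjoint. -/
lemma LstarAdj_comp_reflV (hφ : ContDiff ℝ ∞ φ) (p : Phase d) :
    LstarAdj G (fun q => φ (reflV q)) p = Lstar G φ (reflV p) := by
  have hd : Differentiable ℝ φ := hφ.differentiable (by simp)
  have hd' : ∀ i, Differentiable ℝ (pd (ev i) φ) := fun i =>
    (contDiff_pd hφ).differentiable (by simp)
  rw [Lstar_eq hφ, LstarAdj, transport, ornstein, transport, ornstein]
  have h1 : ∀ i, pd (ev i) (fun q => φ (reflV q)) = fun q => (-1) * pd (ev i) φ (reflV q) :=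
    fun i => by
      funext q
      rw [pd_ev_comp_reflV hd]
      ring
  have h2 : ∀ i, pd (ev i) (fun q => (-1) * pd (ev i) φ (reflV q)) p =
      pd (ev i) (pd (ev i) φ) (reflV p) := fun i => by
    have hc : Differentiable ℝ fun q => pd (ev i) φ (reflV q) := (hd' i).comp reflV.differentiable
    rw [pd_const_mul hc, pd_ev_comp_reflV (hd' i)]
    ring
  simp only [h1, h2, pd_ex_comp_reflV hd]
  simp only [reflV_apply, PiLp.neg_apply, ← Finset.sum_sub_distrib, ← Finset.sum_neg_distrib,
    ← Finset.sum_add_distrib]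
  exact Finset.sum_congr rfl fun i _ => by ring

/-- The control is odd in `v`: both `∂_{v_i}` and multiplication by `v_i` change sign. -/
lemma ctrl_comp_reflV (hφ : Differentiable ℝ φ) (p : Phase d) :
    ctrl α (fun q => φ (reflV q)) p = -ctrl α φ (reflV p) := by
  have hc : Differentiable ℝ fun q => φ (reflV q) := hφ.comp reflV.differentiable
  rw [ctrl_eq hφ, ctrl_eq hc]
  simp only [pd_ev_comp_reflV hφ]
  simp only [reflV_apply, PiLp.neg_apply, ← Finset.sum_neg_distrib]
  exact Finset.sum_congr rfl fun i _ => by ring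

end Bilinear

/-! ### From a core to its closure -/

section Core

variable {H K : Type*} [NormedAddCommGroup H] [InnerProductSpace ℝ H] [CompleteSpace H]
  [NormedAddCommGroup K] [InnerProductSpace ℝ K] [CompleteSpace K]
  {A : H →ₗ.[ℝ] H} {Γ : Submodule ℝ (H × H × K)} {𝒢 𝒩 : Submodule ℝ (H × H)} {C : ℝ}

/-- Applied to differences, the identity for `‖g‖²` bounds `‖g_m - g_n‖²` by the product of the
distances of the `y` and of the `z`. Convergence in the graph of `A` therefore forces convergence of
the gradients. -/
lemma IsDissipationGraph.of_core (hA : A.graph = 𝒢.topologicalClosure)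
    (h1 : ∀ y z g, (y, z, g) ∈ Γ → ‖g‖ ^ 2 = -⟪z, y⟫_ℝ)
    (h2 : ∀ y z, (y, z) ∈ 𝒢 → ∃ g, (y, z, g) ∈ Γ) (h3 : ∀ y z g, (y, z, g) ∈ Γ → (y, z) ∈ 𝒢) :
    IsDissipationGraph A Γ.topologicalClosure := by
  refine ⟨fun y z g h => ?_, fun y z h => ?_, fun y z g h => ?_⟩
  · have hc : IsClosed {q : H × H × K | ‖q.2.2‖ ^ 2 = -⟪q.2.1, q.1⟫_ℝ} :=
      isClosed_eq (by fun_prop) (by fun_prop)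
    exact closure_minimal (fun q hq => h1 _ _ _ hq) hc h
  · rw [hA] at h
    obtain ⟨q, hq, hlim⟩ := mem_closure_iff_seq_limit.1
      (h : (y, z) ∈ closure (𝒢 : Set (H × H)))
    choose g hg using fun n => h2 (q n).1 (q n).2 (hq n)
    have hgc : CauchySeq g := by
      have hq' : CauchySeq q := hlim.cauchySeq
      rw [Metric.cauchySeq_iff] at hq' ⊢
      intro ε hε
      obtain ⟨N, hN⟩ := hq' ε hε
      refine ⟨N, fun m hm n hn => ?_⟩
      have h4 := h1 _ _ _ (Γ.sub_mem (hg m) (hg n))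
      have h5 := hN m hm n hn
      rw [Prod.dist_eq, max_lt_iff, dist_eq_norm, dist_eq_norm] at h5
      have h6 := abs_real_inner_le_norm ((q m).2 - (q n).2) ((q m).1 - (q n).1)
      have h7 : ‖g m - g n‖ ^ 2 ≤ ‖(q m).2 - (q n).2‖ * ‖(q m).1 - (q n).1‖ := by
        have h8 : ‖g m - g n‖ ^ 2 = -⟪(q m).2 - (q n).2, (q m).1 - (q n).1⟫_ℝ := h4
        rw [h8]
        exact (neg_le_abs _).trans h6
      rw [dist_eq_norm]
      refine lt_of_pow_lt_pow_left₀ 2 hε.le (h7.trans_lt ?_)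
      nlinarith [h5.1, h5.2, norm_nonneg ((q m).2 - (q n).2), norm_nonneg ((q m).1 - (q n).1)]
    obtain ⟨l, hl⟩ := cauchySeq_tendsto_of_complete hgc
    refine ⟨l, mem_closure_of_tendsto (((continuous_fst.tendsto _).comp hlim).prodMk_nhds
      (((continuous_snd.tendsto _).comp hlim).prodMk_nhds hl)) (Eventually.of_forall fun n => hg n)⟩
  · rw [hA]
    have hc : IsClosed {q : H × H × K | (q.1, q.2.1) ∈ 𝒢.topologicalClosure} :=
      𝒢.isClosed_topologicalClosure.preimage (by fun_prop)
    exact (closure_minimal (s := (Γ : Set (H × H × K)))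
      (fun q hq => 𝒢.le_topologicalClosure (h3 q.1 q.2.1 q.2.2 hq)) hc) h

lemma IsDominated.closure (h : IsDominated Γ 𝒩 C) : IsDominated Γ.topologicalClosure 𝒩 C := by
  intro f n hfn y z g hy
  have hc : IsClosed {q : H × H × K | |⟪n, q.1⟫_ℝ| ≤ C * ‖f‖ * ‖q.2.2‖} :=
    isClosed_le (by fun_prop) (by fun_prop)
  exact closure_minimal (fun q hq => h f n hfn _ _ _ hq) hc hy

/-- The symmetry `⟪z, R a⟫ = ⟪y, R b⟫` extends from a core to the closure. -/
lemma inner_topologicalClosure {R : H →L[ℝ] H}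
    (h : ∀ y z a b, (y, z) ∈ 𝒢 → (a, b) ∈ 𝒢 → ⟪z, R a⟫_ℝ = ⟪y, R b⟫_ℝ) {y z a b : H}
    (hy : (y, z) ∈ 𝒢.topologicalClosure) (ha : (a, b) ∈ 𝒢.topologicalClosure) :
    ⟪z, R a⟫_ℝ = ⟪y, R b⟫_ℝ := by
  have key : ∀ q ∈ _root_.closure (𝒢 : Set (H × H)), ∀ q' ∈ 𝒢,
      ⟪q.2, R q'.1⟫_ℝ = ⟪q.1, R q'.2⟫_ℝ := by
    intro q hq q' hq'
    have hc : IsClosed {q : H × H | ⟪q.2, R q'.1⟫_ℝ = ⟪q.1, R q'.2⟫_ℝ} :=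
      isClosed_eq (by fun_prop) (by fun_prop)
    exact closure_minimal (fun r hr => h _ _ _ _ hr hq') hc hq
  have hc : IsClosed {q' : H × H | ⟪z, R q'.1⟫_ℝ = ⟪y, R q'.2⟫_ℝ} :=
    isClosed_eq (by fun_prop) (by fun_prop)
  exact closure_minimal (fun r hr => key _ hy r hr) hc ha

end Core

/-! ### The operator `A` and its dissipation graph -/

section Operator

variable {d : ℕ} {G α : E d → ℝ} {φ ψ : Phase d → ℝ}

lemma LocBdd.memLp_of_eq_zero (hG : AssumptionA1 G) {c : Phase d → ℝ} (h : LocBdd c) {R : ℝ}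
    (hR : ∀ p, ¬ ‖p‖ ≤ R → c p = 0) : MemLp c 2 (gibbs G) := by
  have := isFiniteMeasure_gibbs hG
  obtain ⟨M, hM0, hM⟩ := h.exists_nonneg R
  refine MemLp.of_bound (h.1.mono_ac gibbs_absolutelyContinuous) M
    (gibbs_absolutelyContinuous.ae_le (hM.mono fun p hp => ?_))
  by_cases hpR : ‖p‖ ≤ R
  · exact hp hpR
  · rw [hR p hpR, norm_zero]
    exact hM0

lemma memLp_Lstar (hG : AssumptionA1 G) (hφ : IsTest φ) : MemLp (Lstar G φ) 2 (gibbs G) := by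
  obtain ⟨R, hR⟩ := hφ.2.isCompact.isBounded.subset_closedBall (0 : Phase d)
  have h1 : LocBdd (Lstar G φ) := by
    have := (locBdd_transport hG hφ.1).neg.add (locBdd_ornstein hφ.1)
    exact (funext (Lstar_eq hφ.1) : Lstar G φ = _) ▸ this
  refine h1.memLp_of_eq_zero hG (R := R) fun p hp => ?_
  have hR' : ∀ i, tsupport (pd (ev i) φ) ⊆ Metric.closedBall 0 R := fun i =>
    (closure_minimal (fun q hq => by
      by_contra h
      exact hq (eq_zero_of_norm_gt hR (fun h' => h (mem_closedBall_zero_iff.2 h')) (ev i)).2)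
      Metric.isClosed_closedBall)
  rw [Lstar_eq hφ.1, transport, ornstein]
  simp [(eq_zero_of_norm_gt hR hp _).2, (eq_zero_of_norm_gt (hR' _) hp _).2]

lemma memLp_ctrl (hG : AssumptionA1 G) (hα : AssumptionA2 α) (hφ : IsTest φ) :
    MemLp (ctrl α φ) 2 (gibbs G) := by
  obtain ⟨R, hR⟩ := hφ.2.isCompact.isBounded.subset_closedBall (0 : Phase d)
  have h1 : LocBdd (ctrl α φ) := by
    have : LocBdd fun p : Phase d => ∑ i, weakGrad α p.1 i * (pd (ev i) φ p - p.2 i * φ p) :=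
      LocBdd.sum fun i _ => (hα.locBdd_weakGrad i).comp_fst.mul ((locBdd_pd hφ.1 _).sub
        ((LocBdd.coord i).mul (LocBdd.of_continuous hφ.continuous)))
    exact (funext (ctrl_eq hφ.differentiable) : ctrl α φ = _) ▸ this
  refine h1.memLp_of_eq_zero hG (R := R) fun p hp => ?_
  rw [ctrl_eq hφ.differentiable]
  simp [(eq_zero_of_norm_gt hR hp _).2, (eq_zero_of_norm_gt hR hp 0).1]

lemma gradV_eq_sum (hφ : Differentiable ℝ φ) :
    gradV φ = fun p => ∑ i, pd (ev i) φ p • EuclideanSpace.single i (1 : ℝ) := by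
  funext p
  rw [eq_sum_single (gradV φ p)]
  simp only [gradV_apply hφ]

lemma memLp_gradV (hG : AssumptionA1 G) (hφ : IsTest φ) : MemLp (gradV φ) 2 (gibbs G) := by
  have := isFiniteMeasure_gibbs hG
  rw [gradV_eq_sum hφ.differentiable]
  refine memLp_finsetSum _ fun i _ => ?_
  exact (ContinuousLinearMap.toSpanSingleton ℝ (EuclideanSpace.single i (1 : ℝ))).comp_memLp'
    (hφ.pd.memLp_gibbs hG)

/-- The graph of `φ ↦ (𝓛* φ, ∇_v φ)` on test functions. -/
def coreGraph (G : E d → ℝ) : Submodule ℝ (Y G × Y G × Yd G) where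
  carrier := {q | ∃ φ : Phase d → ℝ, IsTest φ ∧ q.1 =ᵐ[gibbs G] φ ∧
    q.2.1 =ᵐ[gibbs G] Lstar G φ ∧ q.2.2 =ᵐ[gibbs G] gradV φ}
  zero_mem' := by
    obtain ⟨φ, h1, h2, h3⟩ := (graphLstar G).zero_mem
    have h0 : Lstar G (0 : Phase d → ℝ) = 0 := by
      simpa using Lstar_smul G 0 (IsTest.zero (X := Phase d))
    refine ⟨0, IsTest.zero, Lp.coeFn_zero _ _ _, ?_, ?_⟩
    · rw [h0]; exact Lp.coeFn_zero _ _ _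
    · have : gradV (0 : Phase d → ℝ) = 0 := by
        rw [gradV_eq_sum IsTest.zero.differentiable]
        funext p
        simp [pd]
      rw [this]; exact Lp.coeFn_zero _ _ _
  add_mem' := by
    rintro ⟨a, a', a''⟩ ⟨b, b', b''⟩ ⟨φ, hφ, h1, h2, h3⟩ ⟨ψ, hψ, h1', h2', h3'⟩
    refine ⟨φ + ψ, hφ.add hψ, (Lp.coeFn_add a b).trans (h1.add h1'), ?_, ?_⟩
    · rw [Lstar_add G hφ hψ]
      exact (Lp.coeFn_add a' b').trans (h2.add h2')
    · have : gradV (φ + ψ) = gradV φ + gradV ψ := by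
        funext p
        exact gradient_add' ((hφ.sliceV p.1).differentiable (by simp) p.2)
          ((hψ.sliceV p.1).differentiable (by simp) p.2)
      rw [this]
      exact (Lp.coeFn_add a'' b'').trans (h3.add h3')
  smul_mem' := by
    rintro c ⟨a, a', a''⟩ ⟨φ, hφ, h1, h2, h3⟩
    refine ⟨c • φ, hφ.smul c, (Lp.coeFn_smul c a).trans (h1.const_smul c), ?_, ?_⟩
    · rw [Lstar_smul G c hφ]
      exact (Lp.coeFn_smul c a').trans (h2.const_smul c)
    · have : gradV (c • φ) = c • gradV φ := by
        funext p
        exact gradient_smul' c ((hφ.sliceV p.1).differentiable (by simp) p.2)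
      rw [this]
      exact (Lp.coeFn_smul c a'').trans (h3.const_smul c)

lemma exists_mem_coreGraph (hG : AssumptionA1 G) (hφ : IsTest φ) : ∃ y z g,
    (y, z, g) ∈ coreGraph G ∧ y =ᵐ[gibbs G] φ ∧ z =ᵐ[gibbs G] Lstar G φ ∧ g =ᵐ[gibbs G] gradV φ :=
  have h : _ ∧ _ ∧ _ := ⟨(hφ.memLp_gibbs hG).coeFn_toLp, (memLp_Lstar hG hφ).coeFn_toLp,
    (memLp_gradV hG hφ).coeFn_toLp⟩
  ⟨_, _, _, ⟨φ, hφ, h⟩, h⟩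

lemma mem_graphLstar_of_mem_coreGraph {y z : Y G} {g : Yd G} (h : (y, z, g) ∈ coreGraph G) :
    (y, z) ∈ graphLstar G := by
  obtain ⟨φ, h1, h2, h3, -⟩ := h
  exact ⟨φ, h1, h2, h3⟩

lemma exists_mem_coreGraph_of_mem_graphLstar (hG : AssumptionA1 G) {y z : Y G}
    (h : (y, z) ∈ graphLstar G) : ∃ g, (y, z, g) ∈ coreGraph G := by
  obtain ⟨φ, h1, h2, h3⟩ := h
  exact ⟨(memLp_gradV hG h1).toLp, φ, h1, h2, h3, (memLp_gradV hG h1).coeFn_toLp⟩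

lemma norm_sq_of_mem_coreGraph (hG : AssumptionA1 G) {y z : Y G} {g : Yd G}
    (h : (y, z, g) ∈ coreGraph G) : ‖g‖ ^ 2 = -⟪z, y⟫_ℝ := by
  obtain ⟨φ, hφ, h1, h2, h3⟩ := h
  rw [inner_Y hG h2 h1, integral_Lstar_self hG hφ, ← real_inner_self_eq_norm_sq, L2.inner_def,
    mul_neg, neg_neg, ← integral_gibbs hG]
  refine integral_congr_ae ?_
  filter_upwards [h3] with p hp
  rw [hp, real_inner_self_eq_norm_sq, EuclideanSpace.norm_sq_eq]
  exact Finset.sum_congr rfl fun i _ => by rw [gradV_apply hφ.differentiable]; simp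

/-! ### The reflection on `Y` -/

lemma wt_reflV (p : Phase d) : wt G (reflV p) = wt G p := by
  simp [wt, hamiltonian, reflV_apply]

lemma measurePreserving_reflV (G : E d → ℝ) :
    MeasurePreserving (reflV (d := d)) (gibbs G) (gibbs G) := by
  have h1 : MeasurePreserving (reflV (d := d)) volume volume :=
    (MeasurePreserving.id volume).prod (Measure.measurePreserving_neg (volume : Measure (E d)))
  have hemb : MeasurableEmbedding (reflV (d := d)) := reflV.toHomeomorph.measurableEmbedding
  refine ⟨h1.measurable, Measure.ext fun s hs => ?_⟩
  rw [Measure.map_apply h1.measurable hs, gibbs, withDensity_apply _ hs,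
    withDensity_apply _ (h1.measurable hs),
    ← h1.setLIntegral_comp_preimage_emb hemb
      (fun p => ENNReal.ofReal ((partitionFn G)⁻¹ * Real.exp (-hamiltonian G p))) s]
  refine lintegral_congr fun p => ?_
  have := wt_reflV (G := G) p
  simp only [wt] at this
  rw [this]

/-- The isometry `f ↦ f(x, -v)` of `Y`. -/
def reflY (G : E d → ℝ) : Y G →ₗᵢ[ℝ] Y G :=
  Lp.compMeasurePreservingₗᵢ ℝ reflV (measurePreserving_reflV G)

lemma reflY_apply (f : Y G) :
    reflY G f = Lp.compMeasurePreserving reflV (measurePreserving_reflV G) f := rfl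

lemma reflY_ae_eq {f : Y G} {φ : Phase d → ℝ} (h : f =ᵐ[gibbs G] φ) :
    reflY G f =ᵐ[gibbs G] fun p => φ (reflV p) := by
  rw [reflY_apply]
  have h1 := Lp.coeFn_compMeasurePreserving f (measurePreserving_reflV G)
  have h2 := (measurePreserving_reflV G).quasiMeasurePreserving.ae h
  filter_upwards [h1, h2] with p h1 h2
  rw [h1, Function.comp_apply, h2]

lemma reflY_reflY (f : Y G) : reflY G (reflY G f) = f := by
  refine Lp.ext ?_
  filter_upwards [reflY_ae_eq (reflY_ae_eq (EventuallyEq.refl _ f))] with p hp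
  rw [hp, reflV_reflV]

lemma inner_reflY (a b : Y G) : ⟪reflY G a, b⟫_ℝ = ⟪a, reflY G b⟫_ℝ := by
  rw [← (reflY G).inner_map_map a, reflY_reflY]

/-- The formal adjoint of `𝓛*` is its conjugate by the reflection, so pairing with a reflected test
function is symmetric. -/
lemma inner_graphLstar (hG : AssumptionA1 G) {y z a b : Y G} (h : (y, z) ∈ graphLstar G)
    (h' : (a, b) ∈ graphLstar G) : ⟪z, reflY G a⟫_ℝ = ⟪y, reflY G b⟫_ℝ := by
  obtain ⟨φ, hφ, h1, h2⟩ := h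
  obtain ⟨ψ, hψ, h3, h4⟩ := h'
  rw [inner_Y hG h2 (reflY_ae_eq h3), inner_Y hG h1 (reflY_ae_eq h4),
    integral_Lstar_mul hG hφ hψ.comp_reflV]
  simp only [LstarAdj_comp_reflV hψ.1]

lemma inner_closure_graphLstar (hG : AssumptionA1 G) {y z a b : Y G}
    (h : (y, z) ∈ (graphLstar G).topologicalClosure)
    (h' : (a, b) ∈ (graphLstar G).topologicalClosure) : ⟪z, reflY G a⟫_ℝ = ⟪y, reflY G b⟫_ℝ :=
  inner_topologicalClosure (R := (reflY G).toContinuousLinearMap)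
    (fun _ _ _ _ h h' => inner_graphLstar hG h h') h h'

lemma dense_test (hG : AssumptionA1 G) : Dense {a : Y G | ∃ b, (a, b) ∈ graphLstar G} := by
  refine Metric.dense_iff.2 fun c ε hε => ?_
  obtain ⟨φ, f, hφ, hf, hlt⟩ := exists_isTest_norm_sub_lt hG c hε
  exact ⟨f, by rwa [mem_ball_iff_norm], (memLp_Lstar hG hφ).toLp, φ, hφ, hf,
    (memLp_Lstar hG hφ).coeFn_toLp⟩

lemma eq_zero_of_inner_test (hG : AssumptionA1 G) {z : Y G}
    (h : ∀ a b, (a, b) ∈ graphLstar G → ⟪z, a⟫_ℝ = 0) : z = 0 :=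
  (dense_test hG).eq_zero_of_inner_left ℝ fun a ⟨b, hb⟩ => h a b hb

/-- This is closability, without which the graph of `opA` would not be known. For `(0, z)` in the
closed graph, the reflection symmetry makes `z` orthogonal to every reflected test function, and
these are dense. The same argument shows that the graph on test functions is single valued. -/
lemma graph_opA (hG : AssumptionA1 G) : (opA G).graph = (graphLstar G).topologicalClosure := by
  have h0 : ∀ q ∈ (graphLstar G).topologicalClosure, q.1 = 0 → q.2 = 0 := by
    rintro ⟨y, z⟩ hq rfl
    have h1 : reflY G z = 0 := eq_zero_of_inner_test hG fun a b hab => by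
      rw [inner_reflY, inner_closure_graphLstar hG hq (Submodule.le_topologicalClosure _ hab),
        inner_zero_left]
    change z = 0
    rw [← reflY_reflY z, h1, map_zero]
  have h1 : (graphLstar G).toLinearPMap.graph = graphLstar G :=
    Submodule.toLinearPMap_graph_eq _ fun q hq => h0 q (Submodule.le_topologicalClosure _ hq)
  have h2 : (graphLstar G).toLinearPMap.IsClosable :=
    ⟨(graphLstar G).topologicalClosure.toLinearPMap, by
      rw [h1, Submodule.toLinearPMap_graph_eq _ h0]⟩
  rw [opA, ← h2.graph_closure_eq_closure_graph, h1]

/-- The graph of `y ↦ (A y, ∇_v y)`. -/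
def dissGraph (G : E d → ℝ) : Submodule ℝ (Y G × Y G × Yd G) := (coreGraph G).topologicalClosure

lemma isDissipationGraph (hG : AssumptionA1 G) : IsDissipationGraph (opA G) (dissGraph G) :=
  IsDissipationGraph.of_core (graph_opA hG) (fun _ _ _ h => norm_sq_of_mem_coreGraph hG h)
    (fun _ _ h => exists_mem_coreGraph_of_mem_graphLstar hG h)
    fun _ _ _ h => mem_graphLstar_of_mem_coreGraph h

lemma dense_domain_opA (hG : AssumptionA1 G) : Dense ((opA G).domain : Set (Y G)) := by
  refine (dense_test hG).mono ?_
  rintro a ⟨b, hb⟩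
  refine LinearPMap.mem_domain_iff.2 ⟨b, ?_⟩
  rw [graph_opA hG]
  exact Submodule.le_topologicalClosure _ hb

end Operator

/-! ### The control operator and velocity gradients in `Y` -/

section Control

variable {d : ℕ} {G α : E d → ℝ} {φ ψ : Phase d → ℝ}

/-- The graph of `N` on test functions. -/
def ctrlGraph (G α : E d → ℝ) : Submodule ℝ (Y G × Y G) where
  carrier := {q | ∃ φ : Phase d → ℝ, IsTest φ ∧ q.1 =ᵐ[gibbs G] φ ∧ q.2 =ᵐ[gibbs G] ctrl α φ}
  zero_mem' := by
    refine ⟨0, IsTest.zero, Lp.coeFn_zero _ _ _, ?_⟩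
    have h0 : ctrl α (0 : Phase d → ℝ) = 0 := by
      funext p
      rw [ctrl_eq IsTest.zero.differentiable]
      simp [pd]
    rw [h0]; exact Lp.coeFn_zero _ _ _
  add_mem' := by
    rintro ⟨a, a'⟩ ⟨b, b'⟩ ⟨φ, hφ, h1, h2⟩ ⟨ψ, hψ, h1', h2'⟩
    refine ⟨φ + ψ, hφ.add hψ, (Lp.coeFn_add a b).trans (h1.add h1'), ?_⟩
    have h0 : ctrl α (φ + ψ) = ctrl α φ + ctrl α ψ := by
      funext p
      change _ = ctrl α φ p + ctrl α ψ p
      rw [ctrl_eq (hφ.add hψ).differentiable, ctrl_eq hφ.differentiable,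
        ctrl_eq hψ.differentiable, ← Finset.sum_add_distrib]
      refine Finset.sum_congr rfl fun i _ => ?_
      rw [show pd (ev i) (φ + ψ) p = pd (ev i) φ p + pd (ev i) ψ p from
        pd_add hφ.differentiable hψ.differentiable _ _, Pi.add_apply]
      ring
    rw [h0]
    exact (Lp.coeFn_add a' b').trans (h2.add h2')
  smul_mem' := by
    rintro c ⟨a, a'⟩ ⟨φ, hφ, h1, h2⟩
    refine ⟨c • φ, hφ.smul c, (Lp.coeFn_smul c a).trans (h1.const_smul c), ?_⟩
    have h0 : ctrl α (c • φ) = c • ctrl α φ := by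
      funext p
      change _ = c * ctrl α φ p
      rw [ctrl_eq (hφ.smul c).differentiable, ctrl_eq hφ.differentiable, Finset.mul_sum]
      refine Finset.sum_congr rfl fun i _ => ?_
      rw [show pd (ev i) (c • φ) p = c * pd (ev i) φ p from
        pd_const_mul hφ.differentiable _ _ _, Pi.smul_apply, smul_eq_mul]
      ring
    rw [h0]
    exact (Lp.coeFn_smul c a').trans (h2.const_smul c)

lemma exists_mem_ctrlGraph (hG : AssumptionA1 G) (hα : AssumptionA2 α) (c : Y G) {ε : ℝ}
    (hε : 0 < ε) : ∃ f n, (f, n) ∈ ctrlGraph G α ∧ ‖f - c‖ < ε := by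
  obtain ⟨φ, f, hφ, hf, h⟩ := exists_isTest_norm_sub_lt hG c hε
  exact ⟨f, (memLp_ctrl hG hα hφ).toLp, ⟨φ, hφ, hf, (memLp_ctrl hG hα hφ).coeFn_toLp⟩, h⟩

/-- With the derivatives moved to the second factor, the pairing is that of `f` with `∇α·∇_v ψ`, and
`∇α` is bounded; the constant is a bound for `‖∇α‖_∞`. -/
lemma isDominated_ctrlGraph (hG : AssumptionA1 G) (hα : AssumptionA2 α) :
    ∃ C : ℝ≥0, IsDominated (dissGraph G) (ctrlGraph G α) C := by
  obtain ⟨C, hC⟩ := hα.exists_bound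
  refine ⟨C, IsDominated.closure ?_⟩
  rintro f n ⟨φ, hφ, hf, hn⟩ y z g ⟨ψ, hψ, hy, -, hg⟩
  have hZ := partitionFn_pos hG
  have hα' : AEStronglyMeasurable (fun p : Phase d => weakGrad α p.1) (gibbs G) :=
    (hα.memLp_weakGrad.1.comp_quasiMeasurePreserving
      Measure.quasiMeasurePreserving_fst).mono_ac gibbs_absolutelyContinuous
  have hb : ∀ᵐ p ∂gibbs G, ‖⟪weakGrad α p.1, gradV ψ p⟫_ℝ‖ ≤ C * ‖gradV ψ p‖ := by
    refine gibbs_absolutelyContinuous.ae_le ((ae_comp_fst hC).mono fun p hp => ?_)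
    exact (norm_inner_le_norm _ _).trans (by gcongr)
  have hm : MemLp (fun p : Phase d => ⟪weakGrad α p.1, gradV ψ p⟫_ℝ) 2 (gibbs G) :=
    (memLp_gradV hG hψ).of_le_mul (hα'.inner (memLp_gradV hG hψ).1) hb
  have h1 : ⟪n, y⟫_ℝ = -⟪f, hm.toLp⟫_ℝ := by
    rw [inner_Y hG hn hy, inner_Y hG hf hm.coeFn_toLp, integral_ctrl_mul hG hα hφ hψ, mul_neg]
    simp only [inner_gradV hψ.differentiable]
  have h2 : ‖hm.toLp‖ ≤ C * ‖g‖ := by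
    refine Lp.norm_le_mul_norm_of_ae_le_mul ?_
    filter_upwards [hb, hm.coeFn_toLp, hg] with p h1 h2 h3
    rw [h2, h3]
    exact h1
  rw [h1, abs_neg]
  refine (abs_real_inner_le_norm _ _).trans ?_
  calc ‖f‖ * ‖hm.toLp‖ ≤ ‖f‖ * (C * ‖g‖) := by gcongr
    _ = C * ‖f‖ * ‖g‖ := by ring

/-! ### Weak gradients in `v` -/

/-- The density of `μ` is undone by the factor `Z exp(H)`, which is bounded on the support of `ψ`.
Lebesgue pairings with test functions are thus continuous on `Y`. -/
lemma exists_dual_test (hG : AssumptionA1 G) (hψ : IsTest ψ) :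
    ∃ h : Y G, ∀ f : Y G, ∫ p, f p * ψ p = ⟪f, h⟫_ℝ := by
  have hw : LocBdd fun p => partitionFn G * Real.exp (hamiltonian G p) :=
    (LocBdd.const _).mul ((locBdd_hamiltonian hG).comp_continuous Real.continuous_exp)
  have hm := hw.memLp_gibbs hG hψ.continuous hψ.2 2
  refine ⟨hm.toLp, fun f => ?_⟩
  rw [inner_Y hG (EventuallyEq.refl _ f) hm.coeFn_toLp, ← integral_const_mul]
  refine integral_congr_ae (ae_of_all _ fun p => ?_)
  have hZ := (partitionFn_pos hG).ne'
  have h1 : Real.exp (hamiltonian G p) * wt G p = 1 := by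
    rw [wt, ← Real.exp_add, add_neg_cancel, Real.exp_zero]
  calc f p * ψ p = (partitionFn G)⁻¹ * partitionFn G * (f p * ψ p *
        (Real.exp (hamiltonian G p) * wt G p)) := by rw [h1, inv_mul_cancel₀ hZ]; ring
    _ = _ := by ring

/-- `exp H` is locally bounded, so the weight can be removed on compact sets. -/
lemma locallyIntegrable_Y (hG : AssumptionA1 G) (f : Y G) : LocallyIntegrable f volume := by
  have hm : AEStronglyMeasurable f volume :=
    (Lp.aestronglyMeasurable f).mono_ac (volume_absolutelyContinuous_gibbs hG)
  refine locallyIntegrable_iff.2 fun K hK => ?_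
  have := isFiniteMeasure_gibbs hG
  have h1 : Integrable (fun p => f p * wt G p) volume :=
    (integrable_gibbs_iff hG).1 ((Lp.memLp f).integrable one_le_two)
  have hw : LocBdd fun p => Real.exp (hamiltonian G p) :=
    (locBdd_hamiltonian hG).comp_continuous Real.continuous_exp
  obtain ⟨R, hR⟩ := hK.isBounded.subset_closedBall (0 : Phase d)
  obtain ⟨M, hM⟩ := hw.2 R
  refine (h1.norm.const_mul M).integrableOn (s := K) |>.mono' hm.restrict ?_
  filter_upwards [ae_restrict_of_ae hM, ae_restrict_mem hK.measurableSet] with p hp hpK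
  have h2 : Real.exp (hamiltonian G p) * wt G p = 1 := by
    rw [wt, ← Real.exp_add, add_neg_cancel, Real.exp_zero]
  have h3 := hp (mem_closedBall_zero_iff.1 (hR hpK))
  rw [abs_of_pos (Real.exp_pos _)] at h3
  rw [norm_mul, Real.norm_of_nonneg (wt_pos p).le]
  calc ‖f p‖ = Real.exp (hamiltonian G p) * (‖f p‖ * wt G p) := by
        rw [mul_left_comm, h2, mul_one]
    _ ≤ M * (‖f p‖ * wt G p) :=
        mul_le_mul_of_nonneg_right h3 (mul_nonneg (norm_nonneg _) (wt_pos p).le)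

/-- The coordinate `gᵢ` of an element `g` of `Y^d`. -/
def projY (G : E d → ℝ) (i : Fin d) : Yd G →L[ℝ] Y G :=
  (EuclideanSpace.proj i : E d →L[ℝ] ℝ).compLpL 2 (gibbs G)

lemma projY_ae_eq (i : Fin d) (g : Yd G) : projY G i g =ᵐ[gibbs G] fun p => g p i :=
  ContinuousLinearMap.coeFn_compLp _ g

/-- Local integrability is automatic for elements of `Y`. What remains are pairings with test
functions, which are stable under limits. -/
lemma isWeakGradV_iff (hG : AssumptionA1 G) {y : Y G} {g : Yd G} :
    IsWeakGradV y g ↔ ∀ i, ∀ φ : Phase d → ℝ, IsTest φ →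
      ∫ p, y p * pd (ev i) φ p = -∫ p, projY G i g p * φ p := by
  have he : ∀ i, projY G i g =ᵐ[volume] fun p => g p i := fun i =>
    (volume_absolutelyContinuous_gibbs hG).ae_le (projY_ae_eq i g)
  have hint : ∀ i (φ : Phase d → ℝ), ∫ p, projY G i g p * φ p = ∫ p, g p i * φ p := fun i φ =>
    integral_congr_ae ((he i).mono fun p hp => by simp only [hp])
  refine ⟨fun h i φ hφ => ?_, fun h i => ⟨locallyIntegrable_Y hG y, ?_, fun φ hφ => ?_⟩⟩
  · rw [hint]
    exact (h i).eq φ hφ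
  · exact (locallyIntegrable_Y hG (projY G i g)).congr (he i)
  · rw [← hint]
    exact h i φ hφ

lemma isWeakGradV_of_tendsto (hG : AssumptionA1 G) {y : Y G} {g : Yd G} {u : ℕ → Y G}
    {D : ℕ → Yd G} (h : ∀ n, IsWeakGradV (u n) (D n)) (hu : Tendsto u atTop (𝓝 y))
    (hD : Tendsto D atTop (𝓝 g)) : IsWeakGradV y g := by
  rw [isWeakGradV_iff hG]
  intro i φ hφ
  obtain ⟨a, ha⟩ := exists_dual_test hG (hφ.pd (e := ev i))
  obtain ⟨b, hb⟩ := exists_dual_test hG hφ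
  have h1 : ∀ n, ⟪u n, a⟫_ℝ = -⟪projY G i (D n), b⟫_ℝ := fun n => by
    rw [← ha, ← hb]
    exact (isWeakGradV_iff hG).1 (h n) i φ hφ
  rw [ha, hb]
  have h2 : Tendsto (fun n => ⟪u n, a⟫_ℝ) atTop (𝓝 ⟪y, a⟫_ℝ) := hu.inner tendsto_const_nhds
  have h3 : Tendsto (fun n => -⟪projY G i (D n), b⟫_ℝ) atTop (𝓝 (-⟪projY G i g, b⟫_ℝ)) :=
    ((((projY G i).continuous.tendsto _).comp hD).inner tendsto_const_nhds).neg
  exact tendsto_nhds_unique h2 (h3.congr fun n => (h1 n).symm)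

lemma isWeakGradV_of_mem_coreGraph (hG : AssumptionA1 G) {y z : Y G} {g : Yd G}
    (h : (y, z, g) ∈ coreGraph G) : IsWeakGradV y g := by
  obtain ⟨φ, hφ, h1, -, h3⟩ := h
  rw [isWeakGradV_iff hG]
  intro i ψ hψ
  have hv := volume_absolutelyContinuous_gibbs hG
  have e1 : ∫ p, y p * pd (ev i) ψ p = ∫ p, φ p * pd (ev i) ψ p :=
    integral_congr_ae (Eventually.mono (hv.ae_le h1) fun p hp => by
      simp only at hp
      simp only [hp])
  have e2 : ∫ p, projY G i g p * ψ p = ∫ p, pd (ev i) φ p * ψ p := by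
    refine integral_congr_ae ?_
    filter_upwards [hv.ae_le (projY_ae_eq i g), hv.ae_le h3] with p h4 h5
    rw [h4, h5, gradV_apply hφ.differentiable]
  rw [e1, e2, ← add_eq_zero_iff_eq_neg, ← integral_add
    ((locBdd_pd hψ.1 _).integrable_mul hφ.continuous hφ.2 |>.congr
      (ae_of_all _ fun p => by simp only; ring))
    ((locBdd_pd hφ.1 _).integrable_mul hψ.continuous hψ.2),
    ← integral_coeffX_mul_pd_ev (LocBdd.const 1) (hφ.mul_right hψ.1) i]
  refine integral_congr_ae (ae_of_all _ fun p => ?_)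
  simp only [pd_mul hφ.differentiable hψ.differentiable]
  ring

lemma isWeakGradV_of_mem_dissGraph (hG : AssumptionA1 G) {y z : Y G} {g : Yd G}
    (h : (y, z, g) ∈ dissGraph G) : IsWeakGradV y g := by
  obtain ⟨q, hq, hlim⟩ := mem_closure_iff_seq_limit.1
    (h : (y, z, g) ∈ closure (coreGraph G : Set (Y G × Y G × Yd G)))
  exact isWeakGradV_of_tendsto hG (fun n => isWeakGradV_of_mem_coreGraph hG (hq n))
    ((continuous_fst.tendsto _).comp hlim)
    (((continuous_snd.comp continuous_snd).tendsto _).comp hlim)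

end Control

/-! ### Mollification in `L²` -/

section Young

variable {X : Type*} [NormedAddCommGroup X] [NormedSpace ℝ X] [MeasureSpace X] [BorelSpace X]
  [FiniteDimensional ℝ X] [(volume : Measure X).IsAddHaarMeasure]

/-- Cauchy-Schwarz for the product of `√a` and `√a b`. -/
lemma lintegral_mul_sq_le {Ω : Type*} [MeasurableSpace Ω] {μ : Measure Ω} {a b : Ω → ℝ≥0∞}
    (ha : AEMeasurable a μ) (hb : AEMeasurable b μ) :
    (∫⁻ q, a q * b q ∂μ) ^ 2 ≤ (∫⁻ q, a q ∂μ) * ∫⁻ q, a q * b q ^ 2 ∂μ := by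
  have h := ENNReal.lintegral_mul_le_Lp_mul_Lq μ (p := 2) (q := 2)
    (Real.HolderConjugate.two_two)
    (f := fun q => a q ^ (1 / 2 : ℝ)) (g := fun q => a q ^ (1 / 2 : ℝ) * b q)
    (ha.pow_const _) ((ha.pow_const _).mul hb)
  have e1 : ∀ t : ℝ≥0∞, (t ^ (1 / 2 : ℝ)) ^ (2 : ℝ) = t := fun t => by
    rw [← ENNReal.rpow_mul]; norm_num
  have e2 : ∀ t : ℝ≥0∞, t ^ (1 / 2 : ℝ) * t ^ (1 / 2 : ℝ) = t := fun t => by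
    rw [← ENNReal.rpow_add_of_nonneg _ _ (by norm_num) (by norm_num)]; norm_num
  simp only [Pi.mul_apply, ENNReal.mul_rpow_of_nonneg _ _ (zero_le_two (α := ℝ)), e1, ← mul_assoc,
    e2] at h
  have h2 := pow_le_pow_left' h 2
  refine h2.trans (le_of_eq ?_)
  rw [mul_pow, ← ENNReal.rpow_natCast, ← ENNReal.rpow_natCast]
  push_cast
  rw [e1, e1]
  simp only [ENNReal.rpow_two]

/-- Young's convolution inequality `‖k * f‖₂ ≤ ‖k‖₁ ‖f‖₂`. -/
lemma eLpNorm_cv_le {k f : X → ℝ} (hk : Continuous k) (hf : AEStronglyMeasurable f volume) :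
    eLpNorm (cv k f) 2 volume ≤ (∫⁻ q, ‖k q‖ₑ) * eLpNorm f 2 volume := by
  have hsq : ∀ u : X → ℝ, eLpNorm u 2 volume ^ 2 = ∫⁻ p, ‖u p‖ₑ ^ 2 := fun u => by
    rw [eLpNorm_eq_lintegral_rpow_enorm_toReal (by simp) (by simp), ← ENNReal.rpow_natCast,
      ← ENNReal.rpow_mul]
    norm_num
  have hfe : AEMeasurable (fun q => ‖f q‖ₑ) volume := hf.enorm
  have hke : Measurable fun z : X × X => ‖k (z.1 - z.2)‖ₑ :=
    ((hk.comp (continuous_fst.sub continuous_snd)).enorm).measurable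
  have hkp : ∀ p, Measurable fun q => ‖k (p - q)‖ₑ := fun p =>
    (hk.comp (continuous_const.sub continuous_id)).enorm.measurable
  have h1 : ∀ p, ‖cv k f p‖ₑ ^ 2 ≤ (∫⁻ q, ‖k q‖ₑ) * ∫⁻ q, ‖k (p - q)‖ₑ * ‖f q‖ₑ ^ 2 := fun p => by
    have h2 : ‖cv k f p‖ₑ ≤ ∫⁻ q, ‖k (p - q)‖ₑ * ‖f q‖ₑ := by
      refine (enorm_integral_le_lintegral_enorm _).trans (le_of_eq ?_)
      simp only [enorm_mul]
    have h3 : ∫⁻ q, ‖k (p - q)‖ₑ = ∫⁻ q, ‖k q‖ₑ :=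
      lintegral_sub_left_eq_self (fun q => ‖k q‖ₑ) p
    rw [← h3]
    exact (pow_le_pow_left' h2 2).trans (lintegral_mul_sq_le (hkp p).aemeasurable hfe)
  have h4 : ∫⁻ p, ∫⁻ q, ‖k (p - q)‖ₑ * ‖f q‖ₑ ^ 2 = (∫⁻ q, ‖k q‖ₑ) * ∫⁻ q, ‖f q‖ₑ ^ 2 := by
    rw [lintegral_lintegral_swap]
    · have : ∀ q, ∫⁻ p, ‖k (p - q)‖ₑ * ‖f q‖ₑ ^ 2 = (∫⁻ q, ‖k q‖ₑ) * ‖f q‖ₑ ^ 2 := fun q => by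
        have hm : AEMeasurable (fun p => ‖k (p - q)‖ₑ) volume :=
          (hk.comp (continuous_id.sub continuous_const)).enorm.measurable.aemeasurable
        rw [lintegral_mul_const'' _ hm, lintegral_sub_right_eq_self (fun p => ‖k p‖ₑ) q]
      simp only [this]
      rw [lintegral_const_mul'' _ (hfe.pow_const 2)]
    · exact hke.aemeasurable.mul ((hfe.comp_quasiMeasurePreserving
        Measure.quasiMeasurePreserving_snd).pow_const 2)
  have h5 : eLpNorm (cv k f) 2 volume ^ 2 ≤ ((∫⁻ q, ‖k q‖ₑ) * eLpNorm f 2 volume) ^ 2 := by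
    rw [hsq, mul_pow, hsq]
    calc ∫⁻ p, ‖cv k f p‖ₑ ^ 2
        ≤ ∫⁻ p, (∫⁻ q, ‖k q‖ₑ) * ∫⁻ q, ‖k (p - q)‖ₑ * ‖f q‖ₑ ^ 2 := lintegral_mono h1
      _ = (∫⁻ q, ‖k q‖ₑ) * ∫⁻ p, ∫⁻ q, ‖k (p - q)‖ₑ * ‖f q‖ₑ ^ 2 := by
          refine lintegral_const_mul'' _ ?_
          exact (hke.aemeasurable.mul ((hfe.comp_quasiMeasurePreserving
            Measure.quasiMeasurePreserving_snd).pow_const 2)).lintegral_prod_right'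
      _ = _ := by rw [h4]; ring
  exact (ENNReal.pow_le_pow_left_iff two_ne_zero).1 h5

lemma IsMollifier.lintegral_eq {k : X → ℝ} {r : ℝ} (hk : IsMollifier k r) :
    ∫⁻ q, ‖k q‖ₑ = 1 := by
  have h := ofReal_integral_eq_lintegral_ofReal (μ := (volume : Measure X))
    (hk.isTest.continuous.integrable_of_hasCompactSupport hk.isTest.2) (ae_of_all _ hk.nonneg)
  rw [hk.integral_eq, ENNReal.ofReal_one] at h
  rw [h]
  exact lintegral_congr fun q => Real.enorm_of_nonneg (hk.nonneg q)

lemma cv_sub {k f g : X → ℝ} (hk : IsTest k) (hf : LocallyIntegrable f volume)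
    (hg : LocallyIntegrable g volume) (p : X) :
    cv k (fun q => f q - g q) p = cv k f p - cv k g p := by
  rw [cv, cv, cv, ← integral_sub (integrable_cv hk.continuous hk.2 hf p)
    (integrable_cv hk.continuous hk.2 hg p)]
  simp only [mul_sub]

lemma IsMollifier.cv_const {k : X → ℝ} {r : ℝ} (hk : IsMollifier k r) (a : ℝ) (p : X) :
    cv k (fun _ => a) p = a := by
  rw [cv, integral_mul_const, integral_sub_left_eq_self k volume p, hk.integral_eq, one_mul]

/-- Convergence of mollifications in `L²`. -/
lemma tendsto_eLpNorm_cv_sub {k : ℕ → X → ℝ} {r : ℕ → ℝ} (hk : ∀ n, IsMollifier (k n) (r n))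
    (hr : Tendsto r atTop (𝓝 0)) {f : X → ℝ} (hf : MemLp f 2 volume) :
    Tendsto (fun n => eLpNorm (fun p => cv (k n) f p - f p) 2 volume) atTop (𝓝 0) := by
  have : ProperSpace X := FiniteDimensional.proper ℝ X
  refine ENNReal.tendsto_atTop_zero.2 fun ε hε => ?_
  obtain ⟨ε', hε', hle⟩ : ∃ ε' : ℝ≥0∞, 0 < ε' ∧ ε' + ε' + ε' ≤ ε := by
    refine ⟨ε / 3, ENNReal.div_pos hε.ne' (by simp), ?_⟩
    rw [ENNReal.add_thirds]
  -- Three small terms: for the continuous, compactly supported `g` the mollification converges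
  -- uniformly on a fixed ball, and `f - g` is small both before and, by Young's inequality, after
  -- mollification.
  obtain ⟨g, hgc, hfg, hg, hgm⟩ := hf.exists_hasCompactSupport_eLpNorm_sub_le (by simp) hε'.ne'
  have hfi : LocallyIntegrable f volume := hf.locallyIntegrable one_le_two
  have hgi : LocallyIntegrable g volume := hg.locallyIntegrable
  obtain ⟨R, hR⟩ := hgc.isCompact.isBounded.subset_closedBall (0 : X)
  have hgz : ∀ p, R < ‖p‖ → g p = 0 := fun p hp => image_eq_zero_of_notMem_tsupport fun h =>
    absurd (mem_closedBall_zero_iff.1 (hR h)) (not_le.2 hp)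
  set c : ℝ≥0∞ := volume (Metric.closedBall (0 : X) (R + 1)) ^ (2 : ℝ≥0∞).toReal⁻¹ with hc
  have hct : c ≠ ⊤ := ENNReal.rpow_ne_top_of_nonneg (by norm_num)
    (isCompact_closedBall _ _).measure_lt_top.ne
  obtain ⟨δ, hδ, hδε⟩ : ∃ δ : ℝ, 0 < δ ∧ c * ENNReal.ofReal δ ≤ ε' := by
    have h1 : Tendsto (fun δ : ℝ => c * ENNReal.ofReal δ) (𝓝[>] 0) (𝓝 0) := by
      have h2 := ENNReal.Tendsto.const_mul (a := c)
        (ENNReal.tendsto_ofReal (tendsto_id (x := 𝓝 (0 : ℝ)))) (Or.inr hct)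
      simp only [ENNReal.ofReal_zero, mul_zero, id] at h2
      exact h2.mono_left nhdsWithin_le_nhds
    obtain ⟨δ, h3, h4⟩ := ((h1.eventually (gt_mem_nhds hε')).and self_mem_nhdsWithin).exists
    exact ⟨δ, h4, h3.le⟩
  obtain ⟨η, hη, hgη⟩ := Metric.uniformContinuous_iff.1 (hgc.uniformContinuous_of_continuous hg) δ hδ
  obtain ⟨N, hN⟩ := eventually_atTop.1 (hr.eventually (gt_mem_nhds (lt_min hη one_pos)))
  refine ⟨N, fun n hn => ?_⟩
  have hrn := hN n hn
  have hrη : r n < η := hrn.trans_le (min_le_left _ _)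
  have hr1 : r n < 1 := hrn.trans_le (min_le_right _ _)
  have hb : ∀ p, |cv (k n) g p - g p| ≤ δ := fun p => by
    have h1 := cv_sub (hk n).isTest hgi (locallyIntegrable_const (g p)) p
    rw [(hk n).cv_const] at h1
    rw [← h1]
    refine (hk n).abs_cv_le' (ae_of_all _ fun q hq => ?_)
    have h2 := hgη (a := q) (b := p) (by rw [dist_comm, dist_eq_norm]; linarith)
    rw [Real.dist_eq] at h2
    exact h2.le
  have hz : ∀ p, R + 1 < ‖p‖ → cv (k n) g p - g p = 0 := fun p hp => by
    rw [hgz p (by linarith), sub_zero, cv]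
    refine integral_eq_zero_of_ae (ae_of_all _ fun q => ?_)
    by_cases h : r n ≤ ‖p - q‖
    · simp [(hk n).eq_zero _ h]
    · have h3 : ‖p‖ ≤ ‖p - q‖ + ‖q‖ := by simpa using norm_add_le (p - q) q
      simp [hgz q (by linarith [not_le.1 h])]
  have h1 : eLpNorm (fun p => cv (k n) g p - g p) 2 volume ≤ ε' := by
    have e : (fun p => cv (k n) g p - g p) =
        (Metric.closedBall (0 : X) (R + 1)).indicator fun p => cv (k n) g p - g p := by
      funext p
      by_cases hp : p ∈ Metric.closedBall (0 : X) (R + 1)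
      · rw [indicator_of_mem hp]
      · rw [indicator_of_notMem hp, hz p]
        simpa using hp
    rw [e, eLpNorm_indicator_eq_eLpNorm_restrict Metric.isClosed_closedBall.measurableSet]
    refine (eLpNorm_le_of_ae_bound (C := δ) (ae_of_all _ fun p => hb p)).trans ?_
    rwa [Measure.restrict_apply_univ]
  have h2 : eLpNorm (cv (k n) fun p => f p - g p) 2 volume ≤ ε' := by
    refine (eLpNorm_cv_le (hk n).isTest.continuous (hf.1.sub hgm.1)).trans ?_
    rw [(hk n).lintegral_eq, one_mul]
    exact hfg
  have hcm : ∀ {u : X → ℝ}, LocallyIntegrable u volume →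
      AEStronglyMeasurable (cv (k n) u) volume := fun hu =>
    (contDiff_cv (hk n).isTest hu).continuous.aestronglyMeasurable
  have e : (fun p => cv (k n) f p - f p) = (cv (k n) fun p => f p - g p) +
      ((fun p => cv (k n) g p - g p) - (f - g)) := by
    funext p
    simp only [Pi.add_apply, Pi.sub_apply, cv_sub (hk n).isTest hfi hgi]
    ring
  rw [e]
  refine (eLpNorm_add_le (hcm (hfi.sub hgi)) (((hcm hgi).sub hgm.1).sub (hf.1.sub hgm.1))
    one_le_two).trans ?_
  refine (add_le_add h2 ((eLpNorm_sub_le ((hcm hgi).sub hgm.1) (hf.1.sub hgm.1) one_le_two).trans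
    (add_le_add h1 hfg))).trans ?_
  rwa [← add_assoc]

end Young

/-! ### Conjugation by `exp(H/2)` -/

section Conjugation

variable {d : ℕ} {G : E d → ℝ} {ψ : Phase d → ℝ}

/-- The operator `l - 𝓛*` conjugated by `exp(H/2)`. -/
def conjOp (G : E d → ℝ) (l : ℝ) (ψ : Phase d → ℝ) (p : Phase d) : ℝ :=
  (l - d / 2 + ‖p.2‖ ^ 2 / 4) * ψ p + transport G ψ p - ∑ i, pd (ev i) (pd (ev i) ψ) p

lemma conjOp_eq (l : ℝ) (p : Phase d) : conjOp G l ψ p = l * ψ p + ∑ i,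
    ((1 / 4 * p.2 i ^ 2 - 1 / 2) * ψ p + p.2 i * pd (ex i) ψ p - weakGrad G p.1 i * pd (ev i) ψ p -
      pd (ev i) (pd (ev i) ψ) p) := by
  simp only [conjOp, transport, Finset.sum_sub_distrib, Finset.sum_add_distrib, ← Finset.sum_mul,
    ← Finset.mul_sum, ← EuclideanSpace.real_norm_sq_eq]
  simp
  ring

/-- The conjugating weight is built from a smooth `Γ`, since `exp(H/2)` need not be smooth. The last
sum is the price; it involves only `∇Γ - ∇G` and disappears as `Γ` approaches `G`. -/
lemma sub_Lstar_mul_exp {Γ : E d → ℝ} (hΓ : ContDiff ℝ ∞ Γ) (hψ : ContDiff ℝ ∞ ψ) (l : ℝ)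
    (p : Phase d) :
    l * (ψ p * Real.exp (1 / 4 * ‖p.2‖ ^ 2 + 1 / 2 * Γ p.1)) -
      Lstar G (fun q => ψ q * Real.exp (1 / 4 * ‖q.2‖ ^ 2 + 1 / 2 * Γ q.1)) p =
    Real.exp (1 / 4 * ‖p.2‖ ^ 2 + 1 / 2 * Γ p.1) * (conjOp G l ψ p + 1 / 2 * ψ p *
      ∑ i, p.2 i * (pd (EuclideanSpace.single i 1) Γ p.1 - weakGrad G p.1 i)) := by
  set ε : Phase d → ℝ := fun q => Real.exp (1 / 4 * ‖q.2‖ ^ 2 + 1 / 2 * Γ q.1) with hε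
  have hΓs : ContDiff ℝ ∞ fun q : Phase d => Γ q.1 := hΓ.comp contDiff_fst
  have hΓs' : ContDiff ℝ ∞ fun q : Phase d => 1 / 2 * Γ q.1 := contDiff_const.mul hΓs
  have hεs : ContDiff ℝ ∞ ε := ((contDiff_coeff_norm_sq _).add hΓs').exp
  have hεd : Differentiable ℝ ε := hεs.differentiable (by simp)
  have hψd : Differentiable ℝ ψ := hψ.differentiable (by simp)
  have hpd : ∀ e q, pd e ε q = (pd e (fun q : Phase d => 1 / 4 * ‖q.2‖ ^ 2) q +
      1 / 2 * pd e.1 Γ q.1) * ε q := fun e q => by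
    have h1 : Differentiable ℝ fun q : Phase d => 1 / 4 * ‖q.2‖ ^ 2 :=
      (contDiff_coeff_norm_sq _).differentiable (by simp)
    have h2 : Differentiable ℝ fun q : Phase d => 1 / 2 * Γ q.1 := hΓs'.differentiable (by simp)
    have h12 : Differentiable ℝ fun q : Phase d => 1 / 4 * ‖q.2‖ ^ 2 + 1 / 2 * Γ q.1 := h1.add h2
    simp only [hε]
    rw [pd_exp h12, pd_add h1 h2, pd_const_mul (hΓs.differentiable (by simp)),
      pd_comp_fst (hΓ.differentiable (by simp))]
  have hx : ∀ i q, pd (ex i) (fun q => ψ q * ε q) q =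
      (pd (ex i) ψ q + 1 / 2 * pd (EuclideanSpace.single i 1) Γ q.1 * ψ q) * ε q := fun i q => by
    rw [pd_mul hψd hεd, hpd, pd_ex_coeff_norm_sq]
    simp only [ex]
    ring
  have hv : ∀ i q, pd (ev i) (fun q => ψ q * ε q) q =
      (pd (ev i) ψ q + 1 / 2 * q.2 i * ψ q) * ε q := fun i q => by
    rw [pd_mul hψd hεd, hpd, pd_ev_coeff_norm_sq]
    simp only [ev, pd_zero]
    ring
  have hc : ∀ i (q : Phase d), pd (ev i) (fun q : Phase d => q.2 i) q = 1 := fun i q => by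
    have : (fun q : Phase d => q.2 i) = fun q : Phase d => (EuclideanSpace.proj i :
      E d →L[ℝ] ℝ) ((ContinuousLinearMap.snd ℝ (E d) (E d)) q) := rfl
    rw [this, pd]
    change fderiv ℝ ((EuclideanSpace.proj i : E d →L[ℝ] ℝ).comp
      (ContinuousLinearMap.snd ℝ (E d) (E d))) q (ev i) = 1
    rw [ContinuousLinearMap.fderiv]
    simp [ev]
  have hvv : ∀ i q, pd (ev i) (pd (ev i) (fun q => ψ q * ε q)) q =
      (pd (ev i) (pd (ev i) ψ) q + q.2 i * pd (ev i) ψ q + 1 / 2 * ψ q +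
        1 / 4 * q.2 i ^ 2 * ψ q) * ε q := fun i q => by
    have e : pd (ev i) (fun q => ψ q * ε q) = fun q =>
      (pd (ev i) ψ q + 1 / 2 * (q.2 i * ψ q)) * ε q := by
      funext q; rw [hv]; ring
    have d0 : Differentiable ℝ fun q : Phase d => q.2 i := by fun_prop
    have d1 : Differentiable ℝ fun q : Phase d => q.2 i * ψ q := d0.mul hψd
    have d2 : Differentiable ℝ fun q : Phase d => 1 / 2 * (q.2 i * ψ q) := d1.const_mul _
    have d3 : Differentiable ℝ (pd (ev i) ψ) := (contDiff_pd hψ).differentiable (by simp)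
    have d4 : Differentiable ℝ fun q : Phase d => pd (ev i) ψ q + 1 / 2 * (q.2 i * ψ q) := d3.add d2
    rw [e, pd_mul d4 hεd, pd_add d3 d2, pd_const_mul d1, pd_mul d0 hψd, hc, hpd,
      pd_ev_coeff_norm_sq]
    simp only [ev, pd_zero]
    ring
  rw [Lstar_eq (hψ.mul hεs), conjOp_eq]
  simp only [transport, ornstein, hx, hv, hvv]
  have hsum : ∑ i, (p.2 i * ((pd (ex i) ψ p + 1 / 2 * pd (EuclideanSpace.single i 1) Γ p.1 * ψ p) *
      ε p) - weakGrad G p.1 i * ((pd (ev i) ψ p + 1 / 2 * p.2 i * ψ p) * ε p) -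
      ((pd (ev i) (pd (ev i) ψ) p + p.2 i * pd (ev i) ψ p + 1 / 2 * ψ p +
        1 / 4 * p.2 i ^ 2 * ψ p) * ε p - p.2 i * ((pd (ev i) ψ p + 1 / 2 * p.2 i * ψ p) * ε p))) =
      ε p * ∑ i, ((1 / 4 * p.2 i ^ 2 - 1 / 2) * ψ p + p.2 i * pd (ex i) ψ p -
      weakGrad G p.1 i * pd (ev i) ψ p - pd (ev i) (pd (ev i) ψ) p) + ε p * (1 / 2 * ψ p *
      ∑ i, p.2 i * (pd (EuclideanSpace.single i 1) Γ p.1 - weakGrad G p.1 i)) := by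
    simp only [Finset.mul_sum, ← Finset.sum_add_distrib]
    exact Finset.sum_congr rfl fun i _ => by ring
  simp only [Finset.sum_sub_distrib] at hsum ⊢
  linear_combination hsum

lemma locBdd_conjOp (hG : AssumptionA1 G) (l : ℝ) (hψ : ContDiff ℝ ∞ ψ) : LocBdd (conjOp G l ψ) :=
  (((LocBdd.of_continuous (c := fun p : Phase d => l - d / 2 + ‖p.2‖ ^ 2 / 4) (by fun_prop)).mul
    (LocBdd.of_continuous hψ.continuous)).add (locBdd_transport hG hψ)).sub
    (LocBdd.sum fun i _ => locBdd_pd (contDiff_pd hψ) (ev i))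

lemma conjOp_eq_zero_of_norm_gt {R : ℝ} (hR : tsupport ψ ⊆ Metric.closedBall 0 R) (l : ℝ)
    {p : Phase d} (hp : ¬ ‖p‖ ≤ R) : conjOp G l ψ p = 0 := by
  have h0 : ∀ e, tsupport (pd e ψ) ⊆ Metric.closedBall 0 R := fun e =>
    (closure_minimal (fun q hq => by
      by_contra h
      exact hq (eq_zero_of_norm_gt hR (fun h2 => h (mem_closedBall_zero_iff.2 h2)) e).2)
      Metric.isClosed_closedBall)
  simp [conjOp, transport, (eq_zero_of_norm_gt hR hp _).2, (eq_zero_of_norm_gt hR hp 0).1,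
    (eq_zero_of_norm_gt (h0 _) hp _).2]

/-- If `f` is orthogonal to the range of `l - 𝓛*`, then `f exp(-H/2)` is a distributional solution of
the adjoint of the conjugated equation. -/
lemma integral_mul_conjOp_eq_zero (hG : AssumptionA1 G) {f : Phase d → ℝ} {l : ℝ}
    (hh : LocallyIntegrable (fun p => f p * Real.exp (-(hamiltonian G p / 2))) volume)
    (hf : ∀ φ, IsTest φ → ∫ p, f p * (l * φ p - Lstar G φ p) * wt G p = 0) (hψ : IsTest ψ) :
    ∫ p, (f p * Real.exp (-(hamiltonian G p / 2))) * conjOp G l ψ p = 0 := by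
  set h : Phase d → ℝ := fun p => f p * Real.exp (-(hamiltonian G p / 2)) with hdef
  obtain ⟨Gn, hGn⟩ := hG.exists_isPotentialApprox
  obtain ⟨R, hR⟩ := hψ.2.isCompact.isBounded.subset_closedBall (0 : Phase d)
  -- The orthogonality is tested with `ψ exp(‖v‖²/4 + Gₙ/2)`, an admissible test function. After `h`
  -- is split off, the exponentials leave only `exp((Gₙ - G)/2)`, which tends to `1`.
  set A : ℕ → Phase d → ℝ := fun n p => Real.exp ((Gn n p.1 - G p.1) / 2) * (conjOp G l ψ p +
    1 / 2 * ψ p * ∑ i, p.2 i * (pd (EuclideanSpace.single i 1) (Gn n) p.1 - weakGrad G p.1 i)) with hA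
  have hn : ∀ n, ∫ p, h p * A n p = 0 := fun n => by
    have hΓs' : ContDiff ℝ ∞ fun q : Phase d => 1 / 2 * Gn n q.1 :=
      contDiff_const.mul ((hGn.contDiff n).comp contDiff_fst)
    have hεs : ContDiff ℝ ∞ fun q : Phase d => Real.exp (1 / 4 * ‖q.2‖ ^ 2 + 1 / 2 * Gn n q.1) :=
      ((contDiff_coeff_norm_sq _).add hΓs').exp
    rw [← hf _ (hψ.mul_right hεs)]
    refine integral_congr_ae (ae_of_all _ fun p => ?_)
    simp only [sub_Lstar_mul_exp (hGn.contDiff n) hψ.1, hdef, hA, wt]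
    have e1 : Real.exp (-hamiltonian G p) = Real.exp (-(hamiltonian G p / 2)) *
      Real.exp (-(hamiltonian G p / 2)) := by rw [← Real.exp_add]; congr 1; ring
    have e2 : Real.exp ((Gn n p.1 - G p.1) / 2) = Real.exp (1 / 4 * ‖p.2‖ ^ 2 + 1 / 2 * Gn n p.1) *
      Real.exp (-(hamiltonian G p / 2)) := by
      rw [← Real.exp_add, hamiltonian]; congr 1; ring
    rw [e1, e2]
    ring
  have hAm : ∀ n, AEStronglyMeasurable (A n) volume := fun n => by
    have h1 : ∀ i, LocBdd fun p : Phase d => pd (EuclideanSpace.single i 1) (Gn n) p.1 := fun i =>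
      LocBdd.of_continuous ((continuous_pd (hGn.contDiff n)).comp continuous_fst)
    have h2 : LocBdd fun p : Phase d => Gn n p.1 :=
      LocBdd.of_continuous ((hGn.contDiff n).continuous.comp continuous_fst)
    have h3 : LocBdd (A n) := ((h2.sub hG.locBdd.comp_fst).comp_continuous
      (f := fun s => Real.exp (s / 2)) (by fun_prop)).mul
      ((locBdd_conjOp hG l hψ.1).add (((LocBdd.const (1 / 2)).mul
        (LocBdd.of_continuous hψ.continuous)).mul (LocBdd.sum fun i _ => (LocBdd.coord i).mul
          ((h1 i).sub (hG.locBdd_weakGrad i).comp_fst))))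
    exact h3.1
  obtain ⟨K, hK⟩ : ∃ K : ℝ, ∀ n, ∀ᵐ p, |A n p| ≤ (Metric.closedBall (0 : Phase d) R).indicator
      (fun _ => K) p := by
    obtain ⟨M, hM⟩ := hGn.bound R
    obtain ⟨M', hM'⟩ := hGn.bound_pd R
    obtain ⟨K0, hK0⟩ := hG.locBdd.comp_fst.2 R
    obtain ⟨K1, hK1⟩ := (locBdd_conjOp hG l hψ.1).2 R
    obtain ⟨K2, hK2⟩ := (LocBdd.of_continuous hψ.continuous).2 R
    choose K3 hK3 using fun i => (hG.locBdd_weakGrad i).comp_fst.2 R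
    refine ⟨Real.exp ((M + K0) / 2) * (K1 + 1 / 2 * K2 * ∑ i, R * (M' + K3 i)), fun n => ?_⟩
    filter_upwards [hK0, hK1, hK2, ae_all_iff.2 hK3] with p p0 p1 p2 p3
    by_cases hp : ‖p‖ ≤ R
    · rw [indicator_of_mem (mem_closedBall_zero_iff.2 hp)]
      have hp1 : ‖p.1‖ ≤ R := (norm_fst_le p).trans hp
      specialize p0 hp
      specialize p1 hp
      specialize p2 hp
      rw [hA]
      simp only
      rw [abs_mul]
      refine mul_le_mul ?_ ?_ (abs_nonneg _) (Real.exp_pos _).le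
      · rw [abs_of_pos (Real.exp_pos _)]
        refine Real.exp_le_exp.2 ?_
        have := (abs_le.1 (hM n _ hp1)).2
        have := (abs_le.1 p0).1
        linarith
      · refine (abs_add_le _ _).trans (add_le_add p1 ?_)
        rw [abs_mul, abs_mul, abs_of_pos (by norm_num : (0 : ℝ) < 1 / 2)]
        refine mul_le_mul (mul_le_mul_of_nonneg_left p2 (by norm_num)) ?_ (abs_nonneg _)
          (by linarith [(abs_nonneg _).trans p2])
        refine (Finset.abs_sum_le_sum_abs _ _).trans (Finset.sum_le_sum fun i _ => ?_)
        rw [abs_mul]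
        refine mul_le_mul ?_ ?_ (abs_nonneg _) ((norm_nonneg _).trans hp)
        · exact (PiLp.norm_apply_le p.2 i).trans ((norm_snd_le p).trans hp)
        · exact (abs_sub _ _).trans (add_le_add (hM' n _ hp1 i) (p3 i hp))
    · rw [indicator_of_notMem (fun h => hp (mem_closedBall_zero_iff.1 h)), hA]
      simp [conjOp_eq_zero_of_norm_gt hR l hp, (eq_zero_of_norm_gt hR hp 0).1]
  have hlim := tendsto_integral_of_dominated_convergence (μ := (volume : Measure (Phase d)))
    (F := fun n p => h p * A n p) (f := fun p => h p * conjOp G l ψ p)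
    (fun p => (Metric.closedBall (0 : Phase d) R).indicator (fun p => ‖h p‖ * K) p)
    (fun n => hh.aestronglyMeasurable.mul (hAm n)) ?_ (fun n => ?_) ?_
  · simp only [hn] at hlim
    exact tendsto_nhds_unique hlim tendsto_const_nhds
  · rw [integrable_indicator_iff Metric.isClosed_closedBall.measurableSet]
    exact ((hh.integrableOn_isCompact (isCompact_closedBall _ _)).norm.mul_const K)
  · filter_upwards [hK n] with p hp
    rw [norm_mul]
    by_cases hm : p ∈ Metric.closedBall (0 : Phase d) R
    · rw [indicator_of_mem hm] at hp ⊢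
      exact mul_le_mul_of_nonneg_left hp (norm_nonneg _)
    · rw [indicator_of_notMem hm] at hp ⊢
      rw [Real.norm_eq_abs (A n p), le_antisymm hp (abs_nonneg _), mul_zero]
  · filter_upwards [ae_comp_fst hGn.tendsto, ae_comp_fst hGn.tendsto_pd] with p h1 h2
    refine Tendsto.const_mul _ ?_
    have h3 : Tendsto (fun n => Real.exp ((Gn n p.1 - G p.1) / 2)) atTop (𝓝 (Real.exp 0)) := by
      refine (Real.continuous_exp.tendsto _).comp ?_
      have := (h1.sub_const (G p.1)).div_const 2
      simpa using this
    have h4 : Tendsto (fun n => ∑ i, p.2 i * (pd (EuclideanSpace.single i 1) (Gn n) p.1 -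
        weakGrad G p.1 i)) atTop (𝓝 (∑ i : Fin d, p.2 i * (weakGrad G p.1 i - weakGrad G p.1 i))) :=
      tendsto_finsetSum _ fun i _ => ((h2 i).sub_const _).const_mul _
    have h5 := h3.mul ((h4.const_mul (1 / 2 * ψ p)).const_add (conjOp G l ψ p))
    simpa [hA] using h5

end Conjugation

/-! ### The regularized equation -/

section Regularization

variable {d : ℕ} {G : E d → ℝ} {h k : Phase d → ℝ}

lemma LocBdd.mul_locallyIntegrable {X : Type*} [NormedAddCommGroup X] [MeasureSpace X]
    [BorelSpace X] [ProperSpace X] {c u : X → ℝ} (hc : LocBdd c)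
    (hu : LocallyIntegrable u volume) : LocallyIntegrable (fun p => c p * u p) volume := by
  refine locallyIntegrable_iff.2 fun K hK => ?_
  obtain ⟨R, hR⟩ := hK.isBounded.subset_closedBall (0 : X)
  obtain ⟨M, hM⟩ := hc.2 R
  refine Integrable.bdd_mul (c := M) (hu.integrableOn_isCompact hK) hc.1.restrict ?_
  filter_upwards [ae_restrict_of_ae hM, ae_restrict_mem hK.measurableSet] with p h1 h2
  exact h1 (mem_closedBall_zero_iff.1 (hR h2))

/-- The kernel of the commutator of `v·∇_x` with the convolution by `k`. -/
def commKernel (k : Phase d → ℝ) (q : Phase d) : ℝ := ∑ i, q.2 i * pd (ex i) k q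

lemma isTest_commKernel (hk : IsTest k) : IsTest (commKernel k) := by
  have h : ∀ i : Fin d, IsTest fun q : Phase d => q.2 i * pd (ex i) k q := fun i =>
    hk.pd.mul_left (by fun_prop)
  refine ⟨ContDiff.sum fun i _ => (h i).1, ?_⟩
  exact HasCompactSupport.intro (K := tsupport k) hk.2.isCompact fun q hq => by
    refine Finset.sum_eq_zero fun i _ => ?_
    have h2 : fderiv ℝ k q = 0 := by
      by_contra hne
      exact hq (support_fderiv_subset ℝ hne)
    simp [pd, h2]

/-- The regularization `k * h` of a distributional solution of `conjOp' h = 0` solves the equation up to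
a commutator. -/
lemma regularized_eq (hG : AssumptionA1 G) {l : ℝ} (hh : LocallyIntegrable h volume)
    (hT : ∀ ψ, IsTest ψ → ∫ q, h q * conjOp G l ψ q = 0) (hk : IsTest k) (p : Phase d) :
    (l - d / 2) * cv k h p + cv k (fun q => ‖q.2‖ ^ 2 / 4 * h q) p -
      ∑ i, p.2 i * pd (ex i) (cv k h) p + cv (commKernel k) h p +
      ∑ i, pd (ev i) (cv k fun q => weakGrad G q.1 i * h q) p -
      ∑ i, pd (ev i) (pd (ev i) (cv k h)) p = 0 := by
  have hcont : ∀ {m : Phase d → ℝ}, IsTest m → ∀ {u : Phase d → ℝ}, LocallyIntegrable u volume →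
      Integrable fun q => m (p - q) * u q := fun hm _ hu =>
    integrable_cv hm.continuous hm.2 hu p
  have hgi : ∀ i, LocallyIntegrable (fun q : Phase d => weakGrad G q.1 i * h q) volume := fun i =>
    (hG.locBdd_weakGrad i).comp_fst.mul_locallyIntegrable hh
  have hvi : LocallyIntegrable (fun q : Phase d => ‖q.2‖ ^ 2 / 4 * h q) volume :=
    (LocBdd.of_continuous (c := fun q : Phase d => ‖q.2‖ ^ 2 / 4)
      (by fun_prop)).mul_locallyIntegrable hh
  have hpp : ∀ i, pd (ev i) (pd (ev i) (cv k h)) p = cv (pd (ev i) (pd (ev i) k)) h p := fun i => by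
    rw [← pd_cv hk.pd hh]
    congr 1
    funext q
    exact pd_cv hk hh _ q
  simp only [hpp, pd_cv hk hh, pd_cv hk (hgi _)]
  -- The equation is tested with `q ↦ k (p - q)`. All derivatives of mollified functions now fall on
  -- the kernel, and the two integrands can be compared pointwise.
  rw [← hT _ (hk.comp_sub p)]
  have i1 := (hcont hk hh).const_mul (l - d / 2)
  have i2 := hcont hk hvi
  have i3 : Integrable fun q => ∑ i, p.2 i * (pd (ex i) k (p - q) * h q) :=
    integrable_finsetSum _ fun i _ => (hcont hk.pd hh).const_mul _
  have i4 := hcont (isTest_commKernel hk) hh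
  have i5 : Integrable fun q => ∑ i, pd (ev i) k (p - q) * (weakGrad G q.1 i * h q) :=
    integrable_finsetSum _ fun i _ => hcont hk.pd (hgi i)
  have i6 : Integrable fun q => ∑ i, pd (ev i) (pd (ev i) k) (p - q) * h q :=
    integrable_finsetSum _ fun i _ => hcont hk.pd.pd hh
  have e3 : ∑ i, p.2 i * cv (pd (ex i) k) h p =
      ∫ q, ∑ i, p.2 i * (pd (ex i) k (p - q) * h q) := by
    rw [integral_finsetSum _ fun i _ => (hcont hk.pd hh).const_mul _]
    simp only [integral_const_mul, cv]
  have e5 : ∑ i, cv (pd (ev i) k) (fun q => weakGrad G q.1 i * h q) p =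
      ∫ q, ∑ i, pd (ev i) k (p - q) * (weakGrad G q.1 i * h q) := by
    rw [integral_finsetSum _ fun i _ => hcont hk.pd (hgi i)]
    simp only [cv]
  have e6 : ∑ i, cv (pd (ev i) (pd (ev i) k)) h p =
      ∫ q, ∑ i, pd (ev i) (pd (ev i) k) (p - q) * h q := by
    rw [integral_finsetSum _ fun i _ => hcont hk.pd.pd hh]
    simp only [cv]
  rw [e3, e5, e6]
  simp only [cv]
  rw [← integral_const_mul, ← integral_add' i1 i2, ← integral_sub' (i1.add i2) i3,
    ← integral_add' ((i1.add i2).sub i3) i4, ← integral_add' (((i1.add i2).sub i3).add i4) i5,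
    ← integral_sub' ((((i1.add i2).sub i3).add i4).add i5) i6]
  refine integral_congr_ae (ae_of_all _ fun q => ?_)
  have hdd : ∀ i, pd (ev i) (pd (ev i) fun q => k (p - q)) q = pd (ev i) (pd (ev i) k) (p - q) :=
    fun i => by
    have : (pd (ev i) fun q => k (p - q)) = fun q => (-1) * pd (ev i) k (p - q) := by
      funext q; rw [pd_comp_sub hk.differentiable]; ring
    rw [this, pd_const_mul (hk.pd.comp_sub p).differentiable, pd_comp_sub hk.pd.differentiable]
    ring
  simp only [Pi.add_apply, Pi.sub_apply, conjOp, transport, hdd, pd_comp_sub hk.differentiable, commKernel]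
  -- The velocity at `p` is split as `(p - q) + q`: the second part belongs to the transport inside
  -- the integral, the first is the kernel of the commutator.
  have hs : ∑ i, p.2 i * (pd (ex i) k (p - q) * h q) = ∑ i, (p - q).2 i * pd (ex i) k (p - q) * h q
      + ∑ i, q.2 i * pd (ex i) k (p - q) * h q := by
    rw [← Finset.sum_add_distrib]
    refine Finset.sum_congr rfl fun i _ => ?_
    simp only [Prod.snd_sub, PiLp.sub_apply]
    ring
  have hs2 : ∑ i, pd (ev i) k (p - q) * (weakGrad G q.1 i * h q) =
      ∑ i, weakGrad G q.1 i * pd (ev i) k (p - q) * h q :=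
    Finset.sum_congr rfl fun i _ => by ring
  rw [hs, hs2]
  simp only [← Finset.sum_mul, mul_neg, Finset.sum_neg_distrib]
  ring

end Regularization

/-! ### A localized energy inequality for smooth functions -/

section Energy

variable {d : ℕ} {G : E d → ℝ} {F V K χ : Phase d → ℝ} {H : Fin d → Phase d → ℝ}

/-- The integrand of the localized energy inequality for the regularized equation. -/
def energyDensity (G : E d → ℝ) (l : ℝ) (χ F W : Phase d → ℝ) (e : Fin d → Phase d → ℝ)
    (p : Phase d) : ℝ :=
  (l * χ p ^ 2 + χ p * transport G χ p - ∑ i, pd (ev i) χ p ^ 2) * F p * F p + χ p ^ 2 * F p * W p -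
    ∑ i, (1 / 4 * χ p ^ 2 * e i p * e i p + χ p * pd (ev i) χ p * F p * e i p)

/-- The equation is multiplied by `χ² F` and integrated by parts. What remains is a nonnegative
square, while the coefficient of `∇G` survives only in the differences `H i - ∂ᵢG F`, which vanish
in the limit of mollification. -/
lemma integral_energyDensity_nonpos (hG : AssumptionA1 G) {l : ℝ} (hF : ContDiff ℝ ∞ F)
    (hH : ∀ i, ContDiff ℝ ∞ (H i)) (hχ : IsTest χ)
    (hPDE : ∀ p, l * F p + V p - ∑ i, p.2 i * pd (ex i) F p + K p + ∑ i, pd (ev i) (H i) p -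
      ∑ i, pd (ev i) (pd (ev i) F) p = 0) :
    ∫ p, energyDensity G l χ F (fun p => V p + K p)
      (fun i p => H i p - weakGrad G p.1 i * F p) p ≤ 0 := by
  -- All the terms in divergence form; each of them integrates to zero.
  set D : Fin d → Phase d → ℝ := fun i p => 1 / 2 * (p.2 i * pd (ex i) (fun q => χ q * χ q * (F q * F q)) p) +
    1 / 2 * (weakGrad G p.1 i * pd (ev i) (fun q => χ q * χ q * (F q * F q)) p) +
    (1 * pd (ev i) (fun q => χ q * χ q * (F q * pd (ev i) F q)) p -
    1 * pd (ev i) (fun q => χ q * χ q * (F q * H i q)) p) with hD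
  have hχχ : IsTest fun q => χ q * χ q := hχ.mul_right hχ.1
  have ht : ∀ {u : Phase d → ℝ}, ContDiff ℝ ∞ u → IsTest fun q => χ q * χ q * (F q * u q) :=
    fun hu => hχχ.mul_right (hF.mul hu)
  have j1 : ∀ i, Integrable fun p => p.2 i * pd (ex i) (fun q => χ q * χ q * (F q * F q)) p := fun i =>
    (LocBdd.coord i).integrable_mul (ht hF).pd.continuous (ht hF).pd.2
  have j2 : ∀ i, Integrable fun p : Phase d => weakGrad G p.1 i *
      pd (ev i) (fun q => χ q * χ q * (F q * F q)) p := fun i =>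
    (hG.locBdd_weakGrad i).comp_fst.integrable_mul (ht hF).pd.continuous (ht hF).pd.2
  have j3 : ∀ i {u : Phase d → ℝ}, ContDiff ℝ ∞ u → Integrable fun p : Phase d =>
      1 * pd (ev i) (fun q => χ q * χ q * (F q * u q)) p := fun i u hu =>
    (LocBdd.const 1).integrable_mul (ht hu).pd.continuous (ht hu).pd.2
  have k3 : ∀ i {u : Phase d → ℝ}, ContDiff ℝ ∞ u → ∫ p : Phase d,
      1 * pd (ev i) (fun q => χ q * χ q * (F q * u q)) p = 0 := fun i u hu =>
    integral_coeffX_mul_pd_ev (LocBdd.const 1) (ht hu) i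
  have hFi : ∀ i : Fin d, ContDiff ℝ ∞ (pd (ev i) F) := fun i => contDiff_pd hF
  have zadd : ∀ {f g : Phase d → ℝ}, (Integrable f ∧ ∫ p, f p = 0) → (Integrable g ∧ ∫ p, g p = 0) →
      Integrable (fun p => f p + g p) ∧ ∫ p, f p + g p = 0 := fun h1 h2 =>
    ⟨h1.1.add h2.1, by rw [integral_add h1.1 h2.1, h1.2, h2.2, add_zero]⟩
  have zmul : ∀ {f : Phase d → ℝ} (c : ℝ), (Integrable f ∧ ∫ p, f p = 0) →
      Integrable (fun p => c * f p) ∧ ∫ p, c * f p = 0 := fun c h1 =>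
    ⟨h1.1.const_mul c, by rw [integral_const_mul, h1.2, mul_zero]⟩
  have hD' : ∀ i, Integrable (D i) ∧ ∫ p, D i p = 0 := fun i => by
    have h1 := zadd (zmul (1 / 2) ⟨j1 i, integral_coord_mul_pd_ex (ht hF) i⟩)
      (zmul (1 / 2) ⟨j2 i, integral_coeffX_mul_pd_ev (hG.locBdd_weakGrad i) (ht hF) i⟩)
    have h2 := zadd h1 (zadd ⟨j3 i (hFi i), k3 i (hFi i)⟩ (zmul (-1) ⟨j3 i (hH i), k3 i (hH i)⟩))
    simpa only [hD, neg_one_mul, ← sub_eq_add_neg] using h2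
  have hDi : ∀ i, Integrable (D i) := fun i => (hD' i).1
  -- A nonintegrable density has integral `0` by convention, so the bound is trivial in that case.
  by_cases hint : Integrable (energyDensity G l χ F (fun p => V p + K p)
      (fun i p => H i p - weakGrad G p.1 i * F p))
  swap
  · rw [integral_undef hint]
  have h0 : ∫ p, ∑ i, D i p = 0 := by
    rw [integral_finsetSum _ fun i _ => hDi i]
    exact Finset.sum_eq_zero fun i _ => (hD' i).2
  rw [← h0]
  refine integral_mono hint (integrable_finsetSum _ fun i _ => hDi i) fun p => ?_
  have hχd := hχ.differentiable
  have hFd : Differentiable ℝ F := hF.differentiable (by simp)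
  have hm : ∀ {u : Phase d → ℝ} (e : Phase d), ContDiff ℝ ∞ u →
      pd e (fun q => χ q * χ q * (F q * u q)) p = (pd e χ p * χ p + χ p * pd e χ p) * (F p * u p) +
      χ p * χ p * (pd e F p * u p + F p * pd e u p) := fun {u} e hu => by
    have hud : Differentiable ℝ u := hu.differentiable (by simp)
    have hFu : Differentiable ℝ fun q => F q * u q := hFd.mul hud
    rw [pd_mul hχχ.differentiable hFu, pd_mul hχd hχd, pd_mul hFd hud]
  simp only [hD, hm _ hF, hm _ (hFi _), hm _ (hH _)]
  have hP := hPDE p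
  have key : ∀ i ∈ Finset.univ, F p ^ 2 * (χ p * (p.2 i * pd (ex i) χ p - weakGrad G p.1 i * pd (ev i) χ p)
      - pd (ev i) χ p ^ 2) - (1 / 4 * χ p ^ 2 * (H i p - weakGrad G p.1 i * F p) *
        (H i p - weakGrad G p.1 i * F p) +
        χ p * pd (ev i) χ p * F p * (H i p - weakGrad G p.1 i * F p)) ≤
      1 / 2 * (p.2 i * ((pd (ex i) χ p * χ p + χ p * pd (ex i) χ p) * (F p * F p) +
        χ p * χ p * (pd (ex i) F p * F p + F p * pd (ex i) F p))) +
      1 / 2 * (weakGrad G p.1 i * ((pd (ev i) χ p * χ p + χ p * pd (ev i) χ p) * (F p * F p) +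
        χ p * χ p * (pd (ev i) F p * F p + F p * pd (ev i) F p))) +
      (1 * ((pd (ev i) χ p * χ p + χ p * pd (ev i) χ p) * (F p * pd (ev i) F p) +
        χ p * χ p * (pd (ev i) F p * pd (ev i) F p + F p * pd (ev i) (pd (ev i) F) p)) -
      1 * ((pd (ev i) χ p * χ p + χ p * pd (ev i) χ p) * (F p * H i p) +
        χ p * χ p * (pd (ev i) F p * H i p + F p * pd (ev i) (H i) p))) +
      χ p ^ 2 * F p * (-(p.2 i * pd (ex i) F p) + pd (ev i) (H i) p - pd (ev i) (pd (ev i) F) p) :=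
    fun i _ => by
    -- The difference of the two sides is exactly this square, which completes the gradient
    -- `∂_{v_i}(χ F)` with the error term.
    linarith [sq_nonneg (χ p * pd (ev i) F p + pd (ev i) χ p * F p -
      χ p * (H i p - weakGrad G p.1 i * F p) / 2)]
  have hsum := Finset.sum_le_sum key
  have e1 : ∀ (a b : ℝ) (x y z w : Fin d → ℝ), ∑ i, (a * (b * (x i - y i) - z i) - w i) =
      a * (b * (∑ i, x i - ∑ i, y i) - ∑ i, z i) - ∑ i, w i := fun a b x y z w => by
    rw [Finset.sum_sub_distrib, ← Finset.mul_sum, Finset.sum_sub_distrib, ← Finset.mul_sum,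
      Finset.sum_sub_distrib]
  have e2 : ∀ (a : ℝ) (x y z w : Fin d → ℝ), ∑ i, (w i + a * (-x i + y i - z i)) =
      ∑ i, w i + a * (-∑ i, x i + ∑ i, y i - ∑ i, z i) := fun a x y z w => by
    rw [Finset.sum_add_distrib, ← Finset.mul_sum, Finset.sum_sub_distrib, Finset.sum_add_distrib,
      Finset.sum_neg_distrib]
  rw [e1, e2] at hsum
  simp only [energyDensity, transport]
  linear_combination hsum + (χ p ^ 2 * F p) * hP

end Energy

/-! ### Convergence in `L²` and products -/

section SquareIntegrableLimits

variable {Ω : Type*} [MeasurableSpace Ω] {μ : Measure Ω} {u w : ℕ → Ω → ℝ} {u₀ w₀ : Ω → ℝ}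

/-- Convergence in `L²(μ)`. -/
structure L2Conv (μ : Measure Ω) (u : ℕ → Ω → ℝ) (u₀ : Ω → ℝ) : Prop where
  memLp : ∀ n, MemLp (u n) 2 μ
  memLp_lim : MemLp u₀ 2 μ
  tendsto : Tendsto (fun n => eLpNorm (fun p => u n p - u₀ p) 2 μ) atTop (𝓝 0)

lemma L2Conv.add (h : L2Conv μ u u₀) (h' : L2Conv μ w w₀) :
    L2Conv μ (fun n p => u n p + w n p) fun p => u₀ p + w₀ p where
  memLp n := (h.memLp n).add (h'.memLp n)
  memLp_lim := h.memLp_lim.add h'.memLp_lim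
  tendsto := by
    have h1 := h.tendsto.add h'.tendsto
    rw [add_zero] at h1
    refine tendsto_of_tendsto_of_tendsto_of_le_of_le tendsto_const_nhds h1 (fun _ => zero_le)
      fun n => ?_
    have e : (fun p => u n p + w n p - (u₀ p + w₀ p)) =
        (fun p => u n p - u₀ p) + fun p => w n p - w₀ p := by
      funext p; simp only [Pi.add_apply]; ring
    simp only [e]
    exact eLpNorm_add_le ((h.memLp n).1.sub h.memLp_lim.1) ((h'.memLp n).1.sub h'.memLp_lim.1)
      one_le_two

lemma L2Conv.mul_left (h : L2Conv μ u u₀) {c : Ω → ℝ} (hc : AEStronglyMeasurable c μ) {M : ℝ}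
    (hM : ∀ᵐ p ∂μ, |c p| ≤ M) : L2Conv μ (fun n p => c p * u n p) fun p => c p * u₀ p where
  memLp n := (h.memLp n).of_le_mul (c := M) (hc.mul (h.memLp n).1) (hM.mono fun p hp => by
    rw [norm_mul]
    exact mul_le_mul_of_nonneg_right hp (norm_nonneg _))
  memLp_lim := h.memLp_lim.of_le_mul (c := M) (hc.mul h.memLp_lim.1) (hM.mono fun p hp => by
    rw [norm_mul]
    exact mul_le_mul_of_nonneg_right hp (norm_nonneg _))
  tendsto := by
    have h1 := ENNReal.Tendsto.const_mul (a := ENNReal.ofReal M) h.tendsto (Or.inr (by simp))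
    rw [mul_zero] at h1
    refine tendsto_of_tendsto_of_tendsto_of_le_of_le tendsto_const_nhds h1 (fun _ => zero_le)
      fun n => ?_
    refine eLpNorm_le_mul_eLpNorm_of_ae_le_mul (hM.mono fun p hp => ?_) 2
    rw [← mul_sub, norm_mul]
    exact mul_le_mul_of_nonneg_right hp (norm_nonneg _)

lemma L2Conv.congr {u' : ℕ → Ω → ℝ} {u₀' : Ω → ℝ} (h : L2Conv μ u u₀)
    (hu : ∀ n, ∀ᵐ p ∂μ, u n p = u' n p) (hu₀ : ∀ᵐ p ∂μ, u₀ p = u₀' p) : L2Conv μ u' u₀' where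
  memLp n := (h.memLp n).ae_eq (hu n)
  memLp_lim := h.memLp_lim.ae_eq hu₀
  tendsto := h.tendsto.congr fun n => eLpNorm_congr_ae (by
    filter_upwards [hu n, hu₀] with p h1 h2
    rw [h1, h2])

lemma L2Conv.tendsto_integral_mul (h : L2Conv μ u u₀) (h' : L2Conv μ w w₀) :
    Tendsto (fun n => ∫ p, u n p * w n p ∂μ) atTop (𝓝 (∫ p, u₀ p * w₀ p ∂μ)) := by
  have key : ∀ {a b : Ω → ℝ} (ha : MemLp a 2 μ) (hb : MemLp b 2 μ),
      ⟪ha.toLp a, hb.toLp b⟫_ℝ = ∫ p, a p * b p ∂μ := fun {a b} ha hb => by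
    rw [L2.inner_def]
    refine integral_congr_ae ?_
    filter_upwards [ha.coeFn_toLp, hb.coeFn_toLp] with p h1 h2
    simp [h1, h2, mul_comm]
  have hT : ∀ {u : ℕ → Ω → ℝ} {u₀ : Ω → ℝ} (h : L2Conv μ u u₀),
      Tendsto (fun n => (h.memLp n).toLp (u n)) atTop (𝓝 (h.memLp_lim.toLp u₀)) := fun h =>
    (Lp.tendsto_Lp_iff_tendsto_eLpNorm'' _ h.memLp _ h.memLp_lim).2 h.tendsto
  have := (hT h).inner (𝕜 := ℝ) (hT h')
  simpa only [key] using this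

lemma L2Conv.integrable_mul (h : L2Conv μ u u₀) (h' : L2Conv μ w w₀) (n : ℕ) :
    Integrable (fun p => u n p * w n p) μ := (h.memLp n).integrable_mul (h'.memLp n)

end SquareIntegrableLimits

/-! ### Anisotropic mollifiers -/

section KineticMollifiers

variable {d : ℕ}

lemma isMollifier_prod {a b : E d → ℝ} {r s : ℝ} (ha : IsMollifier a r) (hb : IsMollifier b s)
    (hs : s ≤ r) : IsMollifier (fun p : Phase d => a p.1 * b p.2) r := by
  have hz : ∀ p : Phase d, r ≤ ‖p‖ → a p.1 * b p.2 = 0 := fun p hp => by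
    rcases le_max_iff.1 (hp.trans_eq (Prod.norm_def p)) with h | h
    · rw [ha.eq_zero _ h, zero_mul]
    · rw [hb.eq_zero _ (hs.trans h), mul_zero]
  refine ⟨⟨(ha.isTest.1.comp contDiff_fst).mul (hb.isTest.1.comp contDiff_snd), ?_⟩,
    fun p => mul_nonneg (ha.nonneg _) (hb.nonneg _), ?_, hz⟩
  · refine HasCompactSupport.of_support_subset_isCompact
      (isCompact_closedBall (0 : Phase d) r) fun p hp => ?_
    by_contra h
    rw [mem_closedBall_zero_iff, not_le] at h
    exact hp (hz p h.le)
  · rw [Measure.volume_eq_prod, integral_prod_mul, ha.integral_eq, hb.integral_eq, one_mul]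

lemma commKernel_prod {a b : E d → ℝ} (ha : IsTest a) (hb : IsTest b) (q : Phase d) :
    commKernel (fun p : Phase d => a p.1 * b p.2) q =
      ∑ i, q.2 i * (pd (EuclideanSpace.single i 1) a q.1 * b q.2) := by
  refine Finset.sum_congr rfl fun i _ => ?_
  have h1 : Differentiable ℝ fun p : Phase d => a p.1 := ha.differentiable.comp differentiable_fst
  have h2 : Differentiable ℝ fun p : Phase d => b p.2 := hb.differentiable.comp differentiable_snd
  rw [pd_mul h1 h2, pd_comp_fst ha.differentiable, pd_comp_snd hb.differentiable]
  simp only [ex, pd_zero, mul_zero, add_zero]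

/-- The factor `vᵢ` is at most `s` in absolute value on the support of `b`, while the `x`
derivatives of `a` do not depend on `s`. Narrowing `b` alone makes the commutator small. -/
lemma lintegral_commKernel_prod_le {a b : E d → ℝ} {s : ℝ} (ha : IsTest a) (hb : IsMollifier b s) :
    ∫⁻ q : Phase d, ‖commKernel (fun p : Phase d => a p.1 * b p.2) q‖ₑ ≤
      ENNReal.ofReal (s * ∑ i, ∫ x, |pd (EuclideanSpace.single i (1 : ℝ)) a x|) := by
  have hai : ∀ i : Fin d, Integrable fun x => |pd (EuclideanSpace.single i (1 : ℝ)) a x| := fun i =>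
    (ha.pd.continuous.integrable_of_hasCompactSupport ha.pd.2).abs
  have hbi : Integrable b := hb.isTest.continuous.integrable_of_hasCompactSupport hb.isTest.2
  have hi : ∀ i : Fin d, Integrable fun q : Phase d =>
      s * (|pd (EuclideanSpace.single i (1 : ℝ)) a q.1| * b q.2) := fun i => by
    have := ((hai i).mul_prod hbi).const_mul s
    exact this
  have hle : ∀ q : Phase d, ‖commKernel (fun p : Phase d => a p.1 * b p.2) q‖ₑ ≤
      ENNReal.ofReal (∑ i, s * (|pd (EuclideanSpace.single i (1 : ℝ)) a q.1| * b q.2)) := fun q => by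
    rw [← ofReal_norm]
    refine ENNReal.ofReal_le_ofReal ?_
    rw [commKernel_prod ha hb.isTest]
    refine (norm_sum_le _ _).trans (Finset.sum_le_sum fun i _ => ?_)
    rw [norm_mul, norm_mul, Real.norm_of_nonneg (hb.nonneg _)]
    by_cases h : s ≤ ‖q.2‖
    · simp [hb.eq_zero _ h]
    · exact mul_le_mul_of_nonneg_right ((PiLp.norm_apply_le q.2 i).trans (not_le.1 h).le)
        (mul_nonneg (norm_nonneg _) (hb.nonneg _))
  refine (lintegral_mono hle).trans ?_
  rw [← ofReal_integral_eq_lintegral_ofReal (integrable_finsetSum _ fun i _ => hi i)]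
  · rw [integral_finsetSum _ fun i _ => hi i, Finset.mul_sum]
    refine ENNReal.ofReal_le_ofReal (Finset.sum_le_sum fun i _ => le_of_eq ?_)
    rw [integral_const_mul, Measure.volume_eq_prod,
      integral_prod_mul (fun x => |pd (EuclideanSpace.single i (1 : ℝ)) a x|) b, hb.integral_eq,
      mul_one]
  · refine ae_of_all _ fun q => Finset.sum_nonneg fun i _ => ?_
    by_cases h : s ≤ ‖q.2‖
    · simp [hb.eq_zero _ h]
    · exact mul_nonneg ((norm_nonneg _).trans (not_le.1 h).le)
        (mul_nonneg (abs_nonneg _) (hb.nonneg _))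

/-- Mollifiers on phase space that are much narrower in velocity than in position, so that they
asymptotically commute with `v·∇_x`. -/
lemma exists_kinetic_mollifier {r : ℝ} (hr : 0 < r) : ∃ k : Phase d → ℝ, IsMollifier k r ∧
    ∫⁻ q, ‖commKernel k q‖ₑ ≤ ENNReal.ofReal r := by
  have hex : ∀ s : ℝ, 0 < s → ∃ a : E d → ℝ, IsMollifier a s := fun s hs =>
    ⟨_, ContDiffBump.isMollifier (⟨s / 2, s, half_pos hs, half_lt_self hs⟩ : ContDiffBump (0 : E d))⟩
  obtain ⟨a, ha⟩ := hex r hr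
  set C : ℝ := ∑ i, ∫ x, |pd (EuclideanSpace.single i (1 : ℝ)) a x| with hC
  have hC0 : 0 ≤ C := Finset.sum_nonneg fun i _ => integral_nonneg fun x => abs_nonneg _
  have hs : 0 < r / (1 + C) := by positivity
  -- With velocity width `r / (1 + C)` the commutator kernel has `L¹` norm at most `C r / (1 + C) ≤
  -- r`.
  obtain ⟨b, hb⟩ := hex _ hs
  refine ⟨_, isMollifier_prod ha hb (div_le_self hr.le (by linarith)),
    (lintegral_commKernel_prod_le ha.isTest hb).trans (ENNReal.ofReal_le_ofReal ?_)⟩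
  rw [← hC, div_mul_eq_mul_div, div_le_iff₀ (by positivity)]
  nlinarith

end KineticMollifiers

/-! ### The energy inequality for distributional solutions -/

section EnergyLimit

variable {d : ℕ} {G : E d → ℝ} {h : Phase d → ℝ} {k : ℕ → Phase d → ℝ} {r : ℕ → ℝ}

lemma memLp_cv {k u : Phase d → ℝ} (hk : IsTest k) (hu : MemLp u 2 volume) :
    MemLp (cv k u) 2 volume := by
  refine ⟨(contDiff_cv hk (hu.locallyIntegrable one_le_two)).continuous.aestronglyMeasurable,
    (eLpNorm_cv_le hk.continuous hu.1).trans_lt (ENNReal.mul_lt_top ?_ hu.2)⟩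
  exact (hk.continuous.integrable_of_hasCompactSupport hk.2).2

lemma LocBdd.memLp_indicator_mul {c : Phase d → ℝ} (hc : LocBdd c) (hh : MemLp h 2 volume) (R : ℝ) :
    MemLp ((Metric.closedBall (0 : Phase d) R).indicator fun p => c p * h p) 2 volume := by
  obtain ⟨M, hM⟩ := hc.2 R
  refine hh.of_le_mul (c := |M|)
    ((hc.1.mul hh.1).indicator Metric.isClosed_closedBall.measurableSet) (hM.mono fun p hp => ?_)
  by_cases hm : p ∈ Metric.closedBall (0 : Phase d) R
  · rw [indicator_of_mem hm, norm_mul]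
    exact mul_le_mul_of_nonneg_right ((hp (mem_closedBall_zero_iff.1 hm)).trans (le_abs_self M))
      (norm_nonneg _)
  · rw [indicator_of_notMem hm, norm_zero]
    positivity

/-- The product `c h` may fail to be globally square integrable, but on the ball of radius `R` its
mollification depends only on the truncation to radius `R + 1`. -/
lemma l2Conv_cv_mul (hk : ∀ n, IsMollifier (k n) (r n)) (hr : Tendsto r atTop (𝓝 0))
    (hr1 : ∀ n, r n ≤ 1) (hh : MemLp h 2 volume) {c : Phase d → ℝ} (hc : LocBdd c) (R : ℝ) :
    L2Conv (volume.restrict (Metric.closedBall (0 : Phase d) R))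
      (fun n => cv (k n) fun p => c p * h p) fun p => c p * h p := by
  set u := (Metric.closedBall (0 : Phase d) (R + 1)).indicator fun p => c p * h p with hu
  have hum : MemLp u 2 volume := hc.memLp_indicator_mul hh _
  have h1 : L2Conv (volume.restrict (Metric.closedBall (0 : Phase d) R))
      (fun n => cv (k n) u) u := by
    refine ⟨fun n => (memLp_cv (hk n).isTest hum).restrict _, hum.restrict _, ?_⟩
    exact tendsto_of_tendsto_of_tendsto_of_le_of_le tendsto_const_nhds
      (tendsto_eLpNorm_cv_sub hk hr hum) (fun _ => zero_le)
      fun n => eLpNorm_mono_measure _ Measure.restrict_le_self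
  have hmem := ae_restrict_mem (μ := (volume : Measure (Phase d)))
    (Metric.isClosed_closedBall (x := (0 : Phase d)) (ε := R)).measurableSet
  refine h1.congr (fun n => hmem.mono fun p hp => ?_) (hmem.mono fun p hp => ?_)
  · simp only [cv]
    refine integral_congr_ae (ae_of_all _ fun q => ?_)
    simp only
    by_cases hq : r n ≤ ‖p - q‖
    · rw [(hk n).eq_zero _ hq, zero_mul, zero_mul]
    · rw [hu, indicator_of_mem]
      rw [mem_closedBall_zero_iff] at hp ⊢
      have h2 : ‖q‖ ≤ ‖p‖ + ‖p - q‖ := by simpa using norm_sub_le p (p - q)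
      linarith [hr1 n, not_le.1 hq]
  · rw [hu, indicator_of_mem (Metric.closedBall_subset_closedBall (by linarith) hp)]

/-- The localized energy inequality for distributional solutions `h ∈ L²`. -/
lemma integral_energy_nonpos (hG : AssumptionA1 G) {l : ℝ} (hh : MemLp h 2 volume)
    (hT : ∀ ψ, IsTest ψ → ∫ q, h q * conjOp G l ψ q = 0) {χ : Phase d → ℝ} (hχ : IsTest χ) :
    ∫ p, ((l - d / 2 + ‖p.2‖ ^ 2 / 4) * χ p ^ 2 + χ p * transport G χ p -
      ∑ i, pd (ev i) χ p ^ 2) * h p ^ 2 ≤ 0 := by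
  have hr0 : ∀ n : ℕ, 0 < 1 / ((n : ℝ) + 1) := fun n => Nat.one_div_pos_of_nat
  choose k hk hκ using fun n => exists_kinetic_mollifier (d := d) (hr0 n)
  have hr : Tendsto (fun n : ℕ => 1 / ((n : ℝ) + 1)) atTop (𝓝 0) :=
    tendsto_one_div_add_atTop_nhds_zero_nat
  have hr1 : ∀ n : ℕ, 1 / ((n : ℝ) + 1) ≤ 1 := fun n => by
    rw [div_le_one (by positivity)]; linarith [Nat.cast_nonneg (α := ℝ) n]
  obtain ⟨R, hR⟩ := hχ.2.isCompact.isBounded.subset_closedBall (0 : Phase d)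
  set B := Metric.closedBall (0 : Phase d) R with hB
  have hBm : MeasurableSet B := Metric.isClosed_closedBall.measurableSet
  set μ := (volume : Measure (Phase d)).restrict B with hμ
  have hhl : LocallyIntegrable h volume := hh.locallyIntegrable one_le_two
  have cF : L2Conv μ (fun n => cv (k n) h) h := by
    simpa using l2Conv_cv_mul hk hr hr1 hh (LocBdd.const 1) R
  have cV : L2Conv μ (fun n => cv (k n) fun p => ‖p.2‖ ^ 2 / 4 * h p) fun p => ‖p.2‖ ^ 2 / 4 * h p :=
    l2Conv_cv_mul hk hr hr1 hh
      (LocBdd.of_continuous (c := fun p : Phase d => ‖p.2‖ ^ 2 / 4) (by fun_prop)) R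
  have cH : ∀ i, L2Conv μ (fun n => cv (k n) fun p : Phase d => weakGrad G p.1 i * h p)
      fun p : Phase d => weakGrad G p.1 i * h p := fun i =>
    l2Conv_cv_mul hk hr hr1 hh (hG.locBdd_weakGrad i).comp_fst R
  -- Young's inequality: the commutator kernels have `L¹` norm at most `1 / (n + 1)`.
  have cK : L2Conv μ (fun n => cv (commKernel (k n)) h) fun _ => 0 := by
    refine ⟨fun n => (memLp_cv (isTest_commKernel (hk n).isTest) hh).restrict _, MemLp.zero', ?_⟩
    have h1 : Tendsto (fun n : ℕ => ENNReal.ofReal (1 / ((n : ℝ) + 1)) * eLpNorm h 2 volume) atTop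
        (𝓝 0) := by
      have := ENNReal.Tendsto.mul_const (b := eLpNorm h 2 volume) (ENNReal.tendsto_ofReal hr)
        (Or.inr hh.2.ne)
      simpa using this
    refine tendsto_of_tendsto_of_tendsto_of_le_of_le tendsto_const_nhds h1 (fun _ => zero_le)
      fun n => ?_
    simp only [sub_zero]
    exact (eLpNorm_mono_measure _ Measure.restrict_le_self).trans
      ((eLpNorm_cv_le (isTest_commKernel (hk n).isTest).continuous hh.1).trans
        (mul_le_mul_left (hκ n) _))
  have mulc : ∀ {c : Phase d → ℝ}, LocBdd c → ∀ {u : ℕ → Phase d → ℝ} {u₀ : Phase d → ℝ},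
      L2Conv μ u u₀ → L2Conv μ (fun n p => c p * u n p) fun p => c p * u₀ p := fun {c} hc _ _ hu => by
    obtain ⟨M, hM⟩ := hc.2 R
    refine hu.mul_left (M := M) hc.1.restrict ?_
    filter_upwards [ae_restrict_of_ae hM, ae_restrict_mem hBm] with p h1 h2
    exact h1 (mem_closedBall_zero_iff.1 h2)
  -- Mollifying the product with `∂ᵢG` and multiplying the mollification by `∂ᵢG` have the same
  -- limit, so no derivative of `∇G` is ever needed.
  have ce : ∀ i, L2Conv μ (fun n p => cv (k n) (fun p : Phase d => weakGrad G p.1 i * h p) p -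
      weakGrad G p.1 i * cv (k n) h p) fun _ => 0 := fun i => by
    have h1 := (cH i).add (mulc (hG.locBdd_weakGrad i).comp_fst.neg cF)
    exact h1.congr (fun n => ae_of_all _ fun p => by ring) (ae_of_all _ fun p => by ring)
  have cW := cV.add cK
  have bχ : LocBdd χ := LocBdd.of_continuous hχ.continuous
  have bχ2 : LocBdd fun p => χ p ^ 2 := LocBdd.of_continuous (hχ.continuous.pow 2)
  have bm : LocBdd fun p => (l - d / 2) * χ p ^ 2 + χ p * transport G χ p -
      ∑ i, pd (ev i) χ p ^ 2 :=
    (((LocBdd.const _).mul bχ2).add (bχ.mul (locBdd_transport hG hχ.1))).sub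
      (LocBdd.sum fun i _ => LocBdd.of_continuous (hχ.pd.continuous.pow 2))
  have c1 := mulc bm cF
  have c2 := mulc bχ2 cF
  have c3 := fun i => mulc ((LocBdd.const (1 / 4)).mul bχ2) (ce i)
  have c4 := fun i => mulc (bχ.mul (locBdd_pd hχ.1 (ev i))) cF
  have hn : ∀ n, ∫ p, energyDensity G (l - d / 2) χ (cv (k n) h)
      (fun p => cv (k n) (fun p => ‖p.2‖ ^ 2 / 4 * h p) p + cv (commKernel (k n)) h p)
      (fun i p => cv (k n) (fun p : Phase d => weakGrad G p.1 i * h p) p -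
        weakGrad G p.1 i * cv (k n) h p) p ∂μ ≤ 0 := fun n => by
    have h1 := integral_energyDensity_nonpos hG (contDiff_cv (hk n).isTest hhl)
      (fun i => contDiff_cv (hk n).isTest
        ((hG.locBdd_weakGrad i).comp_fst.mul_locallyIntegrable hhl)) hχ
      (regularized_eq hG hhl hT (hk n).isTest)
    rwa [← setIntegral_eq_integral_of_forall_compl_eq_zero (s := B)] at h1
    intro p hp
    have hp' : ¬ ‖p‖ ≤ R := fun h => hp (mem_closedBall_zero_iff.2 h)
    simp [energyDensity, (eq_zero_of_norm_gt hR hp' _).2, (eq_zero_of_norm_gt hR hp' 0).1]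
  -- Every product is a pairing of two `L²` convergent factors. The commutator and the differences
  -- `ce` tend to zero, so only the quadratic terms in `h` survive.
  have hlim := ((c1.tendsto_integral_mul cF).add (c2.tendsto_integral_mul cW)).sub
    (tendsto_finsetSum Finset.univ fun i _ => ((c3 i).tendsto_integral_mul (ce i)).add
      ((c4 i).tendsto_integral_mul (ce i)))
  have hle := le_of_tendsto' (b := 0) hlim fun n => by
    refine le_trans (le_of_eq ?_) (hn n)
    simp only [energyDensity]
    have i1 := (c1.integrable_mul cF n).add (c2.integrable_mul cW n)
    have i2 := fun i => ((c3 i).integrable_mul (ce i) n).add ((c4 i).integrable_mul (ce i) n)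
    refine Eq.trans ?_ (integral_sub i1 (integrable_finsetSum Finset.univ fun i _ => i2 i)).symm
    refine congrArg₂ _ ?_ (Eq.trans (Finset.sum_congr rfl fun i _ => ?_)
      (integral_finsetSum _ fun i _ => i2 i).symm)
    · exact (integral_add (c1.integrable_mul cF n) (c2.integrable_mul cW n)).symm
    · exact (integral_add ((c3 i).integrable_mul (ce i) n) ((c4 i).integrable_mul (ce i) n)).symm
  simp only [mul_zero, integral_zero, add_zero, Finset.sum_const_zero, sub_zero] at hle
  have i1 : Integrable (fun p => ((l - d / 2) * χ p ^ 2 + χ p * transport G χ p -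
      ∑ i, pd (ev i) χ p ^ 2) * h p * h p) μ := c1.memLp_lim.integrable_mul cF.memLp_lim
  have i2 : Integrable (fun p => χ p ^ 2 * h p * (‖p.2‖ ^ 2 / 4 * h p)) μ :=
    c2.memLp_lim.integrable_mul cV.memLp_lim
  rw [← integral_add i1 i2] at hle
  rw [← setIntegral_eq_integral_of_forall_compl_eq_zero (s := B)]
  · refine (integral_congr_ae (ae_of_all _ fun p => ?_)).trans_le hle
    ring
  · intro p hp
    have hp' : ¬ ‖p‖ ≤ R := fun h => hp (mem_closedBall_zero_iff.2 h)
    simp [(eq_zero_of_norm_gt hR hp' _).2, (eq_zero_of_norm_gt hR hp' 0).1]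

end EnergyLimit

/-! ### Cutoff functions -/

section Cutoff

variable {d : ℕ}

/-- Cutoff functions with a small gradient. -/
lemma exists_cutoff (d : ℕ) (N : ℝ) {ε : ℝ} (hε : 0 < ε) : ∃ a : E d → ℝ, IsTest a ∧
    (∀ x, 0 ≤ a x ∧ a x ≤ 1) ∧ (∀ x, ‖x‖ ≤ N → a x = 1) ∧
    ∀ (i : Fin d) x, |pd (EuclideanSpace.single i (1 : ℝ)) a x| ≤ ε := by
  let b : ContDiffBump (0 : E d) := ⟨1, 2, one_pos, one_lt_two⟩
  have hb : IsTest (b : E d → ℝ) := ⟨b.contDiff, b.hasCompactSupport⟩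
  choose C hC using fun i : Fin d => (hb.pd (e := EuclideanSpace.single i (1 : ℝ))).continuous.bounded_above_of_compact_support
    (hb.pd (e := EuclideanSpace.single i (1 : ℝ))).2
  have hC0 : ∀ i, 0 ≤ C i := fun i => (norm_nonneg _).trans (hC i 0)
  -- The dilation exceeds `|N|`, so the ball of radius `N` lands in the unit ball, and exceeds `(∑ C
  -- i) / ε`, which bounds the partial derivatives by `ε`.
  set s : ℝ := 1 + |N| + (∑ i, C i) / ε with hs
  have hsC : 0 ≤ (∑ i, C i) / ε := div_nonneg (Finset.sum_nonneg fun i _ => hC0 i) hε.le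
  have hs0 : 0 < s := by positivity
  have hlin : ContDiff ℝ ∞ fun x : E d => s⁻¹ • x := contDiff_const_smul _
  refine ⟨fun x => b (s⁻¹ • x), ⟨hb.1.comp hlin, ?_⟩, fun x => ⟨b.nonneg, b.le_one⟩, fun x hx => ?_,
    fun i x => ?_⟩
  · exact hb.2.comp_homeomorph (Homeomorph.smulOfNeZero s⁻¹ (inv_ne_zero hs0.ne'))
  · refine b.one_of_mem_closedBall ?_
    rw [mem_closedBall_zero_iff, norm_smul, norm_inv, Real.norm_of_nonneg hs0.le,
      inv_mul_le_iff₀ hs0]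
    change ‖x‖ ≤ s * 1
    linarith [le_abs_self N]
  · have h1 : pd (EuclideanSpace.single i (1 : ℝ)) (fun x => b (s⁻¹ • x)) x =
        s⁻¹ * pd (EuclideanSpace.single i (1 : ℝ)) b (s⁻¹ • x) := by
      have h2 : HasFDerivAt (fun x : E d => b (s⁻¹ • x)) ((fderiv ℝ b (s⁻¹ • x)).comp
          (s⁻¹ • ContinuousLinearMap.id ℝ (E d))) x :=
        (hb.differentiable _).hasFDerivAt.comp x ((hasFDerivAt_id x).const_smul s⁻¹)
      simp [pd, h2.fderiv]
    rw [h1, abs_mul, abs_of_pos (inv_pos.2 hs0), inv_mul_le_iff₀ hs0]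
    refine (hC i _).trans ((Finset.single_le_sum (fun j _ => hC0 j) (Finset.mem_univ i)).trans ?_)
    rw [← div_le_iff₀ hε]
    linarith [abs_nonneg N]

end Cutoff

/-! ### Triviality of the orthogonal complement of the range -/

section Uniqueness

variable {d : ℕ} {G : E d → ℝ} {h : Phase d → ℝ}

/-- The energy inequality is used with `χ = a(x) ζ(v)`. Since `l - d/2 ≥ 1`, its coefficient is at
least `χ² - 3dε`: the unbounded term `v·∇_x χ` is absorbed by `‖v‖² χ² / 4`, and the term with `∇G`
by choosing `ζ` after `a`. -/
lemma integral_ball_sq_le (hG : AssumptionA1 G) {l : ℝ} (hl : d / 2 + 1 ≤ l) (hh : MemLp h 2 volume)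
    (hT : ∀ ψ, IsTest ψ → ∫ q, h q * conjOp G l ψ q = 0) (N : ℝ) {ε : ℝ} (hε : 0 < ε) (hε1 : ε ≤ 1) :
    ∫ p in Metric.closedBall (0 : Phase d) N, h p ^ 2 ≤ 3 * d * ε * ∫ p, h p ^ 2 := by
  obtain ⟨a, ha, ha01, ha1, had⟩ := exists_cutoff d N hε
  obtain ⟨Ra, hRa⟩ := ha.2.isCompact.isBounded.subset_closedBall (0 : E d)
  choose M hM0 hM using fun i => (hG.locBdd_weakGrad i).exists_nonneg Ra
  have hMs : ∀ i, M i ≤ ∑ i, M i := fun i =>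
    Finset.single_le_sum (fun j _ => hM0 j) (Finset.mem_univ i)
  have hM1 : 0 ≤ ∑ i, M i := Finset.sum_nonneg fun i _ => hM0 i
  -- `∇G` is bounded on the support of `a` by constants `M i` that may be huge; the velocity cutoff
  -- is flattened accordingly.
  have hδ : 0 < ε / (1 + ∑ i, M i) := by positivity
  obtain ⟨ζ, hζ, hζ01, hζ1, hζd⟩ := exists_cutoff d N hδ
  set χ : Phase d → ℝ := fun p => a p.1 * ζ p.2 with hχdef
  have d1 : Differentiable ℝ fun p : Phase d => a p.1 := ha.differentiable.comp differentiable_fst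
  have d2 : Differentiable ℝ fun p : Phase d => ζ p.2 := hζ.differentiable.comp differentiable_snd
  have hχ : IsTest χ := by
    refine ⟨(ha.1.comp contDiff_fst).mul (hζ.1.comp contDiff_snd), ?_⟩
    refine HasCompactSupport.of_support_subset_isCompact (ha.2.isCompact.prod hζ.2.isCompact)
      fun p hp => ⟨subset_tsupport _ fun h0 => hp ?_, subset_tsupport _ fun h0 => hp ?_⟩
    · simp [hχdef, h0]
    · simp [hχdef, h0]
  have hx : ∀ i p, pd (ex i) χ p = pd (EuclideanSpace.single i 1) a p.1 * ζ p.2 := fun i p => by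
    rw [hχdef, pd_mul d1 d2, pd_comp_fst ha.differentiable, pd_comp_snd hζ.differentiable]
    simp only [ex, pd_zero, mul_zero, add_zero]
  have hv : ∀ i p, pd (ev i) χ p = a p.1 * pd (EuclideanSpace.single i 1) ζ p.2 := fun i p => by
    rw [hχdef, pd_mul d1 d2, pd_comp_fst ha.differentiable, pd_comp_snd hζ.differentiable]
    simp only [ev, pd_zero, zero_mul, zero_add]
  have hχ01 : ∀ p, 0 ≤ χ p ∧ χ p ≤ 1 := fun p =>
    ⟨mul_nonneg (ha01 _).1 (hζ01 _).1, mul_le_one₀ (ha01 _).2 (hζ01 _).1 (hζ01 _).2⟩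
  set c : Phase d → ℝ := fun p => (l - d / 2 + ‖p.2‖ ^ 2 / 4) * χ p ^ 2 + χ p * transport G χ p -
      ∑ i, pd (ev i) χ p ^ 2 with hc
  have hcb : LocBdd c :=
    ((((LocBdd.of_continuous (c := fun p : Phase d => l - d / 2 + ‖p.2‖ ^ 2 / 4) (by fun_prop))).mul
      (LocBdd.of_continuous (hχ.continuous.pow 2))).add ((LocBdd.of_continuous hχ.continuous).mul
        (locBdd_transport hG hχ.1))).sub
      (LocBdd.sum fun i _ => LocBdd.of_continuous (hχ.pd.continuous.pow 2))
  obtain ⟨R, hR⟩ := hχ.2.isCompact.isBounded.subset_closedBall (0 : Phase d)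
  have hci : Integrable fun p => c p * h p ^ 2 := by
    refine ((hcb.memLp_indicator_mul hh R).integrable_mul hh).congr (ae_of_all _ fun p => ?_)
    simp only [Pi.mul_apply]
    by_cases hm : p ∈ Metric.closedBall (0 : Phase d) R
    · rw [indicator_of_mem hm]; ring
    · have hp' : ¬ ‖p‖ ≤ R := fun h => hm (mem_closedBall_zero_iff.2 h)
      rw [indicator_of_notMem hm]
      simp [hc, (eq_zero_of_norm_gt hR hp' _).2, (eq_zero_of_norm_gt hR hp' 0).1]
  have hle : ∀ᵐ p : Phase d, χ p ^ 2 - 3 * d * ε ≤ c p := by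
    filter_upwards [ae_all_iff.2 fun i => ae_comp_fst (hM i)] with p hp
    have hterm : ∀ i ∈ Finset.univ, -(3 * ε) ≤ p.2 i ^ 2 / 4 * χ p ^ 2 + χ p * (p.2 i * pd (ex i) χ p -
        weakGrad G p.1 i * pd (ev i) χ p) - pd (ev i) χ p ^ 2 := fun i _ => by
      have b1 : |pd (ex i) χ p| ≤ ε := by
        rw [hx, abs_mul, abs_of_nonneg (hζ01 _).1]
        exact (mul_le_of_le_one_right (abs_nonneg _) (hζ01 _).2).trans (had i _)
      have b2' : |pd (EuclideanSpace.single i (1 : ℝ)) ζ p.2| * (1 + ∑ i, M i) ≤ ε := by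
        rw [← le_div_iff₀ (by positivity)]; exact hζd i _
      have b2 : |pd (ev i) χ p| ≤ ε := by
        rw [hv, abs_mul, abs_of_nonneg (ha01 _).1]
        refine (mul_le_of_le_one_left (abs_nonneg _) (ha01 _).2).trans ?_
        nlinarith [abs_nonneg (pd (EuclideanSpace.single i (1 : ℝ)) ζ p.2)]
      have b3 : |weakGrad G p.1 i * pd (ev i) χ p| ≤ ε := by
        by_cases h0 : a p.1 = 0
        · rw [hv, h0]; simpa using hε.le
        · have h1 : ‖p.1‖ ≤ Ra := mem_closedBall_zero_iff.1 (hRa (subset_tsupport _ h0))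
          rw [hv, abs_mul, abs_mul, abs_of_nonneg (ha01 _).1]
          refine (mul_le_mul ((hp i h1).trans (hMs i)) (mul_le_of_le_one_left (abs_nonneg _)
            (ha01 _).2) (by have := (ha01 p.1).1; positivity) hM1).trans ?_
          nlinarith [abs_nonneg (pd (EuclideanSpace.single i (1 : ℝ)) ζ p.2)]
      have s1 : pd (ex i) χ p ^ 2 ≤ ε := by
        rw [← sq_abs]; nlinarith [abs_nonneg (pd (ex i) χ p)]
      have s2 : pd (ev i) χ p ^ 2 ≤ ε := by
        rw [← sq_abs]; nlinarith [abs_nonneg (pd (ev i) χ p)]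
      have s3 : χ p * (weakGrad G p.1 i * pd (ev i) χ p) ≤ ε := by
        refine (le_abs_self _).trans ?_
        rw [abs_mul, abs_of_nonneg (hχ01 p).1]
        exact (mul_le_of_le_one_left (abs_nonneg _) (hχ01 p).2).trans b3
      -- The square shows `vᵢ² χ² / 4 + χ vᵢ ∂_{x_i} χ ≥ -(∂_{x_i} χ)²`. This and the two remaining
      -- terms cost `ε` each.
      nlinarith [sq_nonneg (p.2 i * χ p / 2 + pd (ex i) χ p)]
    have hsum := Finset.sum_le_sum hterm
    rw [Finset.sum_const, Finset.card_univ, Fintype.card_fin, nsmul_eq_mul, Finset.sum_sub_distrib,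
      Finset.sum_add_distrib, ← Finset.sum_mul, ← Finset.mul_sum, ← Finset.sum_div,
      ← EuclideanSpace.real_norm_sq_eq, Finset.sum_sub_distrib] at hsum
    simp only [hc, transport]
    nlinarith [sq_nonneg (χ p)]
  have hhi : Integrable fun p => h p ^ 2 := hh.integrable_sq
  have hχi : Integrable fun p => χ p ^ 2 * h p ^ 2 := by
    refine hhi.bdd_mul (c := 1) (hχ.continuous.pow 2).aestronglyMeasurable (ae_of_all _ fun p => ?_)
    rw [Real.norm_of_nonneg (sq_nonneg _)]
    exact pow_le_one₀ (hχ01 p).1 (hχ01 p).2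
  have h1 : (∫ p, χ p ^ 2 * h p ^ 2) - 3 * d * ε * ∫ p, h p ^ 2 ≤ ∫ p, c p * h p ^ 2 := by
    rw [← integral_const_mul, ← integral_sub hχi (hhi.const_mul _)]
    refine integral_mono_ae (hχi.sub (hhi.const_mul _)) hci (hle.mono fun p hp => ?_)
    simp only [← sub_mul]
    exact mul_le_mul_of_nonneg_right hp (sq_nonneg _)
  have h2 := integral_energy_nonpos hG hh hT hχ
  have h3 : ∫ p in Metric.closedBall (0 : Phase d) N, h p ^ 2 ≤ ∫ p, χ p ^ 2 * h p ^ 2 := by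
    rw [← integral_indicator Metric.isClosed_closedBall.measurableSet]
    refine integral_mono (hhi.indicator Metric.isClosed_closedBall.measurableSet) hχi fun p => ?_
    by_cases hm : p ∈ Metric.closedBall (0 : Phase d) N
    · rw [indicator_of_mem hm]
      have hN := mem_closedBall_zero_iff.1 hm
      simp [hχdef, ha1 _ ((norm_fst_le p).trans hN), hζ1 _ ((norm_snd_le p).trans hN)]
    · rw [indicator_of_notMem hm]
      positivity
  linarith

/-- A square integrable distributional solution of the adjoint conjugated equation vanishes. -/
lemma ae_eq_zero_of_integral_mul_conjOp (hG : AssumptionA1 G) {l : ℝ} (hl : d / 2 + 1 ≤ l)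
    (hh : MemLp h 2 volume) (hT : ∀ ψ, IsTest ψ → ∫ q, h q * conjOp G l ψ q = 0) :
    h =ᵐ[volume] 0 := by
  have hhi : Integrable fun p => h p ^ 2 := hh.integrable_sq
  have h0 : ∀ N : ℕ, ∀ᵐ p, p ∈ Metric.closedBall (0 : Phase d) N → h p = 0 := fun N => by
    have hS : 0 ≤ ∫ p, h p ^ 2 := integral_nonneg fun p => sq_nonneg _
    have h1 : ∫ p in Metric.closedBall (0 : Phase d) N, h p ^ 2 = 0 := by
      refine le_antisymm ?_ (integral_nonneg fun p => sq_nonneg _)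
      have hlim : Tendsto (fun ε : ℝ => 3 * d * ε * ∫ p, h p ^ 2) (𝓝[>] 0) (𝓝 0) := by
        have : Tendsto (fun ε : ℝ => 3 * d * ε * ∫ p, h p ^ 2) (𝓝 0)
            (𝓝 (3 * d * 0 * ∫ p, h p ^ 2)) := Continuous.tendsto (by fun_prop) 0
        simp only [mul_zero, zero_mul] at this
        exact this.mono_left nhdsWithin_le_nhds
      refine ge_of_tendsto hlim ?_
      filter_upwards [Ioc_mem_nhdsGT (zero_lt_one' ℝ)] with ε hε
      exact integral_ball_sq_le hG hl hh hT N hε.1 hε.2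
    have h2 := (integral_eq_zero_iff_of_nonneg (fun p => sq_nonneg (h p)) hhi.integrableOn).1 h1
    rw [EventuallyEq, ae_restrict_iff' Metric.isClosed_closedBall.measurableSet] at h2
    exact h2.mono fun p hp hm => by simpa using hp hm
  filter_upwards [ae_all_iff.2 h0] with p hp
  obtain ⟨N, hN⟩ := exists_nat_ge ‖p‖
  exact hp N (mem_closedBall_zero_iff.2 hN)

/-- The range of `l - 𝓛*` on test functions is dense for large `l`. -/
lemma eq_zero_of_orthogonal_range (hG : AssumptionA1 G) {l : ℝ} (hl : d / 2 + 1 ≤ l) (f : Y G)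
    (hf : ∀ φ, IsTest φ → ∫ p, f p * (l * φ p - Lstar G φ p) * wt G p = 0) : f = 0 := by
  -- Half of the weight `exp(-H)` goes into `h`, so `f ∈ L²_μ` becomes `h ∈ L²` for Lebesgue
  -- measure.
  set h : Phase d → ℝ := fun p => f p * Real.exp (-(hamiltonian G p / 2)) with hh
  have hfm : AEStronglyMeasurable f volume :=
    (Lp.aestronglyMeasurable f).mono_ac (volume_absolutelyContinuous_gibbs hG)
  have hhm : AEStronglyMeasurable h volume := hfm.mul
    ((locBdd_hamiltonian hG).comp_continuous (f := fun s => Real.exp (-(s / 2))) (by fun_prop)).1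
  have hh2 : MemLp h 2 volume := by
    rw [memLp_two_iff_integrable_sq hhm]
    have h1 := (integrable_gibbs_iff hG).1 (Lp.memLp f).integrable_sq
    refine h1.congr (ae_of_all _ fun p => ?_)
    simp only [hh, mul_pow, wt]
    rw [← Real.exp_nat_mul]
    congr 2
    push_cast
    ring
  have h0 := ae_eq_zero_of_integral_mul_conjOp hG hl hh2 fun ψ hψ =>
    integral_mul_conjOp_eq_zero hG (hh2.locallyIntegrable one_le_two) hf hψ
  refine Lp.ext ?_
  filter_upwards [gibbs_absolutelyContinuous.ae_le h0, Lp.coeFn_zero ℝ 2 (gibbs G)] with p h1 h2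
  rw [h2]
  simpa [hh] using h1

end Uniqueness

/-! ### Surjectivity and extension by density -/

section Range

variable {H : Type*} [NormedAddCommGroup H] [InnerProductSpace ℝ H] [CompleteSpace H]

/-- If `𝒢` is a closed dissipative graph and no nonzero vector is orthogonal to the range of `l - 𝒢`, then
`l - 𝒢` is onto. -/
lemma exists_smul_sub_eq_of_orthogonal {𝒢 : Submodule ℝ (H × H)} (hc : IsClosed (𝒢 : Set (H × H)))
    (hdiss : ∀ y z, (y, z) ∈ 𝒢 → ⟪z, y⟫_ℝ ≤ 0) {l : ℝ} (hl : 0 < l)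
    (horth : ∀ f, (∀ y z, (y, z) ∈ 𝒢 → ⟪l • y - z, f⟫_ℝ = 0) → f = 0) (h : H) :
    ∃ y z, (y, z) ∈ 𝒢 ∧ l • y - z = h := by
  have : CompleteSpace 𝒢 := hc.completeSpace_coe
  let T : 𝒢 →L[ℝ] H := (l • ContinuousLinearMap.fst ℝ H H - ContinuousLinearMap.snd ℝ H H) ∘L
    𝒢.subtypeL
  have hT : ∀ q : 𝒢, T q = l • q.1.1 - q.1.2 := fun q => rfl
  -- Dissipativity bounds `y` by `T (y, z)`, and then `z = l y - T (y, z)`. Being bounded below on a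
  -- complete space, `T` has closed range.
  have hanti : AntilipschitzWith (Real.toNNReal (l⁻¹ + 2)) T := by
    refine T.antilipschitz_of_bound fun q => ?_
    have h1 := mul_norm_le_of_inner_nonpos (hdiss q.1.1 q.1.2 q.2) l
    rw [← hT] at h1
    have h2 : ‖q.1.2‖ ≤ 2 * ‖T q‖ := by
      have e : q.1.2 = l • q.1.1 - T q := by rw [hT]; abel
      have h3 := norm_sub_le (l • q.1.1) (T q)
      rw [← e, norm_smul, Real.norm_of_nonneg hl.le] at h3
      linarith
    have h4 : ‖q.1.1‖ ≤ l⁻¹ * ‖T q‖ := by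
      rw [inv_mul_eq_div, le_div_iff₀ hl]
      linarith
    have hp : 0 ≤ l⁻¹ := (inv_pos.2 hl).le
    rw [Real.coe_toNNReal _ (by positivity), Submodule.coe_norm, Prod.norm_def]
    have h5 := norm_nonneg (T q)
    refine max_le (h4.trans ?_) (h2.trans ?_)
    · nlinarith
    · nlinarith [mul_nonneg hp h5]
  have hcl : IsClosed (T.range : Set H) := hanti.isClosed_range T.uniformContinuous
  have hbot : T.rangeᗮ = ⊥ := by
    refine (Submodule.eq_bot_iff _).2 fun f hf => horth f fun y z hyz => ?_
    exact (Submodule.mem_orthogonal _ _).1 hf _ ⟨⟨(y, z), hyz⟩, rfl⟩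
  have htop : T.range = ⊤ := by
    rw [← hcl.submodule_topologicalClosure_eq, Submodule.topologicalClosure_eq_top_iff, hbot]
  obtain ⟨q, hq⟩ : h ∈ T.range := htop ▸ Submodule.mem_top
  exact ⟨q.1.1, q.1.2, q.2, hq⟩

/-- Continuous extension of `f ↦ ι n`, `(f, n) ∈ 𝒩`. -/
lemma exists_clm_of_norm_le {F : Type*} [NormedAddCommGroup F] [NormedSpace ℝ F] [CompleteSpace F]
    {𝒩 : Submodule ℝ (H × H)} {ι : H →L[ℝ] F} (hd : ∀ c, ∀ ε > 0, ∃ f n, (f, n) ∈ 𝒩 ∧ ‖f - c‖ < ε)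
    {C : ℝ} (hC : ∀ q : 𝒩, ‖ι q.1.2‖ ≤ C * ‖q.1.1‖) :
    ∃ B : H →L[ℝ] F, ∀ f n, (f, n) ∈ 𝒩 → B f = ι n := by
  let e : 𝒩 →ₗ[ℝ] H := (LinearMap.fst ℝ H H).comp 𝒩.subtype
  let f : 𝒩 →ₗ[ℝ] F := ι.toLinearMap.comp ((LinearMap.snd ℝ H H).comp 𝒩.subtype)
  have he : DenseRange e := Metric.dense_iff.2 fun c ε hε => by
    obtain ⟨a, n, h, hlt⟩ := hd c ε hε
    exact ⟨a, by rwa [mem_ball_iff_norm], ⟨(a, n), h⟩, rfl⟩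
  exact ⟨f.extendOfNorm e, fun a n h =>
    LinearMap.extendOfNorm_eq (f := f) (e := e) he ⟨C, hC⟩ ⟨(a, n), h⟩⟩

end Range

/-! ### Maximal dissipativity, the adjoint, and boundedness of `N` -/

section Adjoint

variable {d : ℕ} {G α : E d → ℝ}

/-- The threshold `d/2 + 1` is the one required by the energy argument: conjugation by `exp(H/2)`
costs `d/2`, and the remaining `1` controls `‖h‖²`. -/
lemma isMDissipative_opA (hG : AssumptionA1 G) : IsMDissipative (opA G) (d / 2 + 1) := by
  have hdiss : ∀ y z, (y, z) ∈ (opA G).graph → ⟪z, y⟫_ℝ ≤ 0 := fun y z hyz => by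
    obtain ⟨g, hg⟩ := (isDissipationGraph hG).exists_mem y z hyz
    have := (isDissipationGraph hG).norm_sq y z g hg
    nlinarith [sq_nonneg ‖g‖]
  have hp : (0 : ℝ) < d / 2 + 1 := by positivity
  refine ⟨hp, hdiss, fun l hl h => ?_, dense_domain_opA hG⟩
  refine exists_smul_sub_eq_of_orthogonal ?_ hdiss (hp.trans_le hl) (fun f hf => ?_) h
  · rw [graph_opA hG]
    exact (graphLstar G).isClosed_topologicalClosure
  · refine eq_zero_of_orthogonal_range hG hl f fun φ hφ => ?_
    obtain ⟨y, z, g, hmem, hy, hz, -⟩ := exists_mem_coreGraph hG hφ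
    have hyz : (y, z) ∈ (opA G).graph := by
      rw [graph_opA hG]
      exact Submodule.le_topologicalClosure _ (mem_graphLstar_of_mem_coreGraph hmem)
    have h1 := hf y z hyz
    have he : (l • y - z : Y G) =ᵐ[gibbs G] fun p => l * φ p - Lstar G φ p := by
      filter_upwards [Lp.coeFn_sub (l • y) z, Lp.coeFn_smul l y, hy, hz] with p h1 h2 h3 h4
      rw [h1, Pi.sub_apply, h2, Pi.smul_apply, h3, h4, smul_eq_mul]
    rw [real_inner_comm, inner_Y hG (EventuallyEq.refl _ f) he] at h1
    exact (mul_eq_zero.1 h1).resolve_left (inv_ne_zero (partitionFn_pos hG).ne')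

lemma reflY_mem_graph_adjoint (hG : AssumptionA1 G) {a b : Y G} (h : (a, b) ∈ (opA G).graph) :
    (reflY G a, reflY G b) ∈ (opA G)†.graph := by
  rw [mem_graph_adjoint_iff (dense_domain_opA hG)]
  intro y z hyz
  rw [graph_opA hG] at h hyz
  exact inner_closure_graphLstar hG hyz h

lemma exists_smul_dIncl_sub_eq (hG : AssumptionA1 G) (h : Y G) :
    ∃ x : DAdj G, ((d : ℝ) / 2 + 1) • dIncl G x - dAdj G x = h := by
  obtain ⟨y, z, hyz, he⟩ := (isMDissipative_opA hG).range _ le_rfl (reflY G h)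
  refine ⟨mkDAdj (reflY_mem_graph_adjoint hG hyz), ?_⟩
  rw [dIncl_mkDAdj, dAdj_mkDAdj, ← map_smul, ← map_sub, he, reflY_reflY]

/-- The adjoint of `A` is conjugate to `A` by the reflection of velocities. -/
lemma reflY_mem_graph_of_mem_adjoint (hG : AssumptionA1 G) {a b : Y G}
    (h : (a, b) ∈ (opA G)†.graph) : (reflY G a, reflY G b) ∈ (opA G).graph := by
  set l : ℝ := (d : ℝ) / 2 + 1
  have hA := isMDissipative_opA hG
  -- The reflected graph of `A` is contained in that of `A†`, and `l` minus the reflected operator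
  -- is onto. Thus some `reflY G y` has the same image under `l - A†` as `a`. The difference is
  -- orthogonal to the range of `l - A`, hence zero.
  obtain ⟨y, z, hyz, he⟩ := hA.range l le_rfl (l • reflY G a - reflY G b)
  have hmem := Submodule.sub_mem _ h (reflY_mem_graph_adjoint hG hyz)
  have he' : l • reflY G y - reflY G z = l • a - b := by
    rw [← map_smul, ← map_sub, he, map_sub, map_smul, reflY_reflY, reflY_reflY]
  have hb : b - reflY G z = l • (a - reflY G y) := by
    rw [smul_sub, sub_eq_sub_iff_add_eq_add, add_comm, ← sub_eq_sub_iff_add_eq_add]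
    rw [sub_eq_sub_iff_add_eq_add] at he' ⊢
    rw [he', add_comm]
  have h0 : a - reflY G y = 0 := by
    obtain ⟨y', z', h', e'⟩ := hA.range l le_rfl (a - reflY G y)
    have h1 := (mem_graph_adjoint_iff hA.dense).1 hmem y' z' h'
    rw [hb, real_inner_smul_right, ← real_inner_smul_left] at h1
    have h2 : ⟪l • y' - z', a - reflY G y⟫_ℝ = 0 := by rw [inner_sub_left, h1, sub_self]
    rw [e'] at h2
    exact inner_self_eq_zero.1 h2
  rw [h0, smul_zero] at hb
  rw [sub_eq_zero.1 h0, sub_eq_zero.1 hb, reflY_reflY, reflY_reflY]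
  exact hyz

lemma reflY_mem_ctrlGraph {f n : Y G} (h : (f, n) ∈ ctrlGraph G α) :
    (reflY G f, -reflY G n) ∈ ctrlGraph G α := by
  obtain ⟨φ, hφ, h1, h2⟩ := h
  refine ⟨fun p => φ (reflV p), hφ.comp_reflV, reflY_ae_eq h1, ?_⟩
  filter_upwards [Lp.coeFn_neg (reflY G n), reflY_ae_eq h2] with p h3 h4
  rw [h3, Pi.neg_apply, h4]
  exact (ctrl_comp_reflV hφ.differentiable p).symm

/-- The norm in `Y_{-1}` is tested with elements `x` of `𝓓(A†)`. Reflection turns `x` into an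
element of the domain of `A`, whose velocity gradient satisfies `‖g‖² = -⟪A† x, x⟫ ≤ ‖x‖²` in the
graph norm. The domination of the control by the gradient then gives the bound. -/
lemma exists_norm_emb_le (hG : AssumptionA1 G) (hα : AssumptionA2 α) :
    ∃ C : ℝ, ∀ q : ctrlGraph G α, ‖emb G q.1.2‖ ≤ C * ‖q.1.1‖ := by
  obtain ⟨C, hC⟩ := isDominated_ctrlGraph hG hα
  refine ⟨C, fun q => ContinuousLinearMap.opNorm_le_bound _ (by positivity) fun x => ?_⟩
  have hx := reflY_mem_graph_of_mem_adjoint hG (dIncl_dAdj_mem x)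
  obtain ⟨g, hg⟩ := (isDissipationGraph hG).exists_mem _ _ hx
  have h1 := hC _ _ (reflY_mem_ctrlGraph q.2) _ _ _ hg
  rw [inner_neg_left, abs_neg, LinearIsometry.inner_map_map, LinearIsometry.norm_map] at h1
  have h2 := (isDissipationGraph hG).norm_sq _ _ _ hg
  rw [LinearIsometry.inner_map_map] at h2
  have h3 : ‖g‖ ≤ ‖x‖ := by
    refine le_of_sq_le_sq ?_ (norm_nonneg _)
    rw [h2, norm_sq_DAdj]
    have h4 := (neg_le_abs _).trans (abs_real_inner_le_norm (dAdj G x) (dIncl G x))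
    nlinarith [sq_nonneg (‖dAdj G x‖ - ‖dIncl G x‖)]
  change |⟪q.1.2, dIncl G x⟫_ℝ| ≤ _
  exact h1.trans (mul_le_mul_of_nonneg_left h3 (by positivity))

theorem isCtrlExt_opN (hG : AssumptionA1 G) (hα : AssumptionA2 α) :
    IsCtrlExt G α (opN G α) := by
  have hex : ∃ B, IsCtrlExt G α B := by
    obtain ⟨C, hC⟩ := exists_norm_emb_le hG hα
    obtain ⟨B, hB⟩ := exists_clm_of_norm_le (F := Yneg G) (𝒩 := ctrlGraph G α) (ι := emb G)
      (fun c ε hε => exists_mem_ctrlGraph hG hα c hε) hC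
    refine ⟨B, fun φ hφ => ?_⟩
    have hf := (hφ.memLp_gibbs hG).coeFn_toLp
    have hn := (memLp_ctrl hG hα hφ).coeFn_toLp
    exact ⟨_, _, hf, hn, hB _ _ ⟨φ, hφ, hf, hn⟩⟩
  rw [opN, dif_pos hex]
  exact hex.choose_spec

/-- The classes in `Y` of `φ` and of `ctrl α φ` are determined by any common test function, so the
chosen extension agrees with every pair of the graph. -/
lemma opN_eq_emb (hG : AssumptionA1 G) (hα : AssumptionA2 α) {f n : Y G}
    (h : (f, n) ∈ ctrlGraph G α) : opN G α f = emb G n := by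
  obtain ⟨φ, hφ, h1, h2⟩ := h
  obtain ⟨f', n', h1', h2', he⟩ := isCtrlExt_opN hG hα φ hφ
  have e1 : f = f' := Lp.ext (h1.trans h1'.symm)
  have e2 : n = n' := Lp.ext (h2.trans h2'.symm)
  rw [e1, e2, he]

end Adjoint

end KFP

end

/-! ### The well-posedness theorem -/

theorem proposition3p3 {d : ℕ} (G α : KFP.E d → ℝ)
    (hG : KFP.AssumptionA1 G) (hα : KFP.AssumptionA2 α) :
    KFP.IsCtrlExt G α (KFP.opN G α) ∧
    ∃ (C₁ : ℝ≥0) (C₂ C₃ : ℝ → ℝ≥0),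
      ∀ (y₀ : KFP.Y G) (w : ℝ → KFP.Y G), KFP.MemL2Loc w →
        ∃ (y : ℝ → KFP.Y G) (gradvy : ℝ → KFP.Yd G) (ydot : ℝ → KFP.Yneg G),
          -- `y` is the unique solution in `Y_{-1}`, given by the variation of constants formula
          KFP.IsSolution G α y₀ w (fun t => KFP.emb G (y t)) ∧
          (∀ u, KFP.IsSolution G α y₀ w u → ∀ t ≥ 0, u t = KFP.emb G (y t)) ∧
          KFP.IsMildSolution G α y₀ w y ∧
          -- `∇_v y ∈ L²_loc(0,∞;Y^d)`
          (∀ᵐ t ∂volume.restrict (Ioi (0 : ℝ)), KFP.IsWeakGradV (y t) (gradvy t)) ∧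
          KFP.MemL2Loc gradvy ∧
          -- `ydot` is the weak time derivative of `y` in `Y_{-1}`
          KFP.IsWeakTimeDeriv (fun t => KFP.emb G (y t)) ydot ∧
          KFP.MemL2Loc ydot ∧
          ∀ T > 0,
            MemLp y ∞ (volume.restrict (Ioo 0 T)) ∧
            max (eLpNorm y ∞ (volume.restrict (Ioo 0 T)))
                (eLpNorm gradvy 2 (volume.restrict (Ioo 0 T))) ≤
              C₁ * (‖y₀‖ₑ + eLpNorm w 2 (volume.restrict (Ioo 0 T))) ∧
            -- the norm of `V_v` at time `t` is `(‖y(t)‖² + ‖∇_v y(t)‖²)^{1/2}`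
            eLpNorm (fun t => WithLp.toLp 2 (y t, gradvy t)) 2 (volume.restrict (Ioo 0 T)) ≤
              C₂ T * (‖y₀‖ₑ + eLpNorm w 2 (volume.restrict (Ioo 0 T))) ∧
            eLpNorm ydot 2 (volume.restrict (Ioo 0 T)) ≤
              C₃ T * (‖y₀‖ₑ + eLpNorm w 2 (volume.restrict (Ioo 0 T))) := by
  obtain ⟨C, hC⟩ := KFP.isDominated_ctrlGraph hG hα
  exact ⟨KFP.isCtrlExt_opN hG hα, KFP.exists_solution_opA (KFP.isMDissipative_opA hG)
    (KFP.exists_smul_dIncl_sub_eq hG) (KFP.isDissipationGraph hG) hC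
    (fun _ _ h => KFP.opN_eq_emb hG hα h) (fun c _ hε => KFP.exists_mem_ctrlGraph hG hα c hε)
    (fun _ _ _ h => KFP.isWeakGradV_of_mem_dissGraph hG h)
    (fun _ _ _ _ h hu hD => KFP.isWeakGradV_of_tendsto hG h hu hD)⟩
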